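/- Let $M$ be a smooth finite-dimensional manifold and $\pi:E\to M$ a smooth real vector bundle of finite rank. Let $\mathcal M=\Pi E=(M,\mathcal O)$ be the associated supermanifold, whose superfunctions are $\mathcal O=\Gamma_{\Lambda E^*}$, and let $\mathcal T=\mathrm{Der}_{\mathbb R}(\mathcal O)$ be its tangent sheaf. An even (resp. odd) Riemannian metric on $\mathcal M$ is an even (resp. odd) supersymmetric $\mathcal O$-linear morphism of sheaves $g:\mathcal T\otimes_{\mathcal O}\mathcal T\to\mathcal O$ (with the Koszul signs $g(fX,Y)=(-1)^{|g||f|}f\,g(X,Y)$) that is non-degenerate, i.e. $X\mapsto g(X,\cdot)$ is an isomorphism from $\mathcal T$ onto $\Omega^1=\mathrm{Hom}_{\mathcal O}(\mathcal T,\mathcal O)$ (resp. onto $\Pi\Omega^1$). Let $\mathcal F=\Gamma_{\mathbb R\oplus E^*}\subset\mathcal O$, let $pr:\mathcal O\to\mathcal F$ be the projection that removes the components of degree $\ge 2$, and for $s=s_0+s_1\in\mathcal F(U)$ let $\psi(s)$ be the function $e\mapsto s_0(\pi(e))+s_1(\pi(e))(e)$ on $\pi^{-1}(U)$. Let $\mathcal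 L_{\bar 0}(U)$ be the space of even $X\in\mathcal T(U)$ that preserve $\mathcal F$; for such $X$ let $\Psi(X)$ be the vector field on $\pi^{-1}(U)\subset E$ with $\Psi(X)(\psi(s))=\psi(X(s))$ for all $s\in\mathcal F$. For every even or odd Riemannian metric $g$ on $\mathcal M$ there is exactly one smooth symmetric bilinear form $g^{TE}$ on the tangent bundle of the manifold $E$ such that $$g^{TE}(\Psi(X),\Psi(Y))=\psi\big(pr(g(X,Y))\big)\quad\text{on }\pi^{-1}(U)$$ for all open $U\subset M$ and all $X,Y\in\mathcal L_{\bar 0}(U)$. Moreover: 1. if $g$ is odd, then $g^{TE}$ is a pseudo-Riemannian metric on $E$, i.e. it is non-degenerate at every point of $E$; 2. if $g$ is even and the odd dimension of $\mathcal M$, i.e. the rank of $E$, is positive, then $g^{TE}$ is degenerate at every point of $E$: for every $e\in E$ there is a non-zero $v\in T_eE$ with $g^{TE}(v,w)=0$ for all $w\in T_eE$. -/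

import Mathlib

open Bundle Manifold TopologicalSpace
open scoped ContDiff

noncomputable section

namespace SuperGeom

section ExteriorAlgebra

variable {V W : Type*} [AddCommGroup V] [Module ℝ V] [AddCommGroup W] [Module ℝ W]

/-- The `ℤ/2`-homogeneous part of parity `i` of the exterior algebra `Λ V`. -/
abbrev extParity (V : Type*) [AddCommGroup V] [Module ℝ V] (i : ZMod 2) :
    Submodule ℝ (ExteriorAlgebra ℝ V) :=
  CliffordAlgebra.evenOdd (0 : QuadraticForm ℝ V) i

/-- The sign `(-1) ^ (i * j)` of the Koszul rule. -/
def koszul (i j : ZMod 2) : ℝ := if i = 1 ∧ j = 1 then -1 else 1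

/-- The even (`i = 0`), resp. odd (`i = 1`), component of an element of `Λ V`, as a linear map:
half the sum, resp. difference, of the identity and the parity involution. -/
def extProj (V : Type*) [AddCommGroup V] [Module ℝ V] (i : ZMod 2) :
    ExteriorAlgebra ℝ V →ₗ[ℝ] ExteriorAlgebra ℝ V :=
  (1 / 2 : ℝ) • (LinearMap.id + koszul i 1 •
    (CliffordAlgebra.involute (Q := (0 : QuadraticForm ℝ V))).toLinearMap)

theorem zmod2_cases (i : ZMod 2) : i = 0 ∨ i = 1 := by
  revert i; decide

theorem extProj_mem (i : ZMod 2) (a : ExteriorAlgebra ℝ V) : extProj V i a ∈ extParity V i := by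
  have hsup : a ∈ extParity V 0 ⊔ extParity V 1 := by
    rw [(CliffordAlgebra.evenOdd_isCompl (0 : QuadraticForm ℝ V)).sup_eq_top]; trivial
  obtain ⟨b, hb, c, hc, rfl⟩ := Submodule.mem_sup.1 hsup
  have h0 := CliffordAlgebra.involute_eq_of_mem_even hb
  have h1 := CliffordAlgebra.involute_eq_of_mem_odd hc
  rcases zmod2_cases i with rfl | rfl
  · have : extProj V 0 (b + c) = b := by
      simp only [extProj, koszul, LinearMap.smul_apply, LinearMap.add_apply, LinearMap.id_apply,
        AlgHom.toLinearMap_apply, map_add, h0, h1]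
      norm_num
      module
    rwa [this]
  · have : extProj V 1 (b + c) = c := by
      simp only [extProj, koszul, LinearMap.smul_apply, LinearMap.add_apply, LinearMap.id_apply,
        AlgHom.toLinearMap_apply, map_add, h0, h1]
      norm_num
      module
    rwa [this]

theorem extProj_add (a : ExteriorAlgebra ℝ V) : extProj V 0 a + extProj V 1 a = a := by
  simp only [extProj, koszul, LinearMap.smul_apply, LinearMap.add_apply, LinearMap.id_apply,
    AlgHom.toLinearMap_apply]
  norm_num
  module

theorem map_extProj (φ : V →ₗ[ℝ] W) (i : ZMod 2) (a : ExteriorAlgebra ℝ V) :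
    ExteriorAlgebra.map φ (extProj V i a) = extProj W i (ExteriorAlgebra.map φ a) := by
  have key : (ExteriorAlgebra.map φ).comp
        (CliffordAlgebra.involute (Q := (0 : QuadraticForm ℝ V))) =
      (CliffordAlgebra.involute (Q := (0 : QuadraticForm ℝ W))).comp (ExteriorAlgebra.map φ) := by
    apply ExteriorAlgebra.hom_ext
    ext v
    have h1 : CliffordAlgebra.involute (ExteriorAlgebra.ι ℝ v) = -ExteriorAlgebra.ι ℝ v :=
      CliffordAlgebra.involute_ι v
    have h2 : CliffordAlgebra.involute (ExteriorAlgebra.ι ℝ (φ v)) = -ExteriorAlgebra.ι ℝ (φ v) :=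
      CliffordAlgebra.involute_ι (φ v)
    simp [h1, h2]
  have key' := congrArg (fun ψ => ψ a) key
  simp only [AlgHom.comp_apply] at key'
  simp only [extProj, LinearMap.smul_apply, LinearMap.add_apply, LinearMap.id_apply,
    AlgHom.toLinearMap_apply, map_add, map_smul, key']

theorem ext_supercomm {i j : ZMod 2} {a b : ExteriorAlgebra ℝ V} (ha : a ∈ extParity V i)
    (hb : b ∈ extParity V j) : a * b = koszul i j • (b * a) := by
  have h := CliffordAlgebra.map_mul_map_of_isOrtho_of_mem_evenOdd
    (QuadraticMap.Isometry.id (0 : QuadraticForm ℝ V))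
    (QuadraticMap.Isometry.id (0 : QuadraticForm ℝ V)) (fun x y => by simp [QuadraticMap.IsOrtho]) a b ha hb
  simp only [CliffordAlgebra.map_id, AlgHom.id_apply] at h
  rw [h]
  rcases zmod2_cases i with rfl | rfl <;> rcases zmod2_cases j with rfl | rfl <;> simp [koszul]

end ExteriorAlgebra

section Supermanifold

variable {M : Type*} [TopologicalSpace M]
  (H : Type*) [NormedAddCommGroup H] [NormedSpace ℝ H] [ChartedSpace H M]
  (F : Type*) [NormedAddCommGroup F] [NormedSpace ℝ F] [FiniteDimensional ℝ F]
  (E : M → Type*) [∀ x, AddCommGroup (E x)] [∀ x, Module ℝ (E x)] [∀ x, TopologicalSpace (E x)]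
  [TopologicalSpace (TotalSpace F E)] [FiberBundle F E] [VectorBundle ℝ F E]

/-- The fibre `Λ E_x^*` at `x` of the exterior bundle of the dual bundle of `E`. -/
abbrev ExtFiber (x : M) : Type _ := ExteriorAlgebra ℝ (Module.Dual ℝ (E x))

/-- The isomorphism `Λ E_x^* → Λ F^*` induced by the local trivialization of `E` around `x₀`
(for `x` in the domain of that trivialization). -/
def localRep (x₀ x : M) : ExtFiber E x →ₐ[ℝ] ExteriorAlgebra ℝ (Module.Dual ℝ F) :=
  ExteriorAlgebra.map ((trivializationAt F E x₀).symmₗ ℝ x).dualMap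

/-- Smoothness of a section `s` of `ΛE^* → M` over an open set `U`: around each point, all
components of `s` with respect to a local trivialization of `E` are smooth. -/
def IsSmoothSection (U : Opens M) (s : ∀ x : U, ExtFiber E (x : M)) : Prop :=
  ∀ (x₀ : U) (ℓ : Module.Dual ℝ (ExteriorAlgebra ℝ (Module.Dual ℝ F))),
    ContMDiffAt 𝓘(ℝ, H) 𝓘(ℝ, ℝ) ∞ (fun x : U => ℓ (localRep F E (x₀ : M) (x : M) (s x))) x₀

variable {F} in
theorem extAlg_finite : Module.Finite ℝ (ExteriorAlgebra ℝ (Module.Dual ℝ F)) :=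
  Module.Finite.of_basis (Module.finBasis ℝ (Module.Dual ℝ F)).ExteriorAlgebra

/-- The smooth sections of `ΛE^*` over `U`, as a subalgebra (for the pointwise exterior product) of
the algebra of all sections. -/
def smoothSections (U : Opens M) : Subalgebra ℝ (∀ x : U, ExtFiber E (x : M)) where
  carrier := {s | IsSmoothSection H F E U s}
  add_mem' {a b} ha hb x₀ ℓ := by
    have := (ha x₀ ℓ).add (hb x₀ ℓ)
    refine this.congr_of_eventuallyEq (Filter.Eventually.of_forall fun x => ?_)
    simp
  algebraMap_mem' r x₀ ℓ := by
    have : (fun x : U => ℓ (localRep F E (x₀ : M) (x : M)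
        ((algebraMap ℝ (∀ x : U, ExtFiber E (x : M)) r) x))) =
        fun _ => ℓ (algebraMap ℝ _ r) := by
      funext x
      simp [Pi.algebraMap_apply]
    rw [this]
    exact contMDiffAt_const
  mul_mem' {a b} ha hb x₀ ℓ := by
    have := extAlg_finite (F := F)
    let B := Module.finBasis ℝ (ExteriorAlgebra ℝ (Module.Dual ℝ F))
    have : (fun x : U => ℓ (localRep F E (x₀ : M) (x : M) ((a * b) x))) =
        fun x : U => ∑ i, ∑ j, B.coord i (localRep F E (x₀ : M) (x : M) (a x)) *
          (B.coord j (localRep F E (x₀ : M) (x : M) (b x)) * ℓ (B i * B j)) := by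
      funext x
      rw [Pi.mul_apply, map_mul]
      conv_lhs => rw [← B.sum_repr (localRep F E (x₀ : M) (x : M) (a x)),
        ← B.sum_repr (localRep F E (x₀ : M) (x : M) (b x))]
      simp only [Finset.sum_mul, Finset.mul_sum, map_sum, smul_mul_assoc, mul_smul_comm, map_smul,
        smul_eq_mul, Module.Basis.coord_apply]
      rw [Finset.sum_comm]
      refine Finset.sum_congr rfl fun i _ => Finset.sum_congr rfl fun j _ => ?_
      ring
    rw [this]
    refine contMDiffAt_finsetSum fun i _ => contMDiffAt_finsetSum fun j _ => ?_
    exact (ha x₀ _).mul ((hb x₀ _).mul contMDiffAt_const)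

/-- The superalgebra `𝒪(U)` of superfunctions over `U` of the supermanifold `ΠE`: the smooth
sections of `ΛE^*` over `U`, with the pointwise exterior product. -/
def SuperFun (U : Opens M) : Type _ := smoothSections H F E U

instance (U : Opens M) : Ring (SuperFun H F E U) :=
  inferInstanceAs (Ring (smoothSections H F E U))

instance (U : Opens M) : Algebra ℝ (SuperFun H F E U) :=
  inferInstanceAs (Algebra ℝ (smoothSections H F E U))

/-- The superfunctions over `U` of parity `i`. -/
def superFunParity (U : Opens M) (i : ZMod 2) : Submodule ℝ (SuperFun H F E U) where
  carrier := {s | ∀ x : U, s.1 x ∈ extParity (Module.Dual ℝ (E (x : M))) i}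
  add_mem' ha hb x := add_mem (ha x) (hb x)
  zero_mem' _ := zero_mem _
  smul_mem' c _ ha x := Submodule.smul_mem _ c (ha x)

variable {H F E}

/-- Restriction of superfunctions. -/
def res {U V : Opens M} (h : V ≤ U) : SuperFun H F E U →ₐ[ℝ] SuperFun H F E V where
  toFun s := ⟨fun x => s.1 ⟨x.1, h x.2⟩, fun x₀ ℓ =>
    ContMDiffAt.comp (g := fun x : U => ℓ (localRep F E (x₀ : M) (x : M) (s.1 x))) x₀
      (s.2 ⟨x₀.1, h x₀.2⟩ ℓ) (contMDiff_inclusion h).contMDiffAt⟩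
  map_one' := rfl
  map_mul' _ _ := rfl
  map_zero' := rfl
  map_add' _ _ := rfl
  commutes' _ := rfl

/-- The component of parity `i` of a superfunction. -/
def parityPart {U : Opens M} (i : ZMod 2) (s : SuperFun H F E U) : SuperFun H F E U :=
  ⟨fun x => extProj _ i (s.1 x), fun x₀ ℓ => by
    have := s.2 x₀ (ℓ ∘ₗ extProj (Module.Dual ℝ F) i)
    simpa only [localRep, map_extProj, LinearMap.comp_apply] using this⟩

theorem parityPart_mem {U : Opens M} (i : ZMod 2) (s : SuperFun H F E U) :
    parityPart i s ∈ superFunParity H F E U i := fun _ => extProj_mem i _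

theorem parityPart_add {U : Opens M} (s : SuperFun H F E U) :
    parityPart 0 s + parityPart 1 s = s :=
  Subtype.ext (funext fun _ => extProj_add _)

theorem res_mem {U V : Opens M} (h : V ≤ U) {i : ZMod 2} {s : SuperFun H F E U}
    (hs : s ∈ superFunParity H F E U i) : res h s ∈ superFunParity H F E V i :=
  fun x => hs ⟨x.1, h x.2⟩

theorem superFun_mul_mem {U : Opens M} {i j : ZMod 2} {a b : SuperFun H F E U}
    (ha : a ∈ superFunParity H F E U i) (hb : b ∈ superFunParity H F E U j) :
    a * b ∈ superFunParity H F E U (i + j) :=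
  fun x => CliffordAlgebra.evenOdd_mul_le _ i j (Submodule.mul_mem_mul (ha x) (hb x))

theorem superFun_supercomm {U : Opens M} {i j : ZMod 2} {a b : SuperFun H F E U}
    (ha : a ∈ superFunParity H F E U i) (hb : b ∈ superFunParity H F E U j) :
    a * b = koszul i j • (b * a) :=
  Subtype.ext (funext fun x => ext_supercomm (ha x) (hb x))

variable (H F E)

/-- Families of `ℝ`-linear endomorphisms of `𝒪(V)`, indexed by the open sets `V ⊆ U`. -/
def EndFamily (U : Opens M) : Type _ := ∀ V : Set.Iic U, Module.End ℝ (SuperFun H F E V.1)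

instance (U : Opens M) : AddCommGroup (EndFamily H F E U) :=
  inferInstanceAs (AddCommGroup (∀ V : Set.Iic U, Module.End ℝ (SuperFun H F E V.1)))

instance (U : Opens M) : Module ℝ (EndFamily H F E U) :=
  inferInstanceAs (Module ℝ (∀ V : Set.Iic U, Module.End ℝ (SuperFun H F E V.1)))

@[simp] theorem EndFamily.add_apply {U : Opens M} (X Y : EndFamily H F E U) (V : Set.Iic U)
    (s : SuperFun H F E V.1) : (X + Y) V s = X V s + Y V s := rfl

@[simp] theorem EndFamily.zero_apply {U : Opens M} (V : Set.Iic U)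
    (s : SuperFun H F E V.1) : (0 : EndFamily H F E U) V s = 0 := rfl

@[simp] theorem EndFamily.smul_apply {U : Opens M} (c : ℝ) (X : EndFamily H F E U) (V : Set.Iic U)
    (s : SuperFun H F E V.1) : (c • X) V s = c • X V s := rfl

/-- The superderivations of parity `i` of the sheaf of superalgebras `𝒪|_U`. -/
def superDer (U : Opens M) (i : ZMod 2) : Submodule ℝ (EndFamily H F E U) where
  carrier := {X |
    (∀ (V W : Set.Iic U) (h : W.1 ≤ V.1) (s : SuperFun H F E V.1),
      res h (X V s) = X W (res h s)) ∧
    (∀ (V : Set.Iic U) (j : ZMod 2), ∀ s ∈ superFunParity H F E V.1 j,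
      X V s ∈ superFunParity H F E V.1 (i + j)) ∧
    (∀ (V : Set.Iic U) (j : ZMod 2), ∀ a ∈ superFunParity H F E V.1 j, ∀ b : SuperFun H F E V.1,
      X V (a * b) = X V a * b + koszul i j • (a * X V b))}
  add_mem' {X Y} hX hY := by
    refine ⟨fun V W h s => ?_, fun V j s hs => ?_, fun V j a ha b => ?_⟩
    · simp [hX.1 V W h s, hY.1 V W h s]
    · exact add_mem (hX.2.1 V j s hs) (hY.2.1 V j s hs)
    · simp only [EndFamily.add_apply, hX.2.2 V j a ha b, hY.2.2 V j a ha b, add_mul,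
        mul_add, smul_add]
      abel
  zero_mem' := by
    refine ⟨fun V W h s => by simp, fun V j s hs => zero_mem _, fun V j a ha b => by simp⟩
  smul_mem' c X hX := by
    refine ⟨fun V W h s => ?_, fun V j s hs => ?_, fun V j a ha b => ?_⟩
    · simp [hX.1 V W h s]
    · exact Submodule.smul_mem _ c (hX.2.1 V j s hs)
    · simp only [EndFamily.smul_apply, hX.2.2 V j a ha b, smul_add, smul_mul_assoc,
        mul_smul_comm, smul_comm c]

/-- The sections `𝒯(U)` over `U` of the tangent sheaf `𝒯 = Der_ℝ(𝒪)` of the supermanifold `ΠE`: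
sums of an even and an odd superderivation of `𝒪|_U`. -/
def tangentSheaf (U : Opens M) : Submodule ℝ (EndFamily H F E U) :=
  superDer H F E U 0 ⊔ superDer H F E U 1

variable {H F E}

/-- `X ∈ 𝒯(U)` is homogeneous of parity `i`. -/
def HasParity {U : Opens M} (X : tangentSheaf H F E U) (i : ZMod 2) : Prop :=
  X.1 ∈ superDer H F E U i

/-- Restriction of families of endomorphisms to a smaller open set. -/
def resFam {U V : Opens M} (h : V ≤ U) : EndFamily H F E U →ₗ[ℝ] EndFamily H F E V where
  toFun X W := X ⟨W.1, W.2.trans h⟩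
  map_add' _ _ := rfl
  map_smul' _ _ := rfl

theorem resFam_mem {U V : Opens M} (h : V ≤ U) {i : ZMod 2} {X : EndFamily H F E U}
    (hX : X ∈ superDer H F E U i) : resFam h X ∈ superDer H F E V i :=
  ⟨fun V W h' s => hX.1 ⟨V.1, V.2.trans h⟩ ⟨W.1, W.2.trans h⟩ h' s,
    fun V j s hs => hX.2.1 ⟨V.1, V.2.trans h⟩ j s hs,
    fun V j a ha b => hX.2.2 ⟨V.1, V.2.trans h⟩ j a ha b⟩

/-- Restriction of superderivations. -/
def resT {U V : Opens M} (h : V ≤ U) (X : tangentSheaf H F E U) : tangentSheaf H F E V :=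
  ⟨resFam h X.1, by
    obtain ⟨Y, hY, Z, hZ, hX⟩ := Submodule.mem_sup.1 X.2
    rw [← hX, map_add]
    exact Submodule.add_mem_sup (resFam_mem h hY) (resFam_mem h hZ)⟩

/-- Left multiplication of a family of endomorphisms by a superfunction. -/
def smulFam {U : Opens M} (f : SuperFun H F E U) (X : EndFamily H F E U) : EndFamily H F E U :=
  fun V => LinearMap.mulLeft ℝ (res V.2 f) ∘ₗ X V

theorem smulFam_mem {U : Opens M} {i k : ZMod 2} {f : SuperFun H F E U}
    (hf : f ∈ superFunParity H F E U k) {X : EndFamily H F E U} (hX : X ∈ superDer H F E U i) :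
    smulFam f X ∈ superDer H F E U (k + i) := by
  refine ⟨fun V W h s => ?_, fun V j s hs => ?_, fun V j a ha b => ?_⟩
  · simp only [smulFam, LinearMap.comp_apply, LinearMap.mulLeft_apply, map_mul, hX.1 V W h s]
    rfl
  · have := superFun_mul_mem (res_mem V.2 hf) (hX.2.1 V j s hs)
    rwa [← add_assoc] at this
  · have hc := superFun_supercomm (res_mem V.2 hf) ha
    simp only [smulFam, LinearMap.comp_apply, LinearMap.mulLeft_apply, hX.2.2 V j a ha b, mul_add,
      mul_smul_comm, ← mul_assoc, hc, smul_mul_assoc, smul_smul]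
    congr 2
    rcases zmod2_cases i with rfl | rfl <;> rcases zmod2_cases j with rfl | rfl <;>
      rcases zmod2_cases k with rfl | rfl <;> simp [koszul]

theorem smulFam_parts {U : Opens M} (f : SuperFun H F E U) (Y Z : EndFamily H F E U) :
    smulFam f (Y + Z) =
      (smulFam (parityPart 0 f) Y + smulFam (parityPart 1 f) Z) +
      (smulFam (parityPart 0 f) Z + smulFam (parityPart 1 f) Y) := by
  funext V
  ext1 s
  have hf : res V.2 f = res V.2 (parityPart 0 f) + res V.2 (parityPart 1 f) := by
    rw [← map_add, parityPart_add]
  simp only [smulFam, EndFamily.add_apply, LinearMap.comp_apply, LinearMap.mulLeft_apply, mul_add,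
    hf, add_mul]
  abel

theorem smulFam_mem_tangentSheaf {U : Opens M} (f : SuperFun H F E U) {X : EndFamily H F E U}
    (hX : X ∈ tangentSheaf H F E U) : smulFam f X ∈ tangentSheaf H F E U := by
  obtain ⟨Y, hY, Z, hZ, rfl⟩ := Submodule.mem_sup.1 hX
  have h00 := smulFam_mem (parityPart_mem 0 f) hY
  have h11 := smulFam_mem (parityPart_mem 1 f) hZ
  have h01 := smulFam_mem (parityPart_mem 0 f) hZ
  have h10 := smulFam_mem (parityPart_mem 1 f) hY
  rw [zero_add] at h00 h01
  rw [add_zero] at h10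
  rw [show (1 + 1 : ZMod 2) = 0 from by decide] at h11
  rw [smulFam_parts]
  exact Submodule.add_mem_sup (add_mem h00 h11) (add_mem h01 h10)

/-- The left `𝒪(U)`-multiplication on `𝒯(U)`: `(f X)(s) = f · X(s)`. -/
def smulT {U : Opens M} (f : SuperFun H F E U) (X : tangentSheaf H F E U) : tangentSheaf H F E U :=
  ⟨smulFam f X.1, smulFam_mem_tangentSheaf f X.2⟩

variable (H F E)

/-- The sections over `U` of parity `i` of `Ω¹ = Hom_𝒪(𝒯, 𝒪)`: morphisms of sheaves
`φ : 𝒯|_U → 𝒪|_U` of parity `i` that are `𝒪`-linear in the graded sense,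
`φ(f Y) = (-1)^{|φ||f|} f φ(Y)`. -/
structure OneForm (U : Opens M) (i : ZMod 2) where
  toFun : ∀ V : Set.Iic U, tangentSheaf H F E V.1 →ₗ[ℝ] SuperFun H F E V.1
  map_res : ∀ (V W : Set.Iic U) (h : W.1 ≤ V.1) (Y : tangentSheaf H F E V.1),
    res h (toFun V Y) = toFun W (resT h Y)
  parity : ∀ (V : Set.Iic U) (j : ZMod 2) (Y : tangentSheaf H F E V.1), HasParity Y j →
    toFun V Y ∈ superFunParity H F E V.1 (i + j)
  map_smul : ∀ (V : Set.Iic U) (k : ZMod 2), ∀ f ∈ superFunParity H F E V.1 k,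
    ∀ Y : tangentSheaf H F E V.1, toFun V (smulT f Y) = koszul i k • (f * toFun V Y)

/-- An even (`p = 0`), resp. odd (`p = 1`), Riemannian metric on the supermanifold `ΠE`: a
supersymmetric non-degenerate morphism of sheaves `g : 𝒯 ⊗ 𝒯 → 𝒪` of parity `p` that is
`𝒪`-linear in the graded sense, `g(f X, Y) = (-1)^{|g||f|} f g(X, Y)` (by supersymmetry this
determines the behaviour in the second argument). Non-degeneracy: `X ↦ g(X, ·)` is, over each open
set, a bijection from `𝒯` onto `Ω¹`, shifting the parity by `p`. -/
structure SuperMetric (p : ZMod 2) where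
  toFun : ∀ U : Opens M,
    tangentSheaf H F E U →ₗ[ℝ] tangentSheaf H F E U →ₗ[ℝ] SuperFun H F E U
  map_res : ∀ {U V : Opens M} (h : V ≤ U) (X Y : tangentSheaf H F E U),
    res h (toFun U X Y) = toFun V (resT h X) (resT h Y)
  parity : ∀ (U : Opens M) (i j : ZMod 2) (X Y : tangentSheaf H F E U),
    HasParity X i → HasParity Y j → toFun U X Y ∈ superFunParity H F E U (p + i + j)
  supersymm : ∀ (U : Opens M) (i j : ZMod 2) (X Y : tangentSheaf H F E U),
    HasParity X i → HasParity Y j → toFun U X Y = koszul i j • toFun U Y X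
  map_smul : ∀ (U : Opens M) (k : ZMod 2), ∀ f ∈ superFunParity H F E U k,
    ∀ X Y : tangentSheaf H F E U, toFun U (smulT f X) Y = koszul p k • (f * toFun U X Y)
  nondegenerate : ∀ (U : Opens M) (i : ZMod 2) (φ : OneForm H F E U (p + i)),
    ∃! X : tangentSheaf H F E U, HasParity X i ∧
      ∀ (V : Set.Iic U) (Y : tangentSheaf H F E V.1), toFun V.1 (resT V.2 X) Y = φ.toFun V Y

variable {H F E}

/-- The superfunctions in `ℱ(U) = Γ(U, ℝ ⊕ E^*)`, i.e. without components of degree `≥ 2`. -/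
def IsAffine {U : Opens M} (s : SuperFun H F E U) : Prop :=
  ∀ x : U, ∃ (c : ℝ) (θ : Module.Dual ℝ (E (x : M))),
    s.1 x = algebraMap ℝ _ c + ExteriorAlgebra.ι ℝ θ

open Classical in
/-- The function on `π⁻¹(U) ⊆ E` attached to the components `s₀ ∈ C^∞(U)`, `s₁ ∈ Γ(U, E^*)` of
degree `0` and `1` of a superfunction `s`: `e ↦ s₀(π(e)) + s₁(π(e))(e)`. On `ℱ(U)` this is the
identification `ψ` with the functions that are affine on the fibres; on `𝒪(U)` it is `ψ ∘ pr`.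
It is set to zero outside of `π⁻¹(U)`. -/
def affineFun {U : Opens M} (s : SuperFun H F E U) (e : TotalSpace F E) : ℝ :=
  if h : e.proj ∈ U then
    ExteriorAlgebra.algebraMapInv (s.1 ⟨e.proj, h⟩) + ExteriorAlgebra.ιInv (s.1 ⟨e.proj, h⟩) e.snd
  else 0

/-- `X` belongs to `ℒ₀(U)`: it is an even superderivation preserving `ℱ`. -/
def IsAffineEven {U : Opens M} (X : tangentSheaf H F E U) : Prop :=
  HasParity X 0 ∧ ∀ (V : Set.Iic U) (s : SuperFun H F E V.1), IsAffine s → IsAffine (X.1 V s)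

/-- The vector field `X'` on `π⁻¹(U) ⊆ E` is `Ψ(X) = ψ ∘ X ∘ ψ⁻¹`, i.e. `X'(ψ(s)) = ψ(X(s))` for
all `s ∈ ℱ`. (The values of `X'` outside of `π⁻¹(U)` are irrelevant.) -/
def IsPsi {U : Opens M} (X : tangentSheaf H F E U)
    (X' : ∀ e : TotalSpace F E, TangentSpace (𝓘(ℝ, H).prod 𝓘(ℝ, F)) e) : Prop :=
  ∀ (V : Set.Iic U) (s : SuperFun H F E V.1), IsAffine s → ∀ e : TotalSpace F E, e.proj ∈ V.1 →
    mfderiv (𝓘(ℝ, H).prod 𝓘(ℝ, F)) 𝓘(ℝ, ℝ) (affineFun s) e (X' e) = affineFun (X.1 V s) e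

end Supermanifold

section Form

variable {M : Type*} [TopologicalSpace M]
  (H : Type*) [NormedAddCommGroup H] [NormedSpace ℝ H] [ChartedSpace H M] [IsManifold 𝓘(ℝ, H) ∞ M]
  (F : Type*) [NormedAddCommGroup F] [NormedSpace ℝ F] [FiniteDimensional ℝ F]
  (E : M → Type*) [∀ x, AddCommGroup (E x)] [∀ x, Module ℝ (E x)] [∀ x, TopologicalSpace (E x)]
  [TopologicalSpace (TotalSpace F E)] [FiberBundle F E] [VectorBundle ℝ F E]
  [ContMDiffVectorBundle ∞ F E 𝓘(ℝ, H)]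

/-- A smooth field of symmetric bilinear forms on the tangent spaces of the manifold `E` (the total
space of the bundle), i.e. a symmetric `C^∞_E`-bilinear form on vector fields on `E`. -/
structure SymmetricForm where
  toFun : ∀ e : TotalSpace F E, TangentSpace (𝓘(ℝ, H).prod 𝓘(ℝ, F)) e →L[ℝ]
    TangentSpace (𝓘(ℝ, H).prod 𝓘(ℝ, F)) e →L[ℝ] ℝ
  symm : ∀ e v w, toFun e v w = toFun e w v
  contMDiff : ContMDiff (𝓘(ℝ, H).prod 𝓘(ℝ, F))
    ((𝓘(ℝ, H).prod 𝓘(ℝ, F)).prod 𝓘(ℝ, (H × F) →L[ℝ] (H × F) →L[ℝ] ℝ)) ∞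
    (fun e => TotalSpace.mk' ((H × F) →L[ℝ] (H × F) →L[ℝ] ℝ)
      (E := fun e : TotalSpace F E => TangentSpace (𝓘(ℝ, H).prod 𝓘(ℝ, F)) e →L[ℝ]
        TangentSpace (𝓘(ℝ, H).prod 𝓘(ℝ, F)) e →L[ℝ] ℝ) e (toFun e))

variable {H F E}

/-- The form `h` on `E` is the form `g^{TE}` induced by `g`: on the vector fields in
`ℒ₀' = Ψ(ℒ₀)` it is the transport of `pr ∘ g`, that is
`h(Ψ(X), Ψ(Y)) = ψ(pr(g(X, Y)))` for all open `U ⊆ M` and `X, Y ∈ ℒ₀(U)`.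
By `C^∞_E`-bilinearity this forces `h(X', Y') = h(a X', b Y') / (a b)` wherever `a b ≠ 0`, for all
vector fields `X', Y'` and functions `a, b` on `E`. -/
def IsInducedBy {p : ZMod 2} (g : SuperMetric H F E p) (h : SymmetricForm H F E) : Prop :=
  ∀ (U : Opens M) (X Y : tangentSheaf H F E U)
    (X' Y' : ∀ e : TotalSpace F E, TangentSpace (𝓘(ℝ, H).prod 𝓘(ℝ, F)) e),
    IsAffineEven X → IsAffineEven Y → IsPsi X X' → IsPsi Y Y' →
    ∀ e : TotalSpace F E, e.proj ∈ U → h.toFun e (X' e) (Y' e) = affineFun (g.toFun U X Y) e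

/-- The form is degenerate at the point `e`. -/
def SymmetricForm.IsDegenerateAt (h : SymmetricForm H F E) (e : TotalSpace F E) : Prop :=
  ∃ v, v ≠ 0 ∧ ∀ w, h.toFun e v w = 0

/-- The form is a pseudo-Riemannian metric on `E`: it is non-degenerate at each point. -/
def SymmetricForm.IsPseudoRiemannian (h : SymmetricForm H F E) : Prop :=
  ∀ e : TotalSpace F E, ¬ h.IsDegenerateAt e

end Form

end SuperGeom

end

noncomputable section

set_option linter.unusedSectionVars false

/-! Over a coordinate domain, a chart of `M` and a trivialization of `E` turn superfunctions into
smooth maps from an open subset of `H` to `Λ F^*`. By Hadamard's lemma and the Leibniz rule a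
superderivation is determined by its values on the coordinates (`superDer_eq_zero`), so every
homogeneous one is a combination of the even derivatives `∂_v` and the odd contractions `∂_a`
(`tangentSheaf_expansion`). If `X` is even and preserves `ℱ`, its value on an even coordinate is
even and affine, hence a scalar, and its value on an odd coordinate is odd and affine, hence a
covector `η_j`. The tangent vector `Ψ(X)` at the point with coordinates `(y, f)` is then `(v, Σ
η_j(f) a_j)`, where `v` collects the scalars and the `a_j` form the chosen basis of `F`. Expand
`pr(g(X, Y))` and evaluate at `(y, f)`. The component `g(∂_v, ∂_w)` contributes its full affine
part. A mixed component carries one factor of degree one, so only its scalar part (body) survives.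
An odd-odd component carries two such factors and is removed by `pr`. The result depends on `X` and
`Y` only through the tangent vectors `Ψ(X)` and `Ψ(Y)` at `(y, f)`: it is the form `coordBilin`
(`coordBilin_eq`), which is smooth in `(y, f)`. For uniqueness, the fields `∂_v + θ ∂_a` lie in `ℒ₀`
and have the value `(v, θ(f) a)`. They reach every tangent vector where `f ≠ 0`, or everywhere if `F
= 0`. The complement of the zero section is dense when `F ≠ 0`, and smooth forms are continuous, so
an induced form is unique (`InducedOn.eq`). The same argument over overlaps of coordinate domains
glues the local forms (`localForm_eq`) without computing a transformation law. In the splitting `H ×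
F` the vertical block of `coordBilin` is zero and the mixed block consists, up to sign, of the
bodies of `g(∂_v, ∂_a)`. If `g` is even, these components are odd, their bodies vanish, and vertical
vectors lie in the kernel. If `g` is odd, non-degeneracy of `g`, applied to the differentials of the
coordinates, shows that the mixed block is non-degenerate on both sides (`even_eq_zero`,
`odd_eq_zero`), and the form is non-degenerate whatever its horizontal block. -/

namespace SuperGeom

/-! ### Parity, contraction and the components of degree 0 and 1 in an exterior algebra. -/

section ExteriorAlgebraLemmas

variable {V : Type*} [AddCommGroup V] [Module ℝ V]

/-- The parity involution of the exterior algebra. -/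
abbrev parityInv (V : Type*) [AddCommGroup V] [Module ℝ V] :
    ExteriorAlgebra ℝ V →ₐ[ℝ] ExteriorAlgebra ℝ V :=
  CliffordAlgebra.involute (Q := (0 : QuadraticForm ℝ V))

/-- Parity becomes an eigenvalue equation, which passes through any map that commutes or
anticommutes with the involution. For the converse, an eigenvector is fixed by the projection
`extProj`. -/
theorem mem_extParity_iff {i : ZMod 2} {a : ExteriorAlgebra ℝ V} :
    a ∈ extParity V i ↔ parityInv V a = koszul i 1 • a := by
  rcases zmod2_cases i with rfl | rfl
  · refine ⟨fun h => ?_, fun h => ?_⟩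
    · rw [parityInv, CliffordAlgebra.involute_eq_of_mem_even h]; simp [koszul]
    · have h2 : extProj V 0 a = a := by
        simp only [extProj, LinearMap.smul_apply, LinearMap.add_apply, LinearMap.id_apply,
          AlgHom.toLinearMap_apply]
        rw [h]
        norm_num [koszul]
        module
      exact h2 ▸ extProj_mem 0 a
  · refine ⟨fun h => ?_, fun h => ?_⟩
    · rw [parityInv, CliffordAlgebra.involute_eq_of_mem_odd h]; simp [koszul]
    · have h2 : extProj V 1 a = a := by
        simp only [extProj, LinearMap.smul_apply, LinearMap.add_apply, LinearMap.id_apply,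
          AlgHom.toLinearMap_apply]
        rw [h]
        norm_num [koszul]
        module
      exact h2 ▸ extProj_mem 1 a

theorem algebraMap_mem_extParity (c : ℝ) :
    algebraMap ℝ (ExteriorAlgebra ℝ V) c ∈ extParity V 0 := by
  rw [mem_extParity_iff]; simp [koszul]

theorem parityInv_ι (θ : V) : parityInv V (ExteriorAlgebra.ι ℝ θ) = -ExteriorAlgebra.ι ℝ θ :=
  CliffordAlgebra.involute_ι θ

theorem ι_mem_extParity (θ : V) : ExteriorAlgebra.ι ℝ θ ∈ extParity V 1 :=
  CliffordAlgebra.ι_mem_evenOdd_one _ θ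

/-- The interior product with a covector. -/
abbrev contract (d : Module.Dual ℝ V) : ExteriorAlgebra ℝ V →ₗ[ℝ] ExteriorAlgebra ℝ V :=
  CliffordAlgebra.contractLeft (Q := (0 : QuadraticForm ℝ V)) d

theorem contract_ι_mul (d : Module.Dual ℝ V) (θ : V) (b : ExteriorAlgebra ℝ V) :
    contract d (ExteriorAlgebra.ι ℝ θ * b) = d θ • b - ExteriorAlgebra.ι ℝ θ * contract d b :=
  CliffordAlgebra.contractLeft_ι_mul d θ b

theorem contract_algebraMap (d : Module.Dual ℝ V) (r : ℝ) :
    contract d (algebraMap ℝ (ExteriorAlgebra ℝ V) r) = 0 :=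
  CliffordAlgebra.contractLeft_algebraMap _ d r

theorem contract_ι (d : Module.Dual ℝ V) (θ : V) :
    contract d (ExteriorAlgebra.ι ℝ θ) = algebraMap ℝ _ (d θ) :=
  CliffordAlgebra.contractLeft_ι _ d θ

@[elab_as_elim]
theorem exterior_left_induction {P : ExteriorAlgebra ℝ V → Prop}
    (algebraMap : ∀ r : ℝ, P (algebraMap ℝ _ r))
    (add : ∀ x y, P x → P y → P (x + y)) (ι_mul : ∀ x (θ : V), P x → P (ExteriorAlgebra.ι ℝ θ * x))
    (x : ExteriorAlgebra ℝ V) : P x :=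
  CliffordAlgebra.left_induction (Q := (0 : QuadraticForm ℝ V)) algebraMap add ι_mul x

/-- Contraction is an antiderivation; the involution supplies the Koszul sign without any
homogeneity assumption, by induction from the case of one generator. -/
theorem contract_mul (d : Module.Dual ℝ V) (a b : ExteriorAlgebra ℝ V) :
    contract d (a * b) = contract d a * b + parityInv V a * contract d b := by
  induction a using exterior_left_induction with
  | algebraMap r =>
    rw [← Algebra.smul_def, map_smul, contract_algebraMap, AlgHom.commutes, ← Algebra.smul_def]
    simp
  | add x y hx hy => simp only [add_mul, map_add, hx, hy]; abel
  | ι_mul x θ hx =>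
    rw [mul_assoc, contract_ι_mul, hx, contract_ι_mul, map_mul, parityInv_ι]
    simp only [mul_add, sub_mul, smul_mul_assoc, neg_mul, mul_assoc]
    abel

theorem parityInv_contract (d : Module.Dual ℝ V) (a : ExteriorAlgebra ℝ V) :
    parityInv V (contract d a) = -contract d (parityInv V a) := by
  induction a using exterior_left_induction with
  | algebraMap r => rw [AlgHom.commutes, contract_algebraMap]; simp
  | add x y hx hy => simp only [map_add, hx, hy]; abel
  | ι_mul x θ hx =>
    rw [contract_ι_mul, map_sub, map_mul, map_mul, parityInv_ι, hx, map_smul, neg_mul, neg_mul,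
      map_neg, contract_ι_mul]
    simp

theorem contract_mem {d : Module.Dual ℝ V} {i : ZMod 2} {a : ExteriorAlgebra ℝ V}
    (ha : a ∈ extParity V i) : contract d a ∈ extParity V (1 + i) := by
  rw [mem_extParity_iff] at *
  rw [parityInv_contract, ha]
  rcases zmod2_cases i with rfl | rfl <;> simp [koszul]

/-- The scalar component. -/
abbrev body (a : ExteriorAlgebra ℝ V) : ℝ := ExteriorAlgebra.algebraMapInv a

theorem ιInv_algebraMap (r : ℝ) :
    ExteriorAlgebra.ιInv (algebraMap ℝ (ExteriorAlgebra ℝ V) r) = 0 := by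
  -- `ιInv` is the second component of `toTrivSqZeroExt`, whose target needs a right action on `V`;
  -- the one chosen is the scalar action itself.
  let : Module ℝᵐᵒᵖ V := Module.compHom _ ((RingHom.id ℝ).fromOpposite mul_comm)
  have : IsCentralScalar ℝ V := ⟨fun r m => rfl⟩
  change TrivSqZeroExt.snd (ExteriorAlgebra.toTrivSqZeroExt _) = 0
  rw [AlgHom.commutes]; rfl

theorem ιInv_ι (θ : V) : ExteriorAlgebra.ιInv (ExteriorAlgebra.ι ℝ θ) = θ :=
  ExteriorAlgebra.ι_leftInverse θ

theorem body_algebraMap (r : ℝ) : body (algebraMap ℝ (ExteriorAlgebra ℝ V) r) = r :=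
  ExteriorAlgebra.algebraMap_leftInverse V r

theorem body_ι (θ : V) : body (ExteriorAlgebra.ι ℝ θ) = 0 := by
  simp [body, ExteriorAlgebra.algebraMapInv]

/-- Discarding degrees ≥ 2 is an algebra map onto the trivial square-zero extension, whose product
gives this Leibniz rule. -/
theorem ιInv_mul (a b : ExteriorAlgebra ℝ V) :
    ExteriorAlgebra.ιInv (a * b) =
      body a • ExteriorAlgebra.ιInv b + body b • ExteriorAlgebra.ιInv a := by
  let : Module ℝᵐᵒᵖ V := Module.compHom _ ((RingHom.id ℝ).fromOpposite mul_comm)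
  have : IsCentralScalar ℝ V := ⟨fun r m => rfl⟩
  have key : ∀ c : ExteriorAlgebra ℝ V, body c = (ExteriorAlgebra.toTrivSqZeroExt c).fst := by
    have : (ExteriorAlgebra.algebraMapInv : ExteriorAlgebra ℝ V →ₐ[ℝ] ℝ) =
        (TrivSqZeroExt.fstHom ℝ ℝ V).comp ExteriorAlgebra.toTrivSqZeroExt := by
      apply ExteriorAlgebra.hom_ext
      ext v
      simp [ExteriorAlgebra.algebraMapInv]
    intro c
    rw [body, this]; rfl
  rw [key, key]
  change TrivSqZeroExt.snd (ExteriorAlgebra.toTrivSqZeroExt _) = _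
  rw [map_mul, TrivSqZeroExt.snd_mul]
  rfl

/-- Contraction lowers the degree by one, so only the degree-one component reaches degree zero. -/
theorem body_contract (d : Module.Dual ℝ V) (a : ExteriorAlgebra ℝ V) :
    body (contract d a) = d (ExteriorAlgebra.ιInv a) := by
  induction a using exterior_left_induction with
  | algebraMap r => rw [contract_algebraMap, ιInv_algebraMap]; simp
  | add x y hx hy => simp only [map_add, body] at *; rw [hx, hy]
  | ι_mul x θ hx =>
    rw [contract_ι_mul, ιInv_mul, ιInv_ι, body_ι]
    simp only [body, map_sub, map_mul, map_smul, zero_smul, zero_add, smul_eq_mul]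
    rw [show ExteriorAlgebra.algebraMapInv (ExteriorAlgebra.ι ℝ θ) = (0 : ℝ) from body_ι θ]
    ring

theorem body_parityInv (a : ExteriorAlgebra ℝ V) : body (parityInv V a) = body a := by
  induction a using exterior_left_induction with
  | algebraMap r => rw [AlgHom.commutes]
  | add x y hx hy => simp only [map_add, body] at *; rw [hx, hy]
  | ι_mul x θ hx =>
    simp only [body, map_mul, parityInv_ι, map_neg]
    rw [show ExteriorAlgebra.algebraMapInv (ExteriorAlgebra.ι ℝ θ) = (0 : ℝ) from body_ι θ]
    ring

theorem ιInv_parityInv (a : ExteriorAlgebra ℝ V) :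
    ExteriorAlgebra.ιInv (parityInv V a) = -ExteriorAlgebra.ιInv a := by
  induction a using exterior_left_induction with
  | algebraMap r => rw [AlgHom.commutes, ιInv_algebraMap]; simp
  | add x y hx hy => simp only [map_add]; rw [hx, hy]; abel
  | ι_mul x θ hx =>
    rw [map_mul, ιInv_mul, ιInv_mul, hx, parityInv_ι, body_parityInv, map_neg, ιInv_ι, body_ι]
    simp [body, body_ι]

theorem body_of_odd {a : ExteriorAlgebra ℝ V} (ha : a ∈ extParity V 1) : body a = 0 := by
  have h := body_parityInv a
  rw [mem_extParity_iff.1 ha] at h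
  simp only [body, map_smul, smul_eq_mul, koszul] at h ⊢
  norm_num at h
  linarith

theorem ιInv_of_even {a : ExteriorAlgebra ℝ V} (ha : a ∈ extParity V 0) :
    ExteriorAlgebra.ιInv a = 0 := by
  have h := ιInv_parityInv a
  rw [mem_extParity_iff.1 ha] at h
  simp only [koszul] at h
  norm_num at h
  have h2 : (2 : ℝ) • ExteriorAlgebra.ιInv a = 0 := by
    rw [two_smul]; nth_rewrite 1 [h]; simp
  exact (smul_eq_zero.1 h2).resolve_left two_ne_zero

end ExteriorAlgebraLemmas

/-! ### Evaluation of the affine part at a point of the fibre. -/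

section AffineEval

variable {F : Type*} [AddCommGroup F] [Module ℝ F]

/-- The value at `f ∈ F` of the affine function given by the components of degree `0` and `1` of an
element of `Λ F^*`. -/
def affineEval (f : F) : ExteriorAlgebra ℝ (Module.Dual ℝ F) →ₗ[ℝ] ℝ :=
  ExteriorAlgebra.algebraMapInv.toLinearMap + Module.Dual.eval ℝ F f ∘ₗ ExteriorAlgebra.ιInv

theorem affineEval_apply (f : F) (a : ExteriorAlgebra ℝ (Module.Dual ℝ F)) :
    affineEval f a = body a + ExteriorAlgebra.ιInv a f := rfl

theorem affineEval_algebraMap (f : F) (r : ℝ) : affineEval f (algebraMap ℝ _ r) = r := by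
  rw [affineEval_apply, ιInv_algebraMap, body_algebraMap]; simp

theorem affineEval_ι (f : F) (θ : Module.Dual ℝ F) :
    affineEval f (ExteriorAlgebra.ι ℝ θ) = θ f := by
  rw [affineEval_apply, ιInv_ι, body_ι, zero_add]

theorem affineEval_algebraMap_mul (f : F) (r : ℝ) (a : ExteriorAlgebra ℝ (Module.Dual ℝ F)) :
    affineEval f (algebraMap ℝ _ r * a) = r * affineEval f a := by
  rw [← Algebra.smul_def, map_smul, smul_eq_mul]

/-- A factor of degree one lets only the body of the other factor survive. This is why the mixed
components of a metric enter the induced form through their bodies, and the odd-odd ones not at all.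
-/
theorem affineEval_ι_mul (f : F) (θ : Module.Dual ℝ F) (a : ExteriorAlgebra ℝ (Module.Dual ℝ F)) :
    affineEval f (ExteriorAlgebra.ι ℝ θ * a) = θ f * body a := by
  rw [affineEval_apply, ιInv_mul, ιInv_ι, body_ι]
  simp only [body, map_mul]
  rw [show ExteriorAlgebra.algebraMapInv (ExteriorAlgebra.ι ℝ θ) = (0 : ℝ) from body_ι θ]
  simp [mul_comm]

end AffineEval

/-! ### Calculus for maps into a finite-dimensional algebra, tested by linear forms instead of a
norm. -/

section WeakCalculus

variable {H : Type*} [NormedAddCommGroup H] [NormedSpace ℝ H]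
  {A : Type*} [Ring A] [Algebra ℝ A]

/-- Smoothness at a point of a map into a finite-dimensional algebra, tested by linear forms. -/
def WSmoothAt (S : H → A) (y : H) : Prop :=
  ∀ ℓ : Module.Dual ℝ A, ContDiffAt ℝ ∞ (fun z => ℓ (S z)) y

theorem WSmoothAt.diff {S : H → A} {y : H} (hS : WSmoothAt S y) (ℓ : Module.Dual ℝ A) :
    DifferentiableAt ℝ (fun z => ℓ (S z)) y :=
  (hS ℓ).differentiableAt (by simp)

theorem WSmoothAt.add {S T : H → A} {y : H} (hS : WSmoothAt S y) (hT : WSmoothAt T y) :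
    WSmoothAt (fun z => S z + T z) y := fun ℓ => by
  simpa only [map_add] using (hS ℓ).add (hT ℓ)

theorem WSmoothAt.const (a : A) (y : H) : WSmoothAt (fun _ => a) y := fun _ => contDiffAt_const

theorem WSmoothAt.smul {u : H → ℝ} {S : H → A} {y : H} (hu : ContDiffAt ℝ ∞ u y)
    (hS : WSmoothAt S y) : WSmoothAt (fun z => u z • S z) y := fun ℓ => by
  simpa only [map_smul, smul_eq_mul] using hu.mul (hS ℓ)

theorem WSmoothAt.map {B : Type*} [Ring B] [Algebra ℝ B] {S : H → A} {y : H}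
    (hS : WSmoothAt S y) (T : A →ₗ[ℝ] B) : WSmoothAt (fun z => T (S z)) y :=
  fun ℓ => hS (ℓ ∘ₗ T)

theorem WSmoothAt.congr {S T : H → A} {y : H} (hS : WSmoothAt S y)
    (h : T =ᶠ[nhds y] S) : WSmoothAt T y := fun ℓ =>
  (hS ℓ).congr_of_eventuallyEq (h.mono fun z hz => by simp only [hz])

variable [Module.Finite ℝ A]

/-- The derivative in the direction `v` of a map into a finite-dimensional algebra. -/
def wderiv (v : H) (S : H → A) (y : H) : A :=
  ∑ i, fderiv ℝ (fun z => (Module.finBasis ℝ A).coord i (S z)) y v • Module.finBasis ℝ A i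

theorem apply_eq_sum (ℓ : Module.Dual ℝ A) (a : A) :
    ℓ a = ∑ i, (Module.finBasis ℝ A).coord i a * ℓ (Module.finBasis ℝ A i) := by
  conv_lhs => rw [← (Module.finBasis ℝ A).sum_repr a]
  rw [map_sum]
  simp

/-- This frees `wderiv` from the chosen basis; with `eq_of_forall_dual` it reduces the rules of
differentiation to the real-valued ones. -/
theorem WSmoothAt.apply_wderiv {S : H → A} {y : H} (hS : WSmoothAt S y) (ℓ : Module.Dual ℝ A)
    (v : H) : ℓ (wderiv v S y) = fderiv ℝ (fun z => ℓ (S z)) y v := by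
  have : (fun z => ℓ (S z)) = fun z => ∑ i, (Module.finBasis ℝ A).coord i (S z) *
      ℓ (Module.finBasis ℝ A i) := funext fun z => apply_eq_sum ℓ (S z)
  rw [this, fderiv_fun_sum fun i _ => (hS.diff _).mul_const _]
  simp only [wderiv, map_sum, map_smul, smul_eq_mul, sum_apply]
  refine Finset.sum_congr rfl fun i _ => ?_
  rw [fderiv_mul_const (hS.diff _)]
  simp [mul_comm]

theorem eq_of_forall_dual {a b : A} (h : ∀ ℓ : Module.Dual ℝ A, ℓ a = ℓ b) : a = b :=
  (Module.finBasis ℝ A).ext_elem fun i => h ((Module.finBasis ℝ A).coord i)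

/-- It writes a linear form of a product as a finite sum of products of linear forms of the factors,
so smoothness and the Leibniz rule for products follow from the scalar case. -/
theorem apply_mul_eq_sum (ℓ : Module.Dual ℝ A) (a b : A) :
    ℓ (a * b) = ∑ i, (Module.finBasis ℝ A).coord i a *
      (ℓ ∘ₗ LinearMap.mulLeft ℝ (Module.finBasis ℝ A i)) b := by
  have := apply_eq_sum (ℓ ∘ₗ LinearMap.mulRight ℝ b) a
  simpa using this

theorem WSmoothAt.mul {S T : H → A} {y : H} (hS : WSmoothAt S y) (hT : WSmoothAt T y) :
    WSmoothAt (fun z => S z * T z) y := fun ℓ => by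
  simp only [apply_mul_eq_sum ℓ]
  exact ContDiffAt.sum fun i _ => (hS _).mul (hT _)

theorem WSmoothAt.wderiv {S : H → A} {y : H} (hS : WSmoothAt S y) (v : H) :
    WSmoothAt (wderiv v S) y := fun ℓ => by
  simp only [SuperGeom.wderiv, map_sum, map_smul, smul_eq_mul]
  refine ContDiffAt.sum fun i _ => ContDiffAt.mul ?_ contDiffAt_const
  exact ((hS _).fderiv_right (m := ∞) (by simp)).clm_apply contDiffAt_const

theorem wderiv_mul {S T : H → A} {y : H} (hS : WSmoothAt S y) (hT : WSmoothAt T y) (v : H) :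
    wderiv v (fun z => S z * T z) y = wderiv v S y * T y + S y * wderiv v T y := by
  refine eq_of_forall_dual fun ℓ => ?_
  rw [(hS.mul hT).apply_wderiv, map_add, apply_mul_eq_sum ℓ, apply_mul_eq_sum ℓ]
  simp only [apply_mul_eq_sum ℓ]
  rw [fderiv_fun_sum fun i _ => (hS.diff _).fun_mul (hT.diff _), sum_apply,
    ← Finset.sum_add_distrib]
  refine Finset.sum_congr rfl fun i _ => ?_
  rw [fderiv_fun_mul (hS.diff _) (hT.diff _), hS.apply_wderiv, hT.apply_wderiv]
  simp only [add_apply, smul_apply, smul_eq_mul]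
  ring

theorem wderiv_congr {S T : H → A} {y : H} (h : S =ᶠ[nhds y] T) (v : H) :
    wderiv v S y = wderiv v T y := by
  unfold wderiv
  refine Finset.sum_congr rfl fun i _ => ?_
  have : (fun z => (Module.finBasis ℝ A).coord i (S z)) =ᶠ[nhds y]
      fun z => (Module.finBasis ℝ A).coord i (T z) := h.mono fun z hz => by simp only [hz]
  rw [this.fderiv_eq]

theorem wderiv_add {S T : H → A} {y : H} (hS : WSmoothAt S y) (hT : WSmoothAt T y) (v : H) :
    wderiv v (fun z => S z + T z) y = wderiv v S y + wderiv v T y := by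
  refine eq_of_forall_dual fun ℓ => ?_
  rw [(hS.add hT).apply_wderiv, map_add, hS.apply_wderiv, hT.apply_wderiv]
  simp only [map_add]
  rw [fderiv_fun_add (hS.diff _) (hT.diff _)]; rfl

/-- Conditions cut out by a linear map, such as having a given parity or being affine, are inherited
by derivatives through this identity. -/
theorem wderiv_map {B : Type*} [Ring B] [Algebra ℝ B] [Module.Finite ℝ B] {S : H → A} {y : H}
    (hS : WSmoothAt S y) (T : A →ₗ[ℝ] B) (v : H) :
    wderiv v (fun z => T (S z)) y = T (wderiv v S y) := by
  refine eq_of_forall_dual fun ℓ => ?_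
  rw [(hS.map T).apply_wderiv]
  exact (hS.apply_wderiv (ℓ ∘ₗ T) v).symm

theorem wderiv_const (a : A) (y v : H) : wderiv v (fun _ => a) y = 0 := by
  simp [wderiv]

theorem wderiv_add_dir (v w : H) (S : H → A) (y : H) :
    wderiv (v + w) S y = wderiv v S y + wderiv w S y := by
  simp [wderiv, add_smul, Finset.sum_add_distrib]

theorem wderiv_smul_dir (c : ℝ) (v : H) (S : H → A) (y : H) :
    wderiv (c • v) S y = c • wderiv v S y := by
  simp [wderiv, Finset.smul_sum, mul_smul]

end WeakCalculus

/-! ### Hadamard's lemma. -/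

section Hadamard

variable {H : Type*} [NormedAddCommGroup H] [NormedSpace ℝ H]

open MeasureTheory

/-- The integral over `[0, 1]` of a smooth family of functions depends smoothly on the parameter. -/
theorem contDiff_integral_param {g : H → ℝ → ℝ} (hg : ContDiff ℝ ∞ ↿g) :
    ContDiff ℝ ∞ fun y => ∫ t in (0 : ℝ)..1, g y t := by
  -- The integral is the value at 0 of the convolution of the indicator of `(0, 1]` with `G y`,
  -- hence the sign in `-t`. The cut-off is 1 on the range of integration and gives the compact
  -- support in `t` needed to differentiate a convolution with parameters.
  let ψ : ContDiffBump (0 : ℝ) := ⟨1, 2, one_pos, one_lt_two⟩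
  let G : H → ℝ → ℝ := fun y t => ψ t * g y (-t)
  have hG : ContDiff ℝ ∞ ↿G := by
    have h1 : ContDiff ℝ ∞ fun q : H × ℝ => ψ q.2 := ψ.contDiff.comp contDiff_snd
    have h2 : ContDiff ℝ ∞ fun q : H × ℝ => ↿g (q.1, -q.2) :=
      hg.comp (contDiff_fst.prodMk contDiff_snd.neg)
    exact h1.mul h2
  have hf : LocallyIntegrable ((Set.Ioc (0 : ℝ) 1).indicator fun _ => (1 : ℝ)) volume :=
    (locallyIntegrable_const (1 : ℝ)).indicator measurableSet_Ioc
  have key := contDiffOn_convolution_right_with_param_comp (n := ⊤) (ContinuousLinearMap.mul ℝ ℝ)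
    (s := (Set.univ : Set H)) (v := fun _ => (0 : ℝ)) (μ := volume) contDiffOn_const
    (g := G) isOpen_univ (isCompact_closedBall (0 : ℝ) 2) (fun p x _ hx => by
      have : ψ x = 0 := ψ.zero_of_le_dist (by
        rw [Metric.mem_closedBall, not_le] at hx; exact hx.le)
      simp [G, this]) hf hG.contDiffOn
  rw [contDiffOn_univ] at key
  convert key using 2 with y
  rw [convolution_def, intervalIntegral.integral_of_le zero_le_one,
    ← integral_indicator measurableSet_Ioc]
  refine integral_congr_ae (Filter.Eventually.of_forall fun t => ?_)
  by_cases ht : t ∈ Set.Ioc (0 : ℝ) 1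
  · have : ψ (-t) = 1 := ψ.one_of_mem_closedBall (by
      rw [Metric.mem_closedBall, dist_zero_right, norm_neg, Real.norm_eq_abs, abs_of_pos ht.1]
      exact ht.2)
    simp [ht, G, this]
  · simp [ht]

/-- Integrate the derivative of `u` along the segment from `y₀` to `y` and expand `y - y₀` in the
basis; the coefficients are integrals of partial derivatives. -/
theorem hadamard_global [FiniteDimensional ℝ H] {u : H → ℝ} (hu : ContDiff ℝ ∞ u) (y₀ : H) :
    ∃ h : Fin (Module.finrank ℝ H) → H → ℝ, (∀ i, ContDiff ℝ ∞ (h i)) ∧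
      ∀ y, u y = u y₀ + ∑ i, ((Module.finBasis ℝ H).coord i y - (Module.finBasis ℝ H).coord i y₀) *
        h i y := by
  have hdu : ContDiff ℝ ∞ (fderiv ℝ u) := hu.fderiv_right (by simp)
  have hseg : ContDiff ℝ ∞ fun q : H × ℝ => fderiv ℝ u (y₀ + q.2 • (q.1 - y₀)) :=
    hdu.comp (contDiff_const.add (contDiff_snd.smul (contDiff_fst.sub contDiff_const)))
  have hsm : ∀ w : H, ContDiff ℝ ∞ fun q : H × ℝ => fderiv ℝ u (y₀ + q.2 • (q.1 - y₀)) w :=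
    fun w => hseg.clm_apply contDiff_const
  refine ⟨fun i y => ∫ t in (0 : ℝ)..1, fderiv ℝ u (y₀ + t • (y - y₀)) (Module.finBasis ℝ H i),
    fun i => contDiff_integral_param
      (g := fun y t => fderiv ℝ u (y₀ + t • (y - y₀)) (Module.finBasis ℝ H i)) (hsm _),
    fun y => ?_⟩
  have hcont : ∀ w : H, Continuous fun t : ℝ => fderiv ℝ u (y₀ + t • (y - y₀)) w := fun w =>
    (hsm w).continuous.comp (continuous_const.prodMk continuous_id)
  have hft : ∫ t in (0 : ℝ)..1, fderiv ℝ u (y₀ + t • (y - y₀)) (y - y₀) = u y - u y₀ := by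
    have := intervalIntegral.integral_eq_sub_of_hasDerivAt (a := 0) (b := 1)
      (f := fun t : ℝ => u (y₀ + t • (y - y₀)))
      (f' := fun t => fderiv ℝ u (y₀ + t • (y - y₀)) (y - y₀)) (fun t _ => by
        have h1 : HasDerivAt (fun t : ℝ => y₀ + t • (y - y₀)) (y - y₀) t := by
          simpa using ((hasDerivAt_id t).smul_const (y - y₀)).const_add y₀
        exact ((hu.differentiable (by simp)) _).hasFDerivAt.comp_hasDerivAt t h1)
      ((hcont _).intervalIntegrable _ _)
    simpa using this
  have hexp : ∀ t : ℝ, fderiv ℝ u (y₀ + t • (y - y₀)) (y - y₀) =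
      ∑ i, ((Module.finBasis ℝ H).coord i y - (Module.finBasis ℝ H).coord i y₀) *
        fderiv ℝ u (y₀ + t • (y - y₀)) (Module.finBasis ℝ H i) := by
    intro t
    generalize fderiv ℝ u (y₀ + t • (y - y₀)) = L
    conv_lhs => rw [← (Module.finBasis ℝ H).sum_repr (y - y₀)]
    simp [map_sum]
  simp only [hexp] at hft
  rw [intervalIntegral.integral_finsetSum fun i _ =>
    ((hcont _).intervalIntegrable _ _).const_mul _] at hft
  simp only [intervalIntegral.integral_const_mul] at hft
  linarith

/-- Hadamard's lemma: near `y₀`, a smooth function is a constant plus a combination of the centred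
coordinates with smooth coefficients. -/
theorem hadamard_local [FiniteDimensional ℝ H] {u : H → ℝ} {O : Set H} (hO : IsOpen O) {y₀ : H}
    (hy₀ : y₀ ∈ O) (hu : ContDiffOn ℝ ∞ u O) :
    ∃ (O' : Set H) (h : Fin (Module.finrank ℝ H) → H → ℝ), IsOpen O' ∧ y₀ ∈ O' ∧
      (∀ i, ContDiff ℝ ∞ (h i)) ∧
      ∀ y ∈ O', u y = u y₀ + ∑ i, ((Module.finBasis ℝ H).coord i y -
        (Module.finBasis ℝ H).coord i y₀) * h i y := by
  obtain ⟨r, hr, hrO⟩ := Metric.isOpen_iff.1 hO y₀ hy₀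
  -- Supported inside the ball of radius `r` contained in `O`, this cut-off extends `u` smoothly by
  -- zero; on the ball of radius `r / 3` it is 1 and nothing is changed.
  let ψ : ContDiffBump y₀ := ⟨r / 3, r / 2, by positivity, by linarith⟩
  have hsmooth : ContDiff ℝ ∞ fun y => ψ y * u y := by
    refine contDiff_iff_contDiffAt.2 fun y => ?_
    by_cases hy : y ∈ tsupport fun y => ψ y * u y
    swap
    · exact contDiffAt_const.congr_of_eventuallyEq (notMem_tsupport_iff_eventuallyEq.1 hy)
    have hy' : y ∈ tsupport ψ := tsupport_mul_subset_left hy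
    rw [ψ.tsupport_eq] at hy'
    have : y ∈ O := hrO (Metric.closedBall_subset_ball (by simp [ψ]; linarith) hy')
    exact ψ.contDiffAt.mul (hu.contDiffAt (hO.mem_nhds this))
  obtain ⟨h, hh, hu'⟩ := hadamard_global hsmooth y₀
  refine ⟨Metric.ball y₀ (r / 3), h, Metric.isOpen_ball, Metric.mem_ball_self (by positivity), hh,
    fun y hy => ?_⟩
  have h1 : ∀ z ∈ Metric.ball y₀ (r / 3), ψ z = 1 := fun z hz =>
    ψ.one_of_mem_closedBall (Metric.ball_subset_closedBall hz)
  have := hu' y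
  rwa [h1 y hy, h1 y₀ (Metric.mem_ball_self (by positivity)), one_mul, one_mul] at this

end Hadamard

/-! ### Functoriality of the exterior algebra and its smooth dependence on the linear map. -/

section ExteriorMap

variable {V W : Type*} [AddCommGroup V] [Module ℝ V] [AddCommGroup W] [Module ℝ W]

theorem body_map (φ : V →ₗ[ℝ] W) (a : ExteriorAlgebra ℝ V) :
    body (ExteriorAlgebra.map φ a) = body a := by
  have : (ExteriorAlgebra.algebraMapInv : ExteriorAlgebra ℝ W →ₐ[ℝ] ℝ).comp
      (ExteriorAlgebra.map φ) = ExteriorAlgebra.algebraMapInv := by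
    apply ExteriorAlgebra.hom_ext
    ext v
    simp [ExteriorAlgebra.algebraMapInv]
  exact congrArg (fun ψ => ψ a) this

theorem ιInv_map (φ : V →ₗ[ℝ] W) (a : ExteriorAlgebra ℝ V) :
    ExteriorAlgebra.ιInv (ExteriorAlgebra.map φ a) = φ (ExteriorAlgebra.ιInv a) :=
  congrArg (fun ψ => ψ a) (ExteriorAlgebra.ιInv_comp_map φ)

theorem parityInv_map (φ : V →ₗ[ℝ] W) (a : ExteriorAlgebra ℝ V) :
    parityInv W (ExteriorAlgebra.map φ a) = ExteriorAlgebra.map φ (parityInv V a) := by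
  induction a using exterior_left_induction with
  | algebraMap r => simp only [AlgHom.commutes]
  | add x y hx hy => simp only [map_add, hx, hy]
  | ι_mul x θ hx => simp [map_mul, hx]

theorem map_mem_extParity (φ : V →ₗ[ℝ] W) {i : ZMod 2} {a : ExteriorAlgebra ℝ V}
    (ha : a ∈ extParity V i) : ExteriorAlgebra.map φ a ∈ extParity W i := by
  rw [mem_extParity_iff] at *
  rw [parityInv_map, ha, map_smul]

variable {F : Type*} [NormedAddCommGroup F] [NormedSpace ℝ F] [FiniteDimensional ℝ F]
  {H : Type*} [NormedAddCommGroup H] [NormedSpace ℝ H]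

instance extAlg_finite_inst : Module.Finite ℝ (ExteriorAlgebra ℝ (Module.Dual ℝ F)) :=
  extAlg_finite

/-- On a generator the matrix entries of `C z` appear as coefficients; products and sums preserve
smoothness, so induction over the algebra suffices. -/
theorem wsmoothAt_map_const {C : H → F →L[ℝ] F} {y : H} (hC : ContDiffAt ℝ ∞ C y)
    (a : ExteriorAlgebra ℝ (Module.Dual ℝ F)) :
    WSmoothAt (fun z => ExteriorAlgebra.map (C z).toLinearMap.dualMap a) y := by
  induction a using ExteriorAlgebra.induction with
  | algebraMap r => simpa only [AlgHom.commutes] using WSmoothAt.const _ y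
  | ι θ =>
    intro ℓ
    simp only [ExteriorAlgebra.map_apply_ι]
    have h1 : ∀ z, ℓ (ExteriorAlgebra.ι ℝ ((C z).toLinearMap.dualMap θ)) =
        ∑ i, θ (C z (Module.finBasis ℝ F i)) *
          ℓ (ExteriorAlgebra.ι ℝ ((Module.finBasis ℝ F).coord i)) := by
      intro z
      have h2 : (C z).toLinearMap.dualMap θ =
          ∑ i, θ (C z (Module.finBasis ℝ F i)) • (Module.finBasis ℝ F).coord i := by
        apply (Module.finBasis ℝ F).ext
        intro j
        simp [Finsupp.single_apply]
      rw [h2]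
      simp only [map_sum, map_smul, smul_eq_mul]
    simp only [h1]
    refine ContDiffAt.sum fun i _ => ContDiffAt.mul ?_ contDiffAt_const
    exact (LinearMap.toContinuousLinearMap θ).contDiff.contDiffAt.comp y
      (hC.clm_apply contDiffAt_const)
  | mul a b ha hb => simpa only [map_mul] using ha.mul hb
  | add a b ha hb => simpa only [map_add] using ha.add hb

theorem wsmoothAt_map {C : H → F →L[ℝ] F} {y : H} (hC : ContDiffAt ℝ ∞ C y)
    {S : H → ExteriorAlgebra ℝ (Module.Dual ℝ F)} (hS : WSmoothAt S y) :
    WSmoothAt (fun z => ExteriorAlgebra.map (C z).toLinearMap.dualMap (S z)) y := by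
  intro ℓ
  have h1 : ∀ z, ℓ (ExteriorAlgebra.map (C z).toLinearMap.dualMap (S z)) =
      ∑ i, (Module.finBasis ℝ _).coord i (S z) *
        ℓ (ExteriorAlgebra.map (C z).toLinearMap.dualMap (Module.finBasis ℝ _ i)) := fun z =>
    apply_eq_sum (ℓ ∘ₗ (ExteriorAlgebra.map (C z).toLinearMap.dualMap).toLinearMap) (S z)
  simp only [h1]
  exact ContDiffAt.sum fun i _ => (hS _).mul (wsmoothAt_map_const hC _ ℓ)

end ExteriorMap

/-! ### Superfunctions in local coordinates. -/

section LocalCoordinates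

variable {M : Type*} [TopologicalSpace M]
  {H : Type*} [NormedAddCommGroup H] [NormedSpace ℝ H] [ChartedSpace H M] [IsManifold 𝓘(ℝ, H) ∞ M]
  {F : Type*} [NormedAddCommGroup F] [NormedSpace ℝ F] [FiniteDimensional ℝ F]
  {E : M → Type*} [∀ x, AddCommGroup (E x)] [∀ x, Module ℝ (E x)] [∀ x, TopologicalSpace (E x)]
  [TopologicalSpace (TotalSpace F E)] [FiberBundle F E] [VectorBundle ℝ F E]
  [ContMDiffVectorBundle ∞ F E 𝓘(ℝ, H)]

omit [IsManifold 𝓘(ℝ, H) ∞ M] in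
theorem contDiffAt_comp_chart_symm [IsManifold 𝓘(ℝ, H) ∞ M] {G : Type*} [NormedAddCommGroup G]
    [NormedSpace ℝ G] {x₀ : M}
    {f : M → G} {y : H} (hy : y ∈ (chartAt H x₀).target)
    (hf : ContMDiffAt 𝓘(ℝ, H) 𝓘(ℝ, G) ∞ f ((chartAt H x₀).symm y)) :
    ContDiffAt ℝ ∞ (fun z => f ((chartAt H x₀).symm z)) y := by
  have h1 : ContMDiffAt 𝓘(ℝ, H) 𝓘(ℝ, H) ∞ (chartAt H x₀).symm y :=
    contMDiffOn_chart_symm.contMDiffAt ((chartAt H x₀).open_target.mem_nhds hy)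
  exact (hf.comp y h1).contDiffAt

theorem contMDiffAt_comp_chart {G : Type*} [NormedAddCommGroup G] [NormedSpace ℝ G] {x₀ : M}
    {u : H → G} {x : M} (hx : x ∈ (chartAt H x₀).source)
    (hu : ContDiffAt ℝ ∞ u (chartAt H x₀ x)) :
    ContMDiffAt 𝓘(ℝ, H) 𝓘(ℝ, G) ∞ (fun z => u (chartAt H x₀ z)) x := by
  have h1 : ContMDiffAt 𝓘(ℝ, H) 𝓘(ℝ, H) ∞ (chartAt H x₀) x :=
    contMDiffOn_chart.contMDiffAt ((chartAt H x₀).open_source.mem_nhds hx)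
  exact hu.contMDiffAt.comp x h1

variable (F E) in
/-- The inverse `Λ F^* → Λ E_x^*` of `localRep`. -/
def localRepInv (x₀ x : M) : ExteriorAlgebra ℝ (Module.Dual ℝ F) →ₐ[ℝ] ExtFiber E x :=
  ExteriorAlgebra.map ((trivializationAt F E x₀).linearMapAt ℝ x).dualMap

theorem localRep_localRepInv {x₀ x : M} (hx : x ∈ (trivializationAt F E x₀).baseSet)
    (a : ExteriorAlgebra ℝ (Module.Dual ℝ F)) :
    localRep F E x₀ x (localRepInv F E x₀ x a) = a := by
  rw [localRep, localRepInv, ← AlgHom.comp_apply, ExteriorAlgebra.map_comp_map]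
  have : ((trivializationAt F E x₀).symmₗ ℝ x).dualMap.comp
      ((trivializationAt F E x₀).linearMapAt ℝ x).dualMap = LinearMap.id := by
    ext θ f
    simp only [LinearMap.comp_apply, LinearMap.dualMap_apply, LinearMap.id_apply]
    rw [Trivialization.linearMapAt_symmₗ _ hx]
  rw [this, ExteriorAlgebra.map_id]; rfl

theorem localRepInv_localRep {x₀ x : M} (hx : x ∈ (trivializationAt F E x₀).baseSet)
    (a : ExtFiber E x) : localRepInv F E x₀ x (localRep F E x₀ x a) = a := by
  rw [localRep, localRepInv, ← AlgHom.comp_apply, ExteriorAlgebra.map_comp_map]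
  have : ((trivializationAt F E x₀).linearMapAt ℝ x).dualMap.comp
      ((trivializationAt F E x₀).symmₗ ℝ x).dualMap = LinearMap.id := by
    ext θ f
    simp only [LinearMap.comp_apply, LinearMap.dualMap_apply, LinearMap.id_apply]
    rw [Trivialization.symmₗ_linearMapAt _ hx]
  rw [this, ExteriorAlgebra.map_id]; rfl

theorem localRep_injective {x₀ x : M} (hx : x ∈ (trivializationAt F E x₀).baseSet) :
    Function.Injective (localRep F E x₀ x) :=
  Function.LeftInverse.injective (localRepInv_localRep hx)

/-- Dualizing reverses arrows: the coordinate change from `x₀` to `x₁` carries the representative at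
`x₁` back to the one at `x₀`. -/
theorem localRep_change {x₀ x₁ x : M} (h₀ : x ∈ (trivializationAt F E x₀).baseSet)
    (h₁ : x ∈ (trivializationAt F E x₁).baseSet) (a : ExtFiber E x) :
    localRep F E x₀ x a = ExteriorAlgebra.map
      (((trivializationAt F E x₀).coordChangeL ℝ (trivializationAt F E x₁) x :
        F →L[ℝ] F).toLinearMap.dualMap) (localRep F E x₁ x a) := by
  rw [localRep, localRep, ← AlgHom.comp_apply, ExteriorAlgebra.map_comp_map]
  congr 2
  ext θ f
  simp only [LinearMap.comp_apply, LinearMap.dualMap_apply, ContinuousLinearMap.coe_coe,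
    ContinuousLinearEquiv.coe_coe]
  congr 1
  rw [Trivialization.coordChangeL_apply _ _ ⟨h₀, h₁⟩, Trivialization.symmₗ_apply _ h₀]
  have := Trivialization.symmₗ_linearMapAt (R := ℝ) (trivializationAt F E x₁) h₁
    ((trivializationAt F E x₀).symm x f)
  rw [Trivialization.linearMapAt_apply, if_pos h₁] at this
  exact this.symm

variable (H F E) in
/-- The domain of the local coordinates centred at `x₀`. -/
def coordNhd (x₀ : M) : Opens M :=
  ⟨(chartAt H x₀).source ∩ (trivializationAt F E x₀).baseSet,
    (chartAt H x₀).open_source.inter (trivializationAt F E x₀).open_baseSet⟩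

theorem mem_coordNhd (x₀ : M) : x₀ ∈ coordNhd H F E x₀ :=
  ⟨mem_chart_source H x₀, mem_baseSet_trivializationAt F E x₀⟩

variable (H) in
/-- The part of the model space which corresponds to the open set `V` in the chart at `x₀`. -/
def coordDom (x₀ : M) (V : Opens M) : Set H :=
  (chartAt H x₀).target ∩ (chartAt H x₀).symm ⁻¹' V

theorem isOpen_coordDom (x₀ : M) (V : Opens M) : IsOpen (coordDom H x₀ V) :=
  (chartAt H x₀).symm.isOpen_inter_preimage V.2

theorem coordDom_mono (x₀ : M) {V W : Opens M} (h : W ≤ V) : coordDom H x₀ W ⊆ coordDom H x₀ V :=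
  fun _ hy => ⟨hy.1, h hy.2⟩

theorem chart_mem_coordDom {x₀ : M} {V : Opens M} {x : M}
    (hV : V ≤ coordNhd H F E x₀) (hx : x ∈ V) :
    chartAt H x₀ x ∈ coordDom H x₀ V :=
  ⟨(chartAt H x₀).map_source (hV hx).1, by
    rw [Set.mem_preimage, (chartAt H x₀).left_inv (hV hx).1]; exact hx⟩

open Classical in
/-- The local representative of a section of `ΛE^*` in the coordinates centred at `x₀`. -/
def repSec (x₀ : M) {V : Opens M} (s : ∀ x : V, ExtFiber E (x : M)) (y : H) :
    ExteriorAlgebra ℝ (Module.Dual ℝ F) :=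
  if h : (chartAt H x₀).symm y ∈ V then localRep F E x₀ _ (s ⟨(chartAt H x₀).symm y, h⟩) else 0

theorem repSec_of_mem {x₀ : M} {V : Opens M} (s : ∀ x : V, ExtFiber E (x : M)) {y : H}
    (h : (chartAt H x₀).symm y ∈ V) :
    repSec (F := F) x₀ s y = localRep F E x₀ _ (s ⟨(chartAt H x₀).symm y, h⟩) := dif_pos h

theorem repSec_chart {x₀ : M} {V : Opens M} (hV : V ≤ coordNhd H F E x₀)
    (s : ∀ x : V, ExtFiber E (x : M)) (x : V) :
    repSec x₀ s (chartAt H x₀ (x : M)) = localRep F E x₀ x (s x) := by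
  have h : (chartAt H x₀).symm (chartAt H x₀ (x : M)) = x := (chartAt H x₀).left_inv (hV x.2).1
  rw [repSec_of_mem s (by rw [h]; exact x.2)]
  -- The type of `s` at a point depends on that point, so the equality of points is used by
  -- substitution rather than rewriting.
  have key : ∀ (z : M) (hz : z ∈ V), z = x →
      localRep F E x₀ z (s ⟨z, hz⟩) = localRep F E x₀ x (s x) := by
    rintro z hz rfl; rfl
  exact key _ _ h

/-- `IsSmoothSection` uses at each point the trivialization centred there. Smooth coordinate changes
allow the single trivialization at `x₀` to be used throughout, in both directions. -/
theorem isSmoothSection_iff {x₀ : M} {V : Opens M} (hV : V ≤ coordNhd H F E x₀)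
    (s : ∀ x : V, ExtFiber E (x : M)) :
    IsSmoothSection H F E V s ↔ ∀ y ∈ coordDom H x₀ V, WSmoothAt (repSec (F := F) x₀ s) y := by
  classical
  constructor
  · intro hs y hy
    set x := (chartAt H x₀).symm y with hx
    have hxV : x ∈ V := hy.2
    let σ : M → ExteriorAlgebra ℝ (Module.Dual ℝ F) := fun z =>
      if h : z ∈ V then localRep F E x z (s ⟨z, h⟩) else 0
    have hσ : WSmoothAt (fun z => σ ((chartAt H x₀).symm z)) y := by
      intro ℓ
      refine contDiffAt_comp_chart_symm (f := fun z => ℓ (σ z)) hy.1 ?_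
      have h1 := hs ⟨x, hxV⟩ ℓ
      rw [← hx]
      refine (contMDiffAt_subtype_iff (U := V) (f := fun z => ℓ (σ z)) (x := ⟨x, hxV⟩)).1 ?_
      refine h1.congr_of_eventuallyEq (Filter.Eventually.of_forall fun z => ?_)
      simp [σ]
    have hC : ContDiffAt ℝ ∞ (fun z => ((trivializationAt F E x₀).coordChangeL ℝ
        (trivializationAt F E x) ((chartAt H x₀).symm z) : F →L[ℝ] F)) y :=
      contDiffAt_comp_chart_symm (f := fun z => ((trivializationAt F E x₀).coordChangeL ℝ
        (trivializationAt F E x) z : F →L[ℝ] F)) hy.1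
        (contMDiffAt_coordChangeL (hV hxV).2 (mem_baseSet_trivializationAt F E x))
    refine (wsmoothAt_map hC hσ).congr ?_
    have hcont : ContinuousAt (chartAt H x₀).symm y := (chartAt H x₀).continuousAt_symm hy.1
    have hb := hcont.preimage_mem_nhds ((trivializationAt F E x).open_baseSet.mem_nhds
      (mem_baseSet_trivializationAt F E x))
    filter_upwards [hb, (isOpen_coordDom x₀ V).mem_nhds hy] with z hz1 hz2
    rw [repSec_of_mem s hz2.2, localRep_change (hV hz2.2).2 hz1]
    have : (chartAt H x₀).symm z ∈ V := hz2.2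
    simp only [σ, this, dif_pos]
  · intro hs x₁ ℓ
    have hx₁ := hV x₁.2
    have hC : ContDiffAt ℝ ∞ (fun z => ((trivializationAt F E (x₁ : M)).coordChangeL ℝ
        (trivializationAt F E x₀) ((chartAt H x₀).symm z) : F →L[ℝ] F)) (chartAt H x₀ (x₁ : M)) := by
      refine contDiffAt_comp_chart_symm (f := fun z => ((trivializationAt F E (x₁ : M)).coordChangeL ℝ
        (trivializationAt F E x₀) z : F →L[ℝ] F)) ((chartAt H x₀).map_source hx₁.1) ?_
      rw [(chartAt H x₀).left_inv hx₁.1]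
      exact contMDiffAt_coordChangeL (mem_baseSet_trivializationAt F E (x₁ : M)) hx₁.2
    have h1 := contMDiffAt_comp_chart hx₁.1
      (wsmoothAt_map hC (hs _ (chart_mem_coordDom hV x₁.2)) ℓ)
    refine ((contMDiffAt_subtype_iff (U := V)).2 h1).congr_of_eventuallyEq ?_
    have hb := continuous_subtype_val.continuousAt (x := x₁) |>.preimage_mem_nhds
      ((trivializationAt F E (x₁ : M)).open_baseSet.mem_nhds
      (mem_baseSet_trivializationAt F E (x₁ : M)))
    filter_upwards [hb] with z hz
    rw [repSec_chart hV, localRep_change hz (hV z.2).2, (chartAt H x₀).left_inv (hV z.2).1]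

/-- The local representative of a superfunction in the coordinates centred at `x₀`. -/
def rep (x₀ : M) {V : Opens M} (s : SuperFun H F E V) : H → ExteriorAlgebra ℝ (Module.Dual ℝ F) :=
  repSec x₀ s.1

variable {x₀ : M} {V : Opens M}

theorem wsmoothAt_rep (hV : V ≤ coordNhd H F E x₀) (s : SuperFun H F E V) {y : H}
    (hy : y ∈ coordDom H x₀ V) : WSmoothAt (rep x₀ s) y :=
  (isSmoothSection_iff hV s.1).1 s.2 y hy

theorem rep_chart (hV : V ≤ coordNhd H F E x₀) (s : SuperFun H F E V) (x : V) :
    rep x₀ s (chartAt H x₀ (x : M)) = localRep F E x₀ x (s.1 x) := repSec_chart hV s.1 x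

theorem superFun_ext (hV : V ≤ coordNhd H F E x₀) {s t : SuperFun H F E V}
    (h : ∀ y ∈ coordDom H x₀ V, rep x₀ s y = rep x₀ t y) : s = t := by
  refine Subtype.ext (funext fun x => localRep_injective (hV x.2).2 ?_)
  rw [← rep_chart hV, ← rep_chart hV]
  exact h _ (chart_mem_coordDom hV x.2)

/-- The superfunction with a given local representative. -/
def ofRep (hV : V ≤ coordNhd H F E x₀) (S : H → ExteriorAlgebra ℝ (Module.Dual ℝ F))
    (hS : ∀ y ∈ coordDom H x₀ V, WSmoothAt S y) : SuperFun H F E V :=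
  ⟨fun x => localRepInv F E x₀ x (S (chartAt H x₀ (x : M))), (isSmoothSection_iff hV _).2
    fun y hy => (hS y hy).congr (by
      filter_upwards [(isOpen_coordDom x₀ V).mem_nhds hy] with z hz
      rw [repSec_of_mem _ hz.2, localRep_localRepInv (hV hz.2).2, (chartAt H x₀).right_inv hz.1])⟩

theorem rep_ofRep (hV : V ≤ coordNhd H F E x₀) (S : H → ExteriorAlgebra ℝ (Module.Dual ℝ F))
    (hS : ∀ y ∈ coordDom H x₀ V, WSmoothAt S y) {y : H} (hy : y ∈ coordDom H x₀ V) :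
    rep x₀ (ofRep hV S hS) y = S y := by
  rw [rep, repSec_of_mem _ hy.2]
  simp only [ofRep]
  rw [localRep_localRepInv (hV hy.2).2, (chartAt H x₀).right_inv hy.1]

theorem rep_of_mem (s : SuperFun H F E V) {y : H} (hy : y ∈ coordDom H x₀ V) :
    rep x₀ s y = localRep F E x₀ _ (s.1 ⟨(chartAt H x₀).symm y, hy.2⟩) := repSec_of_mem _ hy.2

theorem rep_mul (s t : SuperFun H F E V) {y : H} (hy : y ∈ coordDom H x₀ V) :
    rep x₀ (s * t) y = rep x₀ s y * rep x₀ t y := by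
  simp only [rep_of_mem _ hy]; exact map_mul _ _ _

theorem rep_add (s t : SuperFun H F E V) (y : H) :
    rep x₀ (s + t) y = rep x₀ s y + rep x₀ t y := by
  unfold rep repSec
  split_ifs
  · exact map_add _ _ _
  · simp

theorem rep_smul (c : ℝ) (s : SuperFun H F E V) (y : H) :
    rep x₀ (c • s) y = c • rep x₀ s y := by
  unfold rep repSec
  split_ifs
  · exact map_smul (localRep F E x₀ _) _ _
  · simp

/-- Local representatives as a linear map. -/
def repₗ (x₀ : M) (V : Opens M) (y : H) :
    SuperFun H F E V →ₗ[ℝ] ExteriorAlgebra ℝ (Module.Dual ℝ F) where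
  toFun s := rep x₀ s y
  map_add' s t := rep_add s t y
  map_smul' c s := rep_smul c s y

theorem rep_zero (y : H) : rep x₀ (0 : SuperFun H F E V) y = 0 := (repₗ x₀ V y).map_zero

theorem rep_sub (s t : SuperFun H F E V) (y : H) :
    rep x₀ (s - t) y = rep x₀ s y - rep x₀ t y := (repₗ x₀ V y).map_sub s t

theorem rep_sum {ι : Type*} (I : Finset ι) (s : ι → SuperFun H F E V) (y : H) :
    rep x₀ (∑ i ∈ I, s i) y = ∑ i ∈ I, rep x₀ (s i) y := map_sum (repₗ x₀ V y) s I

theorem rep_algebraMap (c : ℝ) {y : H} (hy : y ∈ coordDom H x₀ V) :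
    rep x₀ (algebraMap ℝ (SuperFun H F E V) c) y = algebraMap ℝ _ c := by
  rw [rep_of_mem _ hy]; exact AlgHom.commutes _ _

theorem rep_res {W : Opens M} (h : W ≤ V) (s : SuperFun H F E V) {y : H}
    (hy : y ∈ coordDom H x₀ W) : rep x₀ (res h s) y = rep x₀ s y := by
  rw [rep_of_mem _ hy, rep_of_mem _ (coordDom_mono x₀ h hy)]; rfl

theorem mem_superFunParity_iff (hV : V ≤ coordNhd H F E x₀) {i : ZMod 2} {s : SuperFun H F E V} :
    s ∈ superFunParity H F E V i ↔
      ∀ y ∈ coordDom H x₀ V, rep x₀ s y ∈ extParity (Module.Dual ℝ F) i := by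
  constructor
  · intro hs y hy
    rw [rep_of_mem _ hy]
    exact map_mem_extParity _ (hs _)
  · intro hs x
    have h1 := hs _ (chart_mem_coordDom hV x.2)
    rw [rep_chart hV] at h1
    have := map_mem_extParity (((trivializationAt F E x₀).linearMapAt ℝ (x : M)).dualMap) h1
    exact localRepInv_localRep (hV x.2).2 (s.1 x) ▸ this

theorem isAffine_iff (hV : V ≤ coordNhd H F E x₀) {s : SuperFun H F E V} :
    IsAffine s ↔ ∀ y ∈ coordDom H x₀ V, ∃ (c : ℝ) (θ : Module.Dual ℝ F),
      rep x₀ s y = algebraMap ℝ _ c + ExteriorAlgebra.ι ℝ θ := by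
  constructor
  · intro hs y hy
    rw [rep_of_mem _ hy]
    obtain ⟨c, θ, h⟩ := hs ⟨(chartAt H x₀).symm y, hy.2⟩
    refine ⟨c, ((trivializationAt F E x₀).symmₗ ℝ _).dualMap θ, ?_⟩
    rw [h, map_add, AlgHom.commutes, localRep, ExteriorAlgebra.map_apply_ι]
  · intro hs x
    obtain ⟨c, θ, h⟩ := hs _ (chart_mem_coordDom hV x.2)
    refine ⟨c, ((trivializationAt F E x₀).linearMapAt ℝ (x : M)).dualMap θ, ?_⟩
    rw [rep_chart hV] at h
    rw [← localRepInv_localRep (F := F) (hV x.2).2 (s.1 x), h, map_add, AlgHom.commutes,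
      localRepInv,
      ExteriorAlgebra.map_apply_ι]

/-- The components of degree 0 and 1 are natural under the exterior map of a transpose, so
evaluation at `e` becomes evaluation at its fibre coordinate. -/
theorem affineFun_eq (hV : V ≤ coordNhd H F E x₀) (s : SuperFun H F E V) {e : TotalSpace F E}
    (he : e.proj ∈ V) :
    affineFun s e =
      affineEval (trivializationAt F E x₀ e).2 (rep x₀ s (chartAt H x₀ e.proj)) := by
  rw [affineFun, dif_pos he]
  have := rep_chart hV s ⟨e.proj, he⟩
  simp only at this
  rw [this, affineEval_apply, localRep, body_map, ιInv_map]
  simp only [LinearMap.dualMap_apply]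
  congr 2
  have h2 := Trivialization.symmₗ_linearMapAt (R := ℝ) (trivializationAt F E x₀) (hV he).2 e.snd
  rw [Trivialization.linearMapAt_apply, if_pos (hV he).2] at h2
  exact h2.symm

theorem affineFun_res {W : Opens M} (h : W ≤ V) (s : SuperFun H F E V) {e : TotalSpace F E}
    (he : e.proj ∈ W) : affineFun (res h s) e = affineFun s e := by
  rw [affineFun, affineFun, dif_pos he, dif_pos (h he)]; rfl

end LocalCoordinates

/-! ### Open subsets of an open set as indices. -/

section Iic

variable {P : Type*} [Preorder P]

theorem iic_le {U : P} (V : Set.Iic U) : V.1 ≤ U := V.2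

/-- The largest element of `Set.Iic W`. -/
abbrev iicTop (W : P) : Set.Iic W := ⟨W, le_refl W⟩

end Iic

/-! ### Coordinate superderivations and the expansion of a superderivation. -/

section Derivations

variable {M : Type*} [TopologicalSpace M]
  {H : Type*} [NormedAddCommGroup H] [NormedSpace ℝ H] [FiniteDimensional ℝ H]
  [ChartedSpace H M] [IsManifold 𝓘(ℝ, H) ∞ M]
  {F : Type*} [NormedAddCommGroup F] [NormedSpace ℝ F] [FiniteDimensional ℝ F]
  {E : M → Type*} [∀ x, AddCommGroup (E x)] [∀ x, Module ℝ (E x)] [∀ x, TopologicalSpace (E x)]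
  [TopologicalSpace (TotalSpace F E)] [FiberBundle F E] [VectorBundle ℝ F E]
  [ContMDiffVectorBundle ∞ F E 𝓘(ℝ, H)] {x₀ : M}

theorem wsmoothAt_algebraMap {u : H → ℝ} {y : H} (hu : ContDiffAt ℝ ∞ u y) :
    WSmoothAt (fun z => algebraMap ℝ (ExteriorAlgebra ℝ (Module.Dual ℝ F)) (u z)) y := by
  simpa only [Algebra.algebraMap_eq_smul_one] using WSmoothAt.smul hu (WSmoothAt.const 1 y)

theorem dual_contDiff (l : Module.Dual ℝ H) : ContDiff ℝ ∞ l :=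
  (LinearMap.toContinuousLinearMap l).contDiff

theorem wderiv_algebraMap_dual (l : Module.Dual ℝ H) (v y : H) :
    wderiv v (fun z => algebraMap ℝ (ExteriorAlgebra ℝ (Module.Dual ℝ F)) (l z)) y =
      algebraMap ℝ _ (l v) := by
  refine eq_of_forall_dual fun ℓ => ?_
  rw [(wsmoothAt_algebraMap (dual_contDiff l).contDiffAt).apply_wderiv]
  simp only [Algebra.algebraMap_eq_smul_one, map_smul, smul_eq_mul]
  have h : HasFDerivAt (fun z => l z * ℓ 1) (ℓ 1 • LinearMap.toContinuousLinearMap l) y :=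
    (LinearMap.toContinuousLinearMap l).hasFDerivAt.mul_const (ℓ 1)
  rw [h.fderiv]
  simp [mul_comm]

/-- The subspace of parity `i` is the kernel of a linear map, and differentiation commutes with
linear maps. -/
theorem wderiv_mem_extParity {S : H → ExteriorAlgebra ℝ (Module.Dual ℝ F)} {y : H} {i : ZMod 2}
    (hS : WSmoothAt S y) (h : ∀ᶠ z in nhds y, S z ∈ extParity _ i) (v : H) :
    wderiv v S y ∈ extParity _ i := by
  let T : ExteriorAlgebra ℝ (Module.Dual ℝ F) →ₗ[ℝ] ExteriorAlgebra ℝ (Module.Dual ℝ F) :=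
    (parityInv (Module.Dual ℝ F)).toLinearMap - koszul i 1 • LinearMap.id
  have h1 := wderiv_map hS T v
  have h2 : (fun z => T (S z)) =ᶠ[nhds y] fun _ => 0 := h.mono fun z hz => by
    simp [T, mem_extParity_iff.1 hz]
  rw [wderiv_congr h2, wderiv_const] at h1
  rw [mem_extParity_iff]
  have h3 : parityInv (Module.Dual ℝ F) (wderiv v S y) - koszul i 1 • wderiv v S y = 0 := h1.symm
  exact sub_eq_zero.1 h3

/-- The derivative of superfunctions in the direction of a constant vector field in the coordinates
centred at `x₀`. -/
def evenCoordFam (x₀ : M) (v : H) : EndFamily H F E (coordNhd H F E x₀) := fun V =>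
  { toFun := fun s => ofRep (iic_le V) (wderiv v (rep x₀ s)) fun _ hy =>
      (wsmoothAt_rep (iic_le V) s hy).wderiv v
    map_add' := fun s t => superFun_ext (iic_le V) fun y hy => by
      rw [rep_add, rep_ofRep _ _ _ hy, rep_ofRep _ _ _ hy, rep_ofRep _ _ _ hy,
        ← wderiv_add (wsmoothAt_rep (iic_le V) s hy) (wsmoothAt_rep (iic_le V) t hy)]
      simp only [← rep_add]
    map_smul' := fun c s => superFun_ext (iic_le V) fun y hy => by
      rw [RingHom.id_apply, rep_smul, rep_ofRep _ _ _ hy, rep_ofRep _ _ _ hy]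
      have := wderiv_map (wsmoothAt_rep (iic_le V) s hy)
        (c • LinearMap.id : _ →ₗ[ℝ] ExteriorAlgebra ℝ (Module.Dual ℝ F)) v
      simp only [LinearMap.smul_apply, LinearMap.id_apply] at this
      rw [← this]
      simp only [← rep_smul] }

theorem rep_evenCoordFam (v : H) (V : Set.Iic (coordNhd H F E x₀)) (s : SuperFun H F E V.1) {y : H}
    (hy : y ∈ coordDom H x₀ V.1) :
    rep x₀ (evenCoordFam x₀ v V s) y = wderiv v (rep x₀ s) y :=
  rep_ofRep (iic_le V) _ (fun _ hy => (wsmoothAt_rep (iic_le V) s hy).wderiv v) hy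

theorem evenCoordFam_mem (v : H) :
    evenCoordFam x₀ v ∈ superDer H F E (coordNhd H F E x₀) 0 := by
  refine ⟨fun V W h s => superFun_ext (iic_le W) fun y hy => ?_,
    fun V j s hs => (mem_superFunParity_iff (iic_le V)).2 fun y hy => ?_,
    fun V j a ha b => superFun_ext (iic_le V) fun y hy => ?_⟩
  · rw [rep_res h _ hy, rep_evenCoordFam v V s (coordDom_mono x₀ h hy), rep_evenCoordFam v W _ hy]
    refine wderiv_congr ?_ v
    filter_upwards [(isOpen_coordDom x₀ W.1).mem_nhds hy] with z hz
    rw [rep_res h _ hz]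
  · rw [rep_evenCoordFam v V s hy, zero_add]
    refine wderiv_mem_extParity (wsmoothAt_rep (iic_le V) s hy) ?_ v
    filter_upwards [(isOpen_coordDom x₀ V.1).mem_nhds hy] with z hz
    exact (mem_superFunParity_iff (iic_le V)).1 hs z hz
  · have hk : koszul 0 j = 1 := by simp [koszul]
    rw [hk, one_smul, rep_add, rep_mul _ _ hy, rep_mul _ _ hy, rep_evenCoordFam v V _ hy,
      rep_evenCoordFam v V _ hy, rep_evenCoordFam v V _ hy,
      ← wderiv_mul (wsmoothAt_rep (iic_le V) a hy) (wsmoothAt_rep (iic_le V) b hy)]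
    refine wderiv_congr ?_ v
    filter_upwards [(isOpen_coordDom x₀ V.1).mem_nhds hy] with z hz
    rw [rep_mul _ _ hz]

/-- The interior product of superfunctions with a constant section of `E` in the coordinates centred
at `x₀`. -/
def oddCoordFam (x₀ : M) (a : F) : EndFamily H F E (coordNhd H F E x₀) := fun V =>
  { toFun := fun s => ofRep (iic_le V) (fun y => contract (Module.Dual.eval ℝ F a) (rep x₀ s y))
      fun _ hy => (wsmoothAt_rep (iic_le V) s hy).map _
    map_add' := fun s t => superFun_ext (iic_le V) fun y hy => by
      rw [rep_add, rep_ofRep _ _ _ hy, rep_ofRep _ _ _ hy, rep_ofRep _ _ _ hy, rep_add, map_add]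
    map_smul' := fun c s => superFun_ext (iic_le V) fun y hy => by
      rw [RingHom.id_apply, rep_smul, rep_ofRep _ _ _ hy, rep_ofRep _ _ _ hy, rep_smul, map_smul] }

theorem rep_oddCoordFam (a : F) (V : Set.Iic (coordNhd H F E x₀)) (s : SuperFun H F E V.1) {y : H}
    (hy : y ∈ coordDom H x₀ V.1) :
    rep x₀ (oddCoordFam x₀ a V s) y = contract (Module.Dual.eval ℝ F a) (rep x₀ s y) :=
  rep_ofRep (iic_le V) _ _ hy

theorem oddCoordFam_mem (a : F) :
    oddCoordFam x₀ a ∈ superDer H F E (coordNhd H F E x₀) 1 := by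
  refine ⟨fun V W h s => superFun_ext (iic_le W) fun y hy => ?_,
    fun V j s hs => (mem_superFunParity_iff (iic_le V)).2 fun y hy => ?_,
    fun V j s hs b => superFun_ext (iic_le V) fun y hy => ?_⟩
  · rw [rep_res h _ hy, rep_oddCoordFam a V s (coordDom_mono x₀ h hy), rep_oddCoordFam a W _ hy,
      rep_res h _ hy]
  · rw [rep_oddCoordFam a V s hy]
    exact contract_mem ((mem_superFunParity_iff (iic_le V)).1 hs y hy)
  · have hk : koszul 1 j = koszul j 1 := by simp [koszul, and_comm]
    rw [rep_add, rep_smul, rep_mul _ _ hy, rep_mul _ _ hy, rep_oddCoordFam a V _ hy,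
      rep_oddCoordFam a V _ hy, rep_oddCoordFam a V _ hy, rep_mul _ _ hy, contract_mul,
      mem_extParity_iff.1 ((mem_superFunParity_iff (iic_le V)).1 hs y hy), hk, smul_mul_assoc]

/-- The even coordinate superderivations at `x₀`. -/
def evenCoordDer (x₀ : M) : H →ₗ[ℝ] tangentSheaf H F E (coordNhd H F E x₀) where
  toFun v := ⟨evenCoordFam x₀ v, Submodule.mem_sup_left (evenCoordFam_mem v)⟩
  map_add' v w := Subtype.ext (funext fun V => LinearMap.ext fun s =>
      superFun_ext (iic_le V) fun y hy => by
    change _ = rep x₀ (evenCoordFam x₀ v V s + evenCoordFam x₀ w V s) y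
    rw [rep_add, rep_evenCoordFam _ V _ hy, rep_evenCoordFam _ V _ hy, rep_evenCoordFam _ V _ hy,
      wderiv_add_dir])
  map_smul' c v := Subtype.ext (funext fun V => LinearMap.ext fun s =>
      superFun_ext (iic_le V) fun y hy => by
    change _ = rep x₀ (c • evenCoordFam x₀ v V s) y
    rw [rep_smul, rep_evenCoordFam _ V _ hy, rep_evenCoordFam _ V _ hy, wderiv_smul_dir])

/-- The odd coordinate superderivations at `x₀`. -/
def oddCoordDer (x₀ : M) : F →ₗ[ℝ] tangentSheaf H F E (coordNhd H F E x₀) where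
  toFun a := ⟨oddCoordFam x₀ a, Submodule.mem_sup_right (oddCoordFam_mem a)⟩
  map_add' v w := Subtype.ext (funext fun V => LinearMap.ext fun s =>
      superFun_ext (iic_le V) fun y hy => by
    change _ = rep x₀ (oddCoordFam x₀ v V s + oddCoordFam x₀ w V s) y
    rw [rep_add, rep_oddCoordFam _ V _ hy, rep_oddCoordFam _ V _ hy, rep_oddCoordFam _ V _ hy,
      map_add, contract, map_add]
    rfl)
  map_smul' c v := Subtype.ext (funext fun V => LinearMap.ext fun s =>
      superFun_ext (iic_le V) fun y hy => by
    change _ = rep x₀ (c • oddCoordFam x₀ v V s) y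
    rw [rep_smul, rep_oddCoordFam _ V _ hy, rep_oddCoordFam _ V _ hy, map_smul, contract, map_smul]
    rfl)

variable {V W : Opens M}

/-- The even superfunction given by a smooth function of the coordinates. -/
def evenFun (hV : V ≤ coordNhd H F E x₀) (u : H → ℝ)
    (hu : ∀ y ∈ coordDom H x₀ V, ContDiffAt ℝ ∞ u y) : SuperFun H F E V :=
  ofRep hV (fun y => algebraMap ℝ _ (u y)) fun y hy => wsmoothAt_algebraMap (hu y hy)

/-- The superfunction with constant local representative. -/
def constFun (hV : V ≤ coordNhd H F E x₀) (c : ExteriorAlgebra ℝ (Module.Dual ℝ F)) :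
    SuperFun H F E V :=
  ofRep hV (fun _ => c) fun y _ => WSmoothAt.const c y

/-- The even superfunction given by a linear function of the coordinates. -/
def evenCoord (hV : V ≤ coordNhd H F E x₀) (l : Module.Dual ℝ H) : SuperFun H F E V :=
  evenFun hV l fun _ _ => (dual_contDiff l).contDiffAt

/-- The odd superfunction given by a constant section of `E^*`. -/
def oddCoord (hV : V ≤ coordNhd H F E x₀) (θ : Module.Dual ℝ F) : SuperFun H F E V :=
  constFun hV (ExteriorAlgebra.ι ℝ θ)

theorem rep_evenFun (hV : V ≤ coordNhd H F E x₀) (u : H → ℝ)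
    (hu : ∀ y ∈ coordDom H x₀ V, ContDiffAt ℝ ∞ u y) {y : H} (hy : y ∈ coordDom H x₀ V) :
    rep x₀ (evenFun hV u hu) y = algebraMap ℝ _ (u y) := rep_ofRep hV _ _ hy

theorem rep_evenCoord (hV : V ≤ coordNhd H F E x₀) (l : Module.Dual ℝ H) {y : H}
    (hy : y ∈ coordDom H x₀ V) :
    rep x₀ (evenCoord hV l) y = algebraMap ℝ _ (l y) := rep_ofRep hV _ _ hy

theorem rep_constFun (hV : V ≤ coordNhd H F E x₀) (c : ExteriorAlgebra ℝ (Module.Dual ℝ F)) {y : H}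
    (hy : y ∈ coordDom H x₀ V) : rep x₀ (constFun hV c) y = c := rep_ofRep hV _ _ hy

theorem rep_oddCoord (hV : V ≤ coordNhd H F E x₀) (θ : Module.Dual ℝ F) {y : H}
    (hy : y ∈ coordDom H x₀ V) : rep x₀ (oddCoord hV θ) y = ExteriorAlgebra.ι ℝ θ :=
  rep_ofRep hV _ _ hy

theorem evenFun_mem (hV : V ≤ coordNhd H F E x₀) (u : H → ℝ)
    (hu : ∀ y ∈ coordDom H x₀ V, ContDiffAt ℝ ∞ u y) :
    evenFun hV u hu ∈ superFunParity H F E V 0 :=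
  (mem_superFunParity_iff hV).2 fun y hy => by
    rw [rep_evenFun hV u hu hy]; exact algebraMap_mem_extParity _

theorem evenCoord_mem (hV : V ≤ coordNhd H F E x₀) (l : Module.Dual ℝ H) :
    evenCoord hV l ∈ superFunParity H F E V 0 := evenFun_mem hV _ _

theorem oddCoord_mem (hV : V ≤ coordNhd H F E x₀) (θ : Module.Dual ℝ F) :
    oddCoord hV θ ∈ superFunParity H F E V 1 :=
  (mem_superFunParity_iff hV).2 fun y hy => by
    rw [rep_oddCoord hV θ hy]; exact ι_mem_extParity _

theorem evenCoord_isAffine (hV : V ≤ coordNhd H F E x₀) (l : Module.Dual ℝ H) :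
    IsAffine (evenCoord hV l) :=
  (isAffine_iff hV).2 fun y hy => ⟨l y, 0, by rw [rep_evenCoord hV l hy]; simp⟩

theorem oddCoord_isAffine (hV : V ≤ coordNhd H F E x₀) (θ : Module.Dual ℝ F) :
    IsAffine (oddCoord hV θ) :=
  (isAffine_iff hV).2 fun y hy => ⟨0, θ, by rw [rep_oddCoord hV θ hy]; simp⟩

theorem algebraMap_mem_superFunParity (c : ℝ) :
    algebraMap ℝ (SuperFun H F E V) c ∈ superFunParity H F E V 0 :=
  fun _ => algebraMap_mem_extParity c

theorem superDer_algebraMap {i : ZMod 2} {D : EndFamily H F E W} (hD : D ∈ superDer H F E W i)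
    (V : Set.Iic W) (c : ℝ) : D V (algebraMap ℝ _ c) = 0 := by
  have h1 : D V 1 = 0 := by
    have h := hD.2.2 V 0 1 (by simpa using algebraMap_mem_superFunParity (1 : ℝ)) 1
    have hk : koszul i 0 = 1 := by simp [koszul]
    rw [hk, one_smul, mul_one, mul_one, one_mul] at h
    exact left_eq_add.1 h
  rw [Algebra.algebraMap_eq_smul_one, map_smul, h1, smul_zero]

/-- By the Leibniz rule `D` kills constant sections, since covectors generate `Λ F^*`. By Hadamard's
lemma it kills functions. Every superfunction is a finite sum of products of the two kinds. -/
theorem superDer_eq_zero (hW : W ≤ coordNhd H F E x₀) {i : ZMod 2} {D : EndFamily H F E W}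
    (hD : D ∈ superDer H F E W i)
    (heven : ∀ j, D (iicTop W) (evenCoord hW ((Module.finBasis ℝ H).coord j)) = 0)
    (hodd : ∀ j, D (iicTop W) (oddCoord hW ((Module.finBasis ℝ F).coord j)) = 0) : D = 0 := by
  have hk : koszul i 0 = 1 := by simp [koszul]
  have heven' : ∀ (V : Set.Iic W) j,
      D V (evenCoord ((iic_le V).trans hW) ((Module.finBasis ℝ H).coord j)) = 0 := by
    intro V j
    have h := hD.1 (iicTop W) V (iic_le V) (evenCoord hW ((Module.finBasis ℝ H).coord j))
    rw [heven, map_zero] at h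
    rw [h]
    congr 1
  have hodd' : ∀ (V : Set.Iic W) (θ : Module.Dual ℝ F),
      D V (oddCoord ((iic_le V).trans hW) θ) = 0 := by
    intro V θ
    have h1 : oddCoord ((iic_le V).trans hW) θ = ∑ j, θ (Module.finBasis ℝ F j) •
        oddCoord ((iic_le V).trans hW) ((Module.finBasis ℝ F).coord j) := by
      refine superFun_ext ((iic_le V).trans hW) fun y hy => ?_
      rw [rep_sum, rep_oddCoord _ _ hy]
      simp only [rep_smul, rep_oddCoord _ _ hy]
      conv_lhs => rw [← (Module.finBasis ℝ F).sum_dual_apply_smul_coord θ]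
      simp only [map_sum, map_smul]
    rw [h1, map_sum]
    refine Finset.sum_eq_zero fun j _ => ?_
    rw [map_smul]
    have h := hD.1 (iicTop W) V (iic_le V) (oddCoord hW ((Module.finBasis ℝ F).coord j))
    rw [hodd, map_zero] at h
    have h2 : oddCoord ((iic_le V).trans hW) ((Module.finBasis ℝ F).coord j) =
        res (iic_le V) (oddCoord hW ((Module.finBasis ℝ F).coord j)) := by
      refine superFun_ext ((iic_le V).trans hW) fun y hy => ?_
      rw [rep_res _ _ hy, rep_oddCoord _ _ hy, rep_oddCoord _ _ (coordDom_mono x₀ (iic_le V) hy)]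
    rw [h2, ← h, smul_zero]
  have hconst : ∀ (V : Set.Iic W) (c : ExteriorAlgebra ℝ (Module.Dual ℝ F)),
      D V (constFun ((iic_le V).trans hW) c) = 0 := by
    intro V c
    have hV := (iic_le V).trans hW
    induction c using exterior_left_induction with
    | algebraMap r =>
      have : constFun hV (algebraMap ℝ _ r) = algebraMap ℝ (SuperFun H F E V.1) r :=
        superFun_ext hV fun y hy => by rw [rep_constFun _ _ hy, rep_algebraMap _ hy]
      rw [this, superDer_algebraMap hD]
    | add x y hx hy =>
      have : constFun hV (x + y) = constFun hV x + constFun hV y :=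
        superFun_ext hV fun z hz => by
          rw [rep_add, rep_constFun _ _ hz, rep_constFun _ _ hz, rep_constFun _ _ hz]
      rw [this, map_add, hx, hy, add_zero]
    | ι_mul x θ hx =>
      have : constFun hV (ExteriorAlgebra.ι ℝ θ * x) = oddCoord hV θ * constFun hV x :=
        superFun_ext hV fun z hz => by
          rw [rep_mul _ _ hz, rep_constFun _ _ hz, rep_constFun _ _ hz, rep_oddCoord _ _ hz]
      rw [this, hD.2.2 V 1 _ (oddCoord_mem hV θ), hodd', hx]
      simp
  have hfun : ∀ (V : Set.Iic W) (u : H → ℝ) (hu : ∀ y ∈ coordDom H x₀ V.1, ContDiffAt ℝ ∞ u y),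
      D V (evenFun ((iic_le V).trans hW) u hu) = 0 := by
    intro V u hu
    have hV := (iic_le V).trans hW
    refine superFun_ext hV fun y₀ hy₀ => ?_
    obtain ⟨O, h, hO, hyO, hh, hexp⟩ := hadamard_local (isOpen_coordDom x₀ V.1) hy₀
      (fun y hy => (hu y hy).contDiffWithinAt)
    -- The Hadamard expansion holds only near `y₀`; compatibility of `D` with restriction allows
    -- computing on this smaller open set.
    let V' : Set.Iic W := ⟨V.1 ⊓ ⟨_, (chartAt H x₀).isOpen_inter_preimage hO⟩,
      inf_le_left.trans (iic_le V)⟩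
    have hV'V : V'.1 ≤ V.1 := inf_le_left
    have hV' := (iic_le V').trans hW
    have hy₀' : y₀ ∈ coordDom H x₀ V'.1 := ⟨hy₀.1, hy₀.2, (chartAt H x₀).map_target hy₀.1, by
      rw [Set.mem_preimage, (chartAt H x₀).right_inv hy₀.1]; exact hyO⟩
    have hdom : ∀ y ∈ coordDom H x₀ V'.1, y ∈ O := fun y hy => by
      have := hy.2.2.2
      rwa [Set.mem_preimage, (chartAt H x₀).right_inv hy.1] at this
    have hres : res hV'V (evenFun hV u hu) = algebraMap ℝ _ (u y₀) + ∑ j,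
        (evenCoord hV' ((Module.finBasis ℝ H).coord j) -
          algebraMap ℝ _ ((Module.finBasis ℝ H).coord j y₀)) *
        evenFun hV' (h j) (fun y _ => (hh j).contDiffAt) := by
      refine superFun_ext hV' fun y hy => ?_
      rw [rep_res _ _ hy, rep_evenFun _ _ _ (coordDom_mono x₀ hV'V hy), rep_add, rep_sum,
        rep_algebraMap _ hy, hexp y (hdom y hy), map_add, map_sum]
      congr 1
      refine Finset.sum_congr rfl fun j _ => ?_
      rw [rep_mul _ _ hy, rep_evenFun _ _ _ hy, map_mul, map_sub, rep_sub,
        rep_evenCoord _ _ hy, rep_algebraMap _ hy]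
    -- Since `D` kills constants and coordinates, each remaining term is a centred coordinate times
    -- `D (h j)`, which vanishes at `y₀`.
    rw [← rep_res hV'V _ hy₀', hD.1 V V' hV'V, hres, map_add, superDer_algebraMap hD, zero_add,
      map_sum, rep_sum, rep_zero]
    refine Finset.sum_eq_zero fun j _ => ?_
    rw [hD.2.2 V' 0 _ (sub_mem (evenCoord_mem hV' _) (algebraMap_mem_superFunParity _)), map_sub,
      heven', superDer_algebraMap hD, sub_zero, zero_mul, zero_add, hk, one_smul,
      rep_mul _ _ hy₀', rep_sub, rep_evenCoord _ _ hy₀', rep_algebraMap _ hy₀', sub_self, zero_mul]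
  funext V
  refine LinearMap.ext fun s => ?_
  have hV := (iic_le V).trans hW
  -- Expansion in a basis of `Λ F^*` with smooth functions as coefficients.
  have hs : s = ∑ j, evenFun hV (fun y => (Module.finBasis ℝ _).coord j (rep x₀ s y))
      (fun y hy => wsmoothAt_rep hV s hy _) * constFun hV (Module.finBasis ℝ _ j) := by
    refine superFun_ext hV fun y hy => ?_
    rw [rep_sum]
    conv_lhs => rw [← (Module.finBasis ℝ _).sum_repr (rep x₀ s y)]
    refine Finset.sum_congr rfl fun j _ => ?_
    rw [rep_mul _ _ hy, rep_evenFun _ _ _ hy, rep_constFun _ _ hy, ← Algebra.smul_def]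
    rfl
  rw [hs, map_sum]
  refine (Finset.sum_eq_zero fun j _ => ?_).trans rfl
  rw [hD.2.2 V 0 _ (evenFun_mem hV _ _), hfun, hconst]
  simp

theorem evenCoordDer_parity (h : W ≤ coordNhd H F E x₀) (v : H) :
    HasParity (resT h (evenCoordDer (E := E) x₀ v)) 0 := resFam_mem h (evenCoordFam_mem v)

theorem oddCoordDer_parity (h : W ≤ coordNhd H F E x₀) (a : F) :
    HasParity (resT h (oddCoordDer (E := E) x₀ a)) 1 := resFam_mem h (oddCoordFam_mem a)

theorem evenCoordFam_evenCoord (V : Set.Iic (coordNhd H F E x₀)) (v : H) (l : Module.Dual ℝ H) :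
    evenCoordFam x₀ v V (evenCoord (iic_le V) l) = algebraMap ℝ _ (l v) := by
  refine superFun_ext (iic_le V) fun y hy => ?_
  rw [rep_evenCoordFam v V _ hy, rep_algebraMap _ hy, ← wderiv_algebraMap_dual l v y]
  refine wderiv_congr ?_ v
  filter_upwards [(isOpen_coordDom x₀ V.1).mem_nhds hy] with z hz using rep_evenCoord _ _ hz

theorem evenCoordFam_oddCoord (V : Set.Iic (coordNhd H F E x₀)) (v : H) (θ : Module.Dual ℝ F) :
    evenCoordFam x₀ v V (oddCoord (iic_le V) θ) = 0 := by
  refine superFun_ext (iic_le V) fun y hy => ?_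
  rw [rep_evenCoordFam v V _ hy, rep_zero, ← wderiv_const (ExteriorAlgebra.ι ℝ θ) y v]
  refine wderiv_congr ?_ v
  filter_upwards [(isOpen_coordDom x₀ V.1).mem_nhds hy] with z hz using rep_oddCoord _ _ hz

theorem oddCoordFam_evenCoord (V : Set.Iic (coordNhd H F E x₀)) (a : F) (l : Module.Dual ℝ H) :
    oddCoordFam x₀ a V (evenCoord (iic_le V) l) = 0 := by
  refine superFun_ext (iic_le V) fun y hy => ?_
  rw [rep_oddCoordFam a V _ hy, rep_zero, rep_evenCoord _ _ hy, contract_algebraMap]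

theorem oddCoordFam_oddCoord (V : Set.Iic (coordNhd H F E x₀)) (a : F) (θ : Module.Dual ℝ F) :
    oddCoordFam x₀ a V (oddCoord (iic_le V) θ) = algebraMap ℝ _ (θ a) := by
  refine superFun_ext (iic_le V) fun y hy => ?_
  rw [rep_oddCoordFam a V _ hy, rep_algebraMap _ hy, rep_oddCoord _ _ hy, contract_ι]
  rfl

/-- Evaluation of families of endomorphisms at a superfunction. -/
def evalFam {U : Opens M} (V : Set.Iic U) (s : SuperFun H F E V.1) :
    EndFamily H F E U →ₗ[ℝ] SuperFun H F E V.1 where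
  toFun X := X V s
  map_add' _ _ := rfl
  map_smul' _ _ := rfl

theorem evalFam_smulT_evenCoordDer_evenCoord (hW : W ≤ coordNhd H F E x₀) (f : SuperFun H F E W)
    (v : H) (l : Module.Dual ℝ H) :
    evalFam (iicTop W) (evenCoord hW l) (smulT f (resT hW (evenCoordDer x₀ v))).1 = l v • f := by
  have h : evenCoordFam x₀ v ⟨W, hW⟩ (evenCoord hW l) = _ := evenCoordFam_evenCoord ⟨W, hW⟩ v l
  change f * evenCoordFam x₀ v ⟨W, hW⟩ (evenCoord hW l) = _
  rw [h]
  rw [Algebra.algebraMap_eq_smul_one, mul_smul_comm, mul_one]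

theorem evalFam_smulT_evenCoordDer_oddCoord (hW : W ≤ coordNhd H F E x₀) (f : SuperFun H F E W)
    (v : H) (l : Module.Dual ℝ F) :
    evalFam (iicTop W) (oddCoord hW l) (smulT f (resT hW (evenCoordDer x₀ v))).1 = 0 := by
  have h : evenCoordFam x₀ v ⟨W, hW⟩ (oddCoord hW l) = _ := evenCoordFam_oddCoord ⟨W, hW⟩ v l
  change f * evenCoordFam x₀ v ⟨W, hW⟩ (oddCoord hW l) = _
  rw [h]
  exact mul_zero f

theorem evalFam_smulT_oddCoordDer_evenCoord (hW : W ≤ coordNhd H F E x₀) (f : SuperFun H F E W)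
    (v : F) (l : Module.Dual ℝ H) :
    evalFam (iicTop W) (evenCoord hW l) (smulT f (resT hW (oddCoordDer x₀ v))).1 = 0 := by
  have h : oddCoordFam x₀ v ⟨W, hW⟩ (evenCoord hW l) = _ := oddCoordFam_evenCoord ⟨W, hW⟩ v l
  change f * oddCoordFam x₀ v ⟨W, hW⟩ (evenCoord hW l) = _
  rw [h]
  exact mul_zero f

theorem evalFam_smulT_oddCoordDer_oddCoord (hW : W ≤ coordNhd H F E x₀) (f : SuperFun H F E W)
    (v : F) (l : Module.Dual ℝ F) :
    evalFam (iicTop W) (oddCoord hW l) (smulT f (resT hW (oddCoordDer x₀ v))).1 = l v • f := by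
  have h : oddCoordFam x₀ v ⟨W, hW⟩ (oddCoord hW l) = _ := oddCoordFam_oddCoord ⟨W, hW⟩ v l
  change f * oddCoordFam x₀ v ⟨W, hW⟩ (oddCoord hW l) = _
  rw [h]
  rw [Algebra.algebraMap_eq_smul_one, mul_smul_comm, mul_one]

theorem evalFam_combination_evenCoord (hW : W ≤ coordNhd H F E x₀)
    (f : Fin (Module.finrank ℝ H) → SuperFun H F E W)
    (f' : Fin (Module.finrank ℝ F) → SuperFun H F E W) (k : Fin (Module.finrank ℝ H)) :
    evalFam (iicTop W) (evenCoord hW ((Module.finBasis ℝ H).coord k))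
      (∑ j, smulT (f j) (resT hW (evenCoordDer x₀ (Module.finBasis ℝ H j))) +
        ∑ j, smulT (f' j) (resT hW (oddCoordDer x₀ (Module.finBasis ℝ F j)))).1 = f k := by
  rw [Submodule.coe_add, map_add, AddSubmonoidClass.coe_finsetSum,
    AddSubmonoidClass.coe_finsetSum, map_sum, map_sum,
    Finset.sum_congr rfl fun j _ => evalFam_smulT_evenCoordDer_evenCoord hW (f j) _ _,
    Finset.sum_congr rfl fun j _ => evalFam_smulT_oddCoordDer_evenCoord hW (f' j) _ _]
  simp [Finsupp.single_apply]

theorem evalFam_combination_oddCoord (hW : W ≤ coordNhd H F E x₀)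
    (f : Fin (Module.finrank ℝ H) → SuperFun H F E W)
    (f' : Fin (Module.finrank ℝ F) → SuperFun H F E W) (k : Fin (Module.finrank ℝ F)) :
    evalFam (iicTop W) (oddCoord hW ((Module.finBasis ℝ F).coord k))
      (∑ j, smulT (f j) (resT hW (evenCoordDer x₀ (Module.finBasis ℝ H j))) +
        ∑ j, smulT (f' j) (resT hW (oddCoordDer x₀ (Module.finBasis ℝ F j)))).1 = f' k := by
  rw [Submodule.coe_add, map_add, AddSubmonoidClass.coe_finsetSum,
    AddSubmonoidClass.coe_finsetSum, map_sum, map_sum,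
    Finset.sum_congr rfl fun j _ => evalFam_smulT_evenCoordDer_oddCoord hW (f j) _ _,
    Finset.sum_congr rfl fun j _ => evalFam_smulT_oddCoordDer_oddCoord hW (f' j) _ _]
  simp [Finsupp.single_apply]

/-- Every homogeneous superderivation on a coordinate domain is a combination of the coordinate
superderivations, its coefficients being its values on the coordinates. -/
theorem tangentSheaf_expansion (hW : W ≤ coordNhd H F E x₀) {i : ZMod 2}
    {X : tangentSheaf H F E W} (hX : HasParity X i) :
    X = ∑ j, smulT (X.1 (iicTop W) (evenCoord hW ((Module.finBasis ℝ H).coord j)))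
          (resT hW (evenCoordDer x₀ (Module.finBasis ℝ H j))) +
      ∑ j, smulT (X.1 (iicTop W) (oddCoord hW ((Module.finBasis ℝ F).coord j)))
          (resT hW (oddCoordDer x₀ (Module.finBasis ℝ F j))) := by
  -- The difference of the two sides is a superderivation of parity `i` that vanishes on all
  -- coordinates.
  refine Subtype.ext (sub_eq_zero.1 (superDer_eq_zero hW (i := i) ?_ (fun k => ?_) fun k => ?_))
  · refine sub_mem hX (add_mem ?_ ?_)
    · rw [AddSubmonoidClass.coe_finsetSum]
      refine sum_mem fun j _ => ?_
      have h := smulFam_mem (hX.2.1 (iicTop W) 0 _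
        (evenCoord_mem hW ((Module.finBasis ℝ H).coord j)))
        (evenCoordDer_parity hW (Module.finBasis ℝ H j))
      rwa [add_zero, add_zero] at h
    · rw [AddSubmonoidClass.coe_finsetSum]
      refine sum_mem fun j _ => ?_
      have h := smulFam_mem (hX.2.1 (iicTop W) 1 _
        (oddCoord_mem hW ((Module.finBasis ℝ F).coord j)))
        (oddCoordDer_parity hW (Module.finBasis ℝ F j))
      rwa [add_assoc, show (1 + 1 : ZMod 2) = 0 from by decide, add_zero] at h
  · exact sub_eq_zero.2 (evalFam_combination_evenCoord hW
      (fun j => X.1 (iicTop W) (evenCoord hW ((Module.finBasis ℝ H).coord j)))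
      (fun j => X.1 (iicTop W) (oddCoord hW ((Module.finBasis ℝ F).coord j))) k).symm
  · exact sub_eq_zero.2 (evalFam_combination_oddCoord hW
      (fun j => X.1 (iicTop W) (evenCoord hW ((Module.finBasis ℝ H).coord j)))
      (fun j => X.1 (iicTop W) (oddCoord hW ((Module.finBasis ℝ F).coord j))) k).symm

/-- The coefficients on even and odd coordinates have parity `i` and `i + 1`; moving them past `g`
produces the two signs. -/
theorem SuperMetric.map_expansion {p : ZMod 2} (g : SuperMetric H F E p)
    (hW : W ≤ coordNhd H F E x₀) {i : ZMod 2} {X : tangentSheaf H F E W} (hX : HasParity X i)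
    (Y : tangentSheaf H F E W) :
    g.toFun W X Y = koszul p i • ∑ j,
        X.1 (iicTop W) (evenCoord hW ((Module.finBasis ℝ H).coord j)) *
          g.toFun W (resT hW (evenCoordDer x₀ (Module.finBasis ℝ H j))) Y +
      koszul p (i + 1) • ∑ j,
        X.1 (iicTop W) (oddCoord hW ((Module.finBasis ℝ F).coord j)) *
          g.toFun W (resT hW (oddCoordDer x₀ (Module.finBasis ℝ F j))) Y := by
  conv_lhs => rw [tangentSheaf_expansion hW hX]
  rw [map_add, map_sum, map_sum, LinearMap.add_apply, LinearMap.sum_apply, LinearMap.sum_apply,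
    Finset.smul_sum, Finset.smul_sum]
  congr 1
  · refine Finset.sum_congr rfl fun j _ => g.map_smul W i _ ?_ _ _
    have h := hX.2.1 (iicTop W) 0 _ (evenCoord_mem hW ((Module.finBasis ℝ H).coord j))
    rwa [add_zero] at h
  · exact Finset.sum_congr rfl fun j _ => g.map_smul W (i + 1) _
      (hX.2.1 (iicTop W) 1 _ (oddCoord_mem hW ((Module.finBasis ℝ F).coord j))) _ _

end Derivations

/-! ### The induced bilinear form in coordinates. -/

section Metric

variable {M : Type*} [TopologicalSpace M]
  {H : Type*} [NormedAddCommGroup H] [NormedSpace ℝ H] [FiniteDimensional ℝ H]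
  [ChartedSpace H M] [IsManifold 𝓘(ℝ, H) ∞ M]
  {F : Type*} [NormedAddCommGroup F] [NormedSpace ℝ F] [FiniteDimensional ℝ F]
  {E : M → Type*} [∀ x, AddCommGroup (E x)] [∀ x, Module ℝ (E x)] [∀ x, TopologicalSpace (E x)]
  [TopologicalSpace (TotalSpace F E)] [FiberBundle F E] [VectorBundle ℝ F E]
  [ContMDiffVectorBundle ∞ F E 𝓘(ℝ, H)] {x₀ : M} {p : ZMod 2}

variable {V W : Opens M}

/-- Restriction of superderivations as a linear map. -/
def resTₗ {U V : Opens M} (h : V ≤ U) : tangentSheaf H F E U →ₗ[ℝ] tangentSheaf H F E V where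
  toFun := resT h
  map_add' _ _ := rfl
  map_smul' _ _ := rfl

theorem koszul_zero_right (i : ZMod 2) : koszul i 0 = 1 := by simp [koszul]

theorem affineEval_zero (a : ExteriorAlgebra ℝ (Module.Dual ℝ F)) : affineEval 0 a = body a := by
  rw [affineEval_apply, map_zero, add_zero]

/-- Scalar coefficients factor out of the affine part, while a coefficient `η j` of degree one
leaves `η j f` times a body. Both sums are then linear functionals, `L₀` and `L₁`, evaluated at the
basis expansions of `v` and `a`. -/
theorem SuperMetric.affineEval_expansion (g : SuperMetric H F E p)
    (hW : W ≤ coordNhd H F E x₀) {X : tangentSheaf H F E W} (hX : HasParity X 0)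
    (Y : tangentSheaf H F E W) {y : H} (hy : y ∈ coordDom H x₀ W) (f : F) {v : H} {a : F}
    (η : Fin (Module.finrank ℝ F) → Module.Dual ℝ F)
    (hv : ∀ j, rep x₀ (X.1 (iicTop W) (evenCoord hW ((Module.finBasis ℝ H).coord j))) y =
      algebraMap ℝ _ ((Module.finBasis ℝ H).coord j v))
    (hη : ∀ j, rep x₀ (X.1 (iicTop W) (oddCoord hW ((Module.finBasis ℝ F).coord j))) y =
      ExteriorAlgebra.ι ℝ (η j))
    (ha : ∀ j, η j f = (Module.finBasis ℝ F).coord j a) :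
    affineEval f (rep x₀ (g.toFun W X Y) y) =
      affineEval f (rep x₀ (g.toFun W (resT hW (evenCoordDer x₀ v)) Y) y) +
      koszul p 1 * body (rep x₀ (g.toFun W (resT hW (oddCoordDer x₀ a)) Y) y) := by
  let L₀ : H →ₗ[ℝ] ℝ := affineEval f ∘ₗ repₗ x₀ W y ∘ₗ
    ((g.toFun W).flip Y) ∘ₗ resTₗ hW ∘ₗ evenCoordDer x₀
  let L₁ : F →ₗ[ℝ] ℝ := ExteriorAlgebra.algebraMapInv.toLinearMap ∘ₗ repₗ x₀ W y ∘ₗ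
    ((g.toFun W).flip Y) ∘ₗ resTₗ hW ∘ₗ oddCoordDer x₀
  change _ = L₀ v + koszul p 1 * L₁ a
  rw [g.map_expansion hW hX Y, koszul_zero_right, one_smul, zero_add, rep_add, rep_smul, rep_sum,
    rep_sum, map_add, _root_.map_smul, map_sum, map_sum, smul_eq_mul]
  congr 1
  · conv_rhs => rw [← (Module.finBasis ℝ H).sum_repr v, map_sum]
    refine Finset.sum_congr rfl fun j _ => ?_
    rw [rep_mul _ _ hy, hv, affineEval_algebraMap_mul, _root_.map_smul, smul_eq_mul]
    rfl
  · congr 1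
    conv_rhs => rw [← (Module.finBasis ℝ F).sum_repr a, map_sum]
    refine Finset.sum_congr rfl fun j _ => ?_
    rw [rep_mul _ _ hy, hη, affineEval_ι_mul, _root_.map_smul, smul_eq_mul, ha]
    rfl

theorem SuperMetric.supersymm_even (g : SuperMetric H F E p) {i : ZMod 2}
    {X Y : tangentSheaf H F E W} (hX : HasParity X i) (hY : HasParity Y 0) :
    g.toFun W X Y = g.toFun W Y X := by
  rw [g.supersymm W i 0 X Y hX hY, koszul_zero_right, one_smul]

theorem evenCoordDer_hasParity (v : H) : HasParity (evenCoordDer (F := F) (E := E) x₀ v) 0 :=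
  evenCoordFam_mem v

theorem oddCoordDer_hasParity (a : F) : HasParity (oddCoordDer (H := H) (E := E) x₀ a) 1 :=
  oddCoordFam_mem a

/-- The bilinear form on the local model of the tangent spaces of `E` given by the metric `g`. -/
def SuperMetric.coordBilin (g : SuperMetric H F E p) (x₀ : M) (y : H) (f : F) :
    (H × F) →ₗ[ℝ] (H × F) →ₗ[ℝ] ℝ :=
  LinearMap.mk₂ ℝ (fun u w =>
    -- There is no odd-odd term: such components are multiplied by two coefficients of degree one,
    -- and `pr` removes the product.
    affineEval f (rep x₀ (g.toFun _ (evenCoordDer x₀ u.1) (evenCoordDer x₀ w.1)) y) + koszul p 1 *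
      (body (rep x₀ (g.toFun _ (evenCoordDer x₀ u.1) (oddCoordDer x₀ w.2)) y) +
        body (rep x₀ (g.toFun _ (evenCoordDer x₀ w.1) (oddCoordDer x₀ u.2)) y)))
    (fun u u' w => by
      simp only [body, Prod.fst_add, Prod.snd_add, map_add, LinearMap.add_apply, rep_add]; ring)
    (fun c u w => by
      simp only [body, Prod.smul_fst, Prod.smul_snd, _root_.map_smul, LinearMap.smul_apply,
        rep_smul,
        smul_eq_mul]; ring)
    (fun u w w' => by
      simp only [body, Prod.fst_add, Prod.snd_add, map_add, LinearMap.add_apply, rep_add]; ring)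
    (fun c u w => by
      simp only [body, Prod.smul_fst, Prod.smul_snd, _root_.map_smul, LinearMap.smul_apply,
        rep_smul,
        smul_eq_mul]; ring)

theorem SuperMetric.coordBilin_apply (g : SuperMetric H F E p) (x₀ : M) (y : H) (f : F)
    (u w : H × F) : g.coordBilin x₀ y f u w =
    affineEval f (rep x₀ (g.toFun _ (evenCoordDer x₀ u.1) (evenCoordDer x₀ w.1)) y) + koszul p 1 *
      (body (rep x₀ (g.toFun _ (evenCoordDer x₀ u.1) (oddCoordDer x₀ w.2)) y) +
        body (rep x₀ (g.toFun _ (evenCoordDer x₀ w.1) (oddCoordDer x₀ u.2)) y)) := rfl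

theorem SuperMetric.coordBilin_symm (g : SuperMetric H F E p) (x₀ : M) (y : H) (f : F)
    (u w : H × F) : g.coordBilin x₀ y f u w = g.coordBilin x₀ y f w u := by
  rw [g.coordBilin_apply, g.coordBilin_apply,
    g.supersymm_even (evenCoordDer_hasParity u.1) (evenCoordDer_hasParity w.1), add_comm (body _)]

/-- The continuous version of `coordBilin`. -/
def SuperMetric.coordForm (g : SuperMetric H F E p) (x₀ : M) (q : H × F) :
    (H × F) →L[ℝ] (H × F) →L[ℝ] ℝ :=
  LinearMap.toContinuousLinearMap
    (LinearMap.toContinuousLinearMap.toLinearMap ∘ₗ g.coordBilin x₀ q.1 q.2)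

theorem SuperMetric.coordForm_apply (g : SuperMetric H F E p) (x₀ : M) (q u w : H × F) :
    g.coordForm x₀ q u w = g.coordBilin x₀ q.1 q.2 u w := rfl

/-- A basis of `Λ F^*` separates the variables: each term is a smooth function of the base point
times an affine function on the fibre. -/
theorem contDiffAt_affineEval {S : H → ExteriorAlgebra ℝ (Module.Dual ℝ F)} {q : H × F}
    (hS : WSmoothAt S q.1) : ContDiffAt ℝ ∞ (fun r : H × F => affineEval r.2 (S r.1)) q := by
  have h : ∀ r : H × F, affineEval r.2 (S r.1) = ∑ i, (Module.finBasis ℝ _).coord i (S r.1) *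
      affineEval r.2 (Module.finBasis ℝ _ i) := fun r => apply_eq_sum _ _
  simp only [h, affineEval_apply]
  refine ContDiffAt.sum fun i _ => ContDiffAt.mul ?_ (contDiffAt_const.add ?_)
  · exact (hS ((Module.finBasis ℝ _).coord i)).comp q contDiffAt_fst
  · exact (LinearMap.toContinuousLinearMap _).contDiff.contDiffAt.comp q contDiffAt_snd

theorem SuperMetric.contDiffOn_coordForm (g : SuperMetric H F E p) (x₀ : M) :
    ContDiffOn ℝ ∞ (g.coordForm x₀) (coordDom H x₀ (coordNhd H F E x₀) ×ˢ Set.univ) := by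
  refine contDiffOn_clm_apply.2 fun u => contDiffOn_clm_apply.2 fun w => fun q hq => ?_
  have hs : ∀ s : SuperFun H F E (coordNhd H F E x₀), WSmoothAt (rep x₀ s) q.1 := fun s =>
    wsmoothAt_rep le_rfl s hq.1
  have hb : ∀ s : SuperFun H F E (coordNhd H F E x₀),
      ContDiffAt ℝ ∞ (fun r : H × F => body (rep x₀ s r.1)) q := fun s =>
    (hs s ExteriorAlgebra.algebraMapInv.toLinearMap).comp q contDiffAt_fst
  simp only [g.coordForm_apply, g.coordBilin_apply]
  exact ((contDiffAt_affineEval (hs _)).add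
    (contDiffAt_const.mul ((hb _).add (hb _)))).contDiffWithinAt

/-- The induced form computes `pr ∘ g` on even superderivations which preserve `ℱ`. -/
theorem SuperMetric.coordBilin_eq (g : SuperMetric H F E p)
    (hW : W ≤ coordNhd H F E x₀) {X Y : tangentSheaf H F E W} (hX : HasParity X 0)
    (hY : HasParity Y 0) {y : H} (hy : y ∈ coordDom H x₀ W) (f : F) {u w : H × F}
    (η ζ : Fin (Module.finrank ℝ F) → Module.Dual ℝ F)
    (hu : ∀ j, rep x₀ (X.1 (iicTop W) (evenCoord hW ((Module.finBasis ℝ H).coord j))) y =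
      algebraMap ℝ _ ((Module.finBasis ℝ H).coord j u.1))
    (hη : ∀ j, rep x₀ (X.1 (iicTop W) (oddCoord hW ((Module.finBasis ℝ F).coord j))) y =
      ExteriorAlgebra.ι ℝ (η j))
    (hηf : ∀ j, η j f = (Module.finBasis ℝ F).coord j u.2)
    (hw : ∀ j, rep x₀ (Y.1 (iicTop W) (evenCoord hW ((Module.finBasis ℝ H).coord j))) y =
      algebraMap ℝ _ ((Module.finBasis ℝ H).coord j w.1))
    (hζ : ∀ j, rep x₀ (Y.1 (iicTop W) (oddCoord hW ((Module.finBasis ℝ F).coord j))) y =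
      ExteriorAlgebra.ι ℝ (ζ j))
    (hζf : ∀ j, ζ j f = (Module.finBasis ℝ F).coord j w.2) :
    affineEval f (rep x₀ (g.toFun W X Y) y) = g.coordBilin x₀ y f u w := by
  have hb : ∀ Z : tangentSheaf H F E W, body (rep x₀ (g.toFun W Y Z) y) =
      body (rep x₀ (g.toFun W (resT hW (evenCoordDer x₀ w.1)) Z) y) := fun Z => by
    -- At the fibre point 0 every `ζ j` vanishes, so `a = 0` is admissible and the affine evaluation
    -- reduces to the body.
    have h := g.affineEval_expansion hW hY Z hy 0 (a := 0) ζ hw hζ (by simp)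
    rw [affineEval_zero, affineEval_zero] at h
    rw [h]
    have h0 : resT hW (oddCoordDer (E := E) (H := H) x₀ (0 : F)) = 0 := by
      rw [map_zero]; rfl
    rw [h0, map_zero, LinearMap.zero_apply, rep_zero]
    simp [body]
  have hr : ∀ Z Z' : tangentSheaf H F E (coordNhd H F E x₀),
      rep x₀ (g.toFun W (resT hW Z) (resT hW Z')) y = rep x₀ (g.toFun _ Z Z') y := fun Z Z' => by
    rw [← g.map_res hW, rep_res hW _ hy]
  -- The expansion acts on the first argument only. Supersymmetry with the even `Y` costs no sign
  -- and brings `Y` there for a second expansion.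
  rw [g.affineEval_expansion hW hX Y hy f η hu hη hηf,
    g.supersymm_even (evenCoordDer_parity hW u.1) hY,
    g.supersymm_even (oddCoordDer_parity hW u.2) hY,
    hb, g.affineEval_expansion hW hY _ hy f ζ hw hζ hζf, g.coordBilin_apply,
    g.supersymm_even (oddCoordDer_parity hW w.2) (evenCoordDer_parity hW u.1),
    g.supersymm_even (evenCoordDer_parity hW w.1) (evenCoordDer_parity hW u.1), hr, hr, hr]
  ring

end Metric

/-! ### Differentials of superfunctions and the blocks of the coordinate form. -/

section Nondegeneracy

variable {M : Type*} [TopologicalSpace M]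
  {H : Type*} [NormedAddCommGroup H] [NormedSpace ℝ H] [FiniteDimensional ℝ H]
  [ChartedSpace H M] [IsManifold 𝓘(ℝ, H) ∞ M]
  {F : Type*} [NormedAddCommGroup F] [NormedSpace ℝ F] [FiniteDimensional ℝ F]
  {E : M → Type*} [∀ x, AddCommGroup (E x)] [∀ x, Module ℝ (E x)] [∀ x, TopologicalSpace (E x)]
  [TopologicalSpace (TotalSpace F E)] [FiberBundle F E] [VectorBundle ℝ F E]
  [ContMDiffVectorBundle ∞ F E 𝓘(ℝ, H)] {x₀ : M} {U : Opens M}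

/-- The automorphism of the exterior algebra which acts on elements of parity `j` as the Koszul sign
`koszul k j`. -/
def twist (k : ZMod 2) (V : Type*) [AddCommGroup V] [Module ℝ V] :
    ExteriorAlgebra ℝ V →ₐ[ℝ] ExteriorAlgebra ℝ V :=
  if k = 0 then AlgHom.id ℝ _ else parityInv V

theorem twist_apply {V : Type*} [AddCommGroup V] [Module ℝ V] (k : ZMod 2) {j : ZMod 2}
    {a : ExteriorAlgebra ℝ V} (ha : a ∈ extParity V j) : twist k V a = koszul k j • a := by
  rcases zmod2_cases k with rfl | rfl
  · simp [twist, koszul]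
  · rw [twist, if_neg (by decide), mem_extParity_iff.1 ha]
    simp [koszul, and_comm]

theorem twist_map {V W : Type*} [AddCommGroup V] [Module ℝ V] [AddCommGroup W] [Module ℝ W]
    (k : ZMod 2) (φ : V →ₗ[ℝ] W) (a : ExteriorAlgebra ℝ V) :
    twist k W (ExteriorAlgebra.map φ a) = ExteriorAlgebra.map φ (twist k V a) := by
  unfold twist
  split_ifs
  · rfl
  · exact parityInv_map φ a

/-- The action of `twist` on superfunctions. -/
def twistFun (k : ZMod 2) : SuperFun H F E U →ₗ[ℝ] SuperFun H F E U where
  toFun s := ⟨fun x => twist k _ (s.1 x), fun x₁ ℓ => by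
    have := s.2 x₁ (ℓ ∘ₗ (twist k (Module.Dual ℝ F)).toLinearMap)
    simpa only [localRep, ← twist_map, LinearMap.comp_apply, AlgHom.toLinearMap_apply] using this⟩
  map_add' s t := Subtype.ext (funext fun x => map_add (twist k _) (s.1 x) (t.1 x))
  map_smul' c s := Subtype.ext (funext fun x => map_smul (twist k _) c (s.1 x))

theorem twistFun_mul (k : ZMod 2) {j : ZMod 2} {a : SuperFun H F E U}
    (ha : a ∈ superFunParity H F E U j) (b : SuperFun H F E U) :
    twistFun k (a * b) = koszul k j • (a * twistFun k b) := by
  refine Subtype.ext (funext fun x => ?_)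
  have h : twist k _ (a.1 x * b.1 x) = koszul k j • (a.1 x * twist k _ (b.1 x)) := by
    rw [map_mul, twist_apply k (ha x), smul_mul_assoc]
  exact h

theorem twistFun_of_mem (k : ZMod 2) {j : ZMod 2} {a : SuperFun H F E U}
    (ha : a ∈ superFunParity H F E U j) : twistFun k a = koszul k j • a :=
  Subtype.ext (funext fun x => twist_apply k (ha x))

theorem tangentSheaf_res {X : EndFamily H F E U} (hX : X ∈ tangentSheaf H F E U) {V W : Set.Iic U}
    (h : W.1 ≤ V.1) (s : SuperFun H F E V.1) : res h (X V s) = X W (res h s) := by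
  obtain ⟨Y, hY, Z, hZ, rfl⟩ := Submodule.mem_sup.1 hX
  rw [EndFamily.add_apply, EndFamily.add_apply, map_add, hY.1 V W h, hZ.1 V W h]

/-- The differential of a homogeneous superfunction. -/
def differential {k : ZMod 2} {s : SuperFun H F E U} (hs : s ∈ superFunParity H F E U k) :
    OneForm H F E U k where
  toFun V :=
    -- The map `Y ↦ Y s` is linear over superfunctions without sign; the twist inserts the sign that
    -- a one-form of parity `k` must have.
    { toFun := fun Y => twistFun k (Y.1 (iicTop V.1) (res (iic_le V) s))
      map_add' := fun Y Z => map_add (twistFun k) _ _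
      map_smul' := fun c Y => map_smul (twistFun k) c _ }
  map_res V W h Y := by
    change twistFun k (res h (Y.1 (iicTop V.1) (res (iic_le V) s))) = _
    exact congrArg (twistFun k)
      (tangentSheaf_res Y.2 (V := iicTop V.1) (W := ⟨W.1, h⟩) h (res (iic_le V) s))
  parity V j Y hY := by
    have h := hY.2.1 (iicTop V.1) k _ (res_mem (iic_le V) hs)
    change twistFun k _ ∈ _
    rw [twistFun_of_mem k h, add_comm k j]
    exact Submodule.smul_mem _ _ h
  map_smul V j f hf Y := by
    change twistFun k (f * Y.1 (iicTop V.1) (res (iic_le V) s)) = _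
    rw [twistFun_mul k hf]
    rfl

theorem body_rep_of_odd (hU : U ≤ coordNhd H F E x₀) {s : SuperFun H F E U}
    (hs : s ∈ superFunParity H F E U 1) {y : H} (hy : y ∈ coordDom H x₀ U) :
    body (rep x₀ s y) = 0 := body_of_odd ((mem_superFunParity_iff hU).1 hs y hy)

theorem body_rep_mul (s t : SuperFun H F E U) {y : H} (hy : y ∈ coordDom H x₀ U) :
    body (rep x₀ (s * t) y) = body (rep x₀ s y) * body (rep x₀ t y) := by
  rw [rep_mul _ _ hy]; exact map_mul _ _ _

/-- Surjectivity of `X ↦ g(X, ·)` applied to the differential of `s`: the gradient of `s`. -/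
theorem SuperMetric.exists_dual {p : ZMod 2} (g : SuperMetric H F E p) {i : ZMod 2}
    {s : SuperFun H F E U} (hs : s ∈ superFunParity H F E U (p + i)) :
    ∃ X : tangentSheaf H F E U, HasParity X i ∧ ∀ Y : tangentSheaf H F E U,
      g.toFun U X Y = twistFun (p + i) (Y.1 (iicTop U) s) := by
  obtain ⟨X, ⟨hX, h⟩, -⟩ := g.nondegenerate U i (differential hs)
  exact ⟨X, hX, fun Y => h (iicTop U) Y⟩

/-- The body is multiplicative, so at a point the expansion of `g` becomes an identity between real
matrices. -/
theorem SuperMetric.body_expansion {p : ZMod 2} (g : SuperMetric H F E p)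
    {i : ZMod 2} {X : tangentSheaf H F E (coordNhd H F E x₀)} (hX : HasParity X i)
    (Y : tangentSheaf H F E (coordNhd H F E x₀)) {y : H}
    (hy : y ∈ coordDom H x₀ (coordNhd H F E x₀)) :
    body (rep x₀ (g.toFun _ X Y) y) = koszul p i * ∑ j,
        body (rep x₀ (X.1 (iicTop _) (evenCoord le_rfl ((Module.finBasis ℝ H).coord j))) y) *
          body (rep x₀ (g.toFun _ (evenCoordDer x₀ (Module.finBasis ℝ H j)) Y) y) +
      koszul p (i + 1) * ∑ j,
        body (rep x₀ (X.1 (iicTop _) (oddCoord le_rfl ((Module.finBasis ℝ F).coord j))) y) *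
          body (rep x₀ (g.toFun _ (oddCoordDer x₀ (Module.finBasis ℝ F j)) Y) y) := by
  rw [g.map_expansion le_rfl hX Y, rep_add, rep_smul, rep_smul, rep_sum, rep_sum]
  simp only [body, map_add, _root_.map_smul, map_sum, smul_eq_mul]
  congr 2
  · exact Finset.sum_congr rfl fun j _ => body_rep_mul _ _ hy
  · exact Finset.sum_congr rfl fun j _ => body_rep_mul _ _ hy

/-- The mixed components of an odd metric are non-degenerate in the even direction. -/
theorem SuperMetric.even_eq_zero (g : SuperMetric H F E 1) {y : H}
    (hy : y ∈ coordDom H x₀ (coordNhd H F E x₀)) {v : H}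
    (h : ∀ a, body (rep x₀ (g.toFun _ (evenCoordDer x₀ v) (oddCoordDer x₀ a)) y) = 0) : v = 0 := by
  refine (Module.finBasis ℝ H).ext_elem fun k => ?_
  rw [map_zero, Finsupp.zero_apply]
  -- The gradient of the `k`-th even coordinate is odd, as `1 + 1 = 0`, and the body of `g(X, ∂_v)`
  -- is the `k`-th coordinate of `v`. In the expansion of `X` the coefficients of the even
  -- derivatives are odd and have no body; the remaining terms vanish by `h`.
  obtain ⟨X, hX, hXY⟩ := g.exists_dual (i := 1)
    (evenCoord_mem (F := F) (E := E) (le_refl (coordNhd H F E x₀))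
    ((Module.finBasis ℝ H).coord k))
  have h1 := hXY (evenCoordDer x₀ v)
  have h2 : (evenCoordDer (F := F) (E := E) x₀ v).1 (iicTop _) (evenCoord le_rfl
      ((Module.finBasis ℝ H).coord k)) = _ := evenCoordFam_evenCoord (iicTop _) v _
  rw [h2, twistFun_of_mem _ (algebraMap_mem_superFunParity _), koszul_zero_right, one_smul] at h1
  have h3 := g.body_expansion hX (evenCoordDer x₀ v) hy
  rw [h1, rep_algebraMap _ hy, body_algebraMap] at h3
  refine h3.trans ?_
  rw [Finset.sum_eq_zero, Finset.sum_eq_zero, mul_zero, mul_zero, add_zero]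
  · intro j _
    rw [g.supersymm_even (oddCoordDer_hasParity _) (evenCoordDer_hasParity v), h, mul_zero]
  · intro j _
    rw [body_rep_of_odd le_rfl (hX.2.1 (iicTop _) 0 _ (evenCoord_mem le_rfl _)) hy, zero_mul]

/-- The mixed components of an odd metric are non-degenerate in the odd direction. -/
theorem SuperMetric.odd_eq_zero (g : SuperMetric H F E 1) {y : H}
    (hy : y ∈ coordDom H x₀ (coordNhd H F E x₀)) {a : F}
    (h : ∀ v, body (rep x₀ (g.toFun _ (evenCoordDer x₀ v) (oddCoordDer x₀ a)) y) = 0) : a = 0 := by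
  refine (Module.finBasis ℝ F).ext_elem fun k => ?_
  rw [map_zero, Finsupp.zero_apply]
  -- The gradient of an odd coordinate is even, so now the coefficients of the odd derivatives have
  -- no body and `h` disposes of the others.
  obtain ⟨X, hX, hXY⟩ := g.exists_dual (i := 0)
    (oddCoord_mem (H := H) (E := E) (le_refl (coordNhd H F E x₀))
    ((Module.finBasis ℝ F).coord k))
  have h1 := hXY (oddCoordDer x₀ a)
  have h2 : (oddCoordDer (E := E) (H := H) x₀ a).1 (iicTop _) (oddCoord le_rfl
      ((Module.finBasis ℝ F).coord k)) = _ := oddCoordFam_oddCoord (iicTop _) a _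
  rw [h2, twistFun_of_mem _ (algebraMap_mem_superFunParity _), koszul_zero_right, one_smul] at h1
  have h3 := g.body_expansion hX (oddCoordDer x₀ a) hy
  rw [h1, rep_algebraMap _ hy, body_algebraMap] at h3
  refine h3.trans ?_
  rw [Finset.sum_eq_zero, Finset.sum_eq_zero, mul_zero, mul_zero, add_zero]
  · intro j _
    rw [body_rep_of_odd le_rfl (hX.2.1 (iicTop _) 1 _ (oddCoord_mem le_rfl _)) hy, zero_mul]
  · intro j _
    rw [h, mul_zero]

/-- As the vertical block is zero, pairing with vertical vectors sees only `u.1`; once `u.1 = 0`,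
pairing with horizontal vectors sees only `u.2`. -/
theorem SuperMetric.coordBilin_nondegenerate (g : SuperMetric H F E 1) {y : H}
    (hy : y ∈ coordDom H x₀ (coordNhd H F E x₀)) (f : F) {u : H × F}
    (h : ∀ w, g.coordBilin x₀ y f u w = 0) : u = 0 := by
  have hk : koszul 1 1 ≠ 0 := by norm_num [koszul]
  have h1 : u.1 = 0 := g.even_eq_zero hy fun a => by
    have := h (0, a)
    rw [g.coordBilin_apply] at this
    simpa [rep_zero, body, hk] using this
  have h2 : u.2 = 0 := g.odd_eq_zero hy fun v => by
    have := h (v, 0)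
    rw [g.coordBilin_apply, h1] at this
    simpa [rep_zero, body, hk] using this
  exact Prod.ext h1 h2

/-- The mixed components of an even metric are odd, hence without body. -/
theorem SuperMetric.coordBilin_vertical (g : SuperMetric H F E 0) {y : H}
    (hy : y ∈ coordDom H x₀ (coordNhd H F E x₀)) (f a : F) (w : H × F) :
    g.coordBilin x₀ y f (0, a) w = 0 := by
  rw [g.coordBilin_apply, body_rep_of_odd (s := g.toFun _ (evenCoordDer x₀ w.1) _) le_rfl
    (g.parity _ 0 1 _ _ (evenCoordDer_hasParity w.1) (oddCoordDer_hasParity a)) hy]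
  simp [rep_zero, body]

end Nondegeneracy

/-! ### Charts, tangent vectors and bilinear forms on the manifold `E`. -/

section TotalSpaceCoordinates

variable {M : Type*} [TopologicalSpace M]
  {H : Type*} [NormedAddCommGroup H] [NormedSpace ℝ H] [FiniteDimensional ℝ H]
  [ChartedSpace H M] [IsManifold 𝓘(ℝ, H) ∞ M]
  {F : Type*} [NormedAddCommGroup F] [NormedSpace ℝ F] [FiniteDimensional ℝ F]
  {E : M → Type*} [∀ x, AddCommGroup (E x)] [∀ x, Module ℝ (E x)] [∀ x, TopologicalSpace (E x)]
  [TopologicalSpace (TotalSpace F E)] [FiberBundle F E] [VectorBundle ℝ F E]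
  [ContMDiffVectorBundle ∞ F E 𝓘(ℝ, H)]

/-- The coordinates of a point of the manifold `E` in the chart at `e₀`. -/
def totCoord (e₀ e : TotalSpace F E) : H × F := extChartAt (𝓘(ℝ, H).prod 𝓘(ℝ, F)) e₀ e

/-- The trivialization at `e₀` of the tangent bundle of `E`. -/
abbrev tanTriv (e₀ : TotalSpace F E) := trivializationAt (H × F)
  (TangentSpace (𝓘(ℝ, H).prod 𝓘(ℝ, F)) : TotalSpace F E → Type _) e₀

/-- The coordinates of a tangent vector in the chart at `e₀`. -/
def tanCoord (e₀ e : TotalSpace F E) : TangentSpace (𝓘(ℝ, H).prod 𝓘(ℝ, F)) e →L[ℝ] H × F :=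
  (tanTriv e₀).continuousLinearMapAt ℝ e

/-- The tangent vector with given coordinates in the chart at `e₀`. -/
def tanSymm (e₀ e : TotalSpace F E) : H × F →L[ℝ] TangentSpace (𝓘(ℝ, H).prod 𝓘(ℝ, F)) e :=
  (tanTriv e₀).symmL ℝ e

theorem mem_chart_source_totalSpace {e₀ e : TotalSpace F E} :
    e ∈ (chartAt (ModelProd H F) e₀).source ↔ e.proj ∈ coordNhd H F E e₀.proj := by
  rw [FiberBundle.chartedSpace_chartAt]
  simp only [mfld_simps]
  constructor
  · rintro ⟨h1, h2⟩
    exact ⟨by rwa [Trivialization.coe_fst _ h1] at h2, (Trivialization.mem_source _).1 h1⟩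
  · rintro ⟨h1, h2⟩
    exact ⟨(Trivialization.mem_source _).2 h2, by rwa [Trivialization.coe_fst' _ h2]⟩

theorem mem_tanTriv_baseSet {e₀ e : TotalSpace F E} (h : e.proj ∈ coordNhd H F E e₀.proj) :
    e ∈ (tanTriv (H := H) e₀).baseSet :=
  mem_chart_source_totalSpace.2 h

theorem totCoord_eq {e₀ e : TotalSpace F E} (h : e.proj ∈ coordNhd H F E e₀.proj) :
    totCoord (H := H) e₀ e = (chartAt H e₀.proj e.proj, (trivializationAt F E e₀.proj e).2) := by
  have h1 : (trivializationAt F E e₀.proj e).1 = e.proj := Trivialization.coe_fst' _ h.2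
  rw [totCoord, FiberBundle.extChartAt]
  simp only [mfld_simps]
  rw [h1]

theorem tanCoord_tanSymm {e₀ e : TotalSpace F E} (h : e.proj ∈ coordNhd H F E e₀.proj)
    (u : H × F) : tanCoord e₀ e (tanSymm e₀ e u) = u :=
  (tanTriv (H := H) e₀).continuousLinearMapAt_symmL (R := ℝ) (mem_tanTriv_baseSet h) u

theorem tanSymm_tanCoord {e₀ e : TotalSpace F E} (h : e.proj ∈ coordNhd H F E e₀.proj)
    (v : TangentSpace (𝓘(ℝ, H).prod 𝓘(ℝ, F)) e) : tanSymm e₀ e (tanCoord e₀ e v) = v :=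
  (tanTriv (H := H) e₀).symmL_continuousLinearMapAt (R := ℝ) (mem_tanTriv_baseSet h) v

theorem eventually_mem_coordNhd {e : TotalSpace F E} {W : Opens M} (h : e.proj ∈ W) :
    ∀ᶠ z in nhds e, z.proj ∈ W :=
  (FiberBundle.continuous_proj F E).continuousAt.preimage_mem_nhds (W.2.mem_nhds h)

/-- The trivialization of the tangent bundle at `e₀` is the derivative of the chart at `e₀`, so this
is the chain rule. -/
theorem mfderiv_eq_fderiv_coord {e₀ e : TotalSpace F E} (h : e.proj ∈ coordNhd H F E e₀.proj)
    {f : TotalSpace F E → ℝ} {u : H × F → ℝ} (hf : f =ᶠ[nhds e] fun z => u (totCoord e₀ z))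
    (hu : DifferentiableAt ℝ u (totCoord e₀ e)) (v : TangentSpace (𝓘(ℝ, H).prod 𝓘(ℝ, F)) e) :
    mfderiv (𝓘(ℝ, H).prod 𝓘(ℝ, F)) 𝓘(ℝ, ℝ) f e v =
      fderiv ℝ u (totCoord e₀ e) (tanCoord e₀ e v) := by
  have hs := mem_chart_source_totalSpace.2 h
  have h1 : MDifferentiableAt (𝓘(ℝ, H).prod 𝓘(ℝ, F)) 𝓘(ℝ, H × F)
      (extChartAt (𝓘(ℝ, H).prod 𝓘(ℝ, F)) e₀) e := mdifferentiableAt_extChartAt hs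
  have h2 : MDifferentiableAt 𝓘(ℝ, H × F) 𝓘(ℝ, ℝ) u (extChartAt (𝓘(ℝ, H).prod 𝓘(ℝ, F)) e₀ e) :=
    hu.mdifferentiableAt
  have h3 := (hf.mfderiv_eq (I := 𝓘(ℝ, H).prod 𝓘(ℝ, F)) (I' := 𝓘(ℝ, ℝ))).trans
    (mfderiv_comp e h2 h1)
  have h4 := TangentBundle.continuousLinearMapAt_trivializationAt (I := 𝓘(ℝ, H).prod 𝓘(ℝ, F)) hs
  rw [tanCoord, h4]
  refine (DFunLike.congr_fun h3 v).trans ?_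
  rw [mfderiv_eq_fderiv]
  rfl

theorem contMDiffAt_totCoord {e₀ e : TotalSpace F E} (h : e.proj ∈ coordNhd H F E e₀.proj) :
    ContMDiffAt (𝓘(ℝ, H).prod 𝓘(ℝ, F)) 𝓘(ℝ, H × F) ∞ (totCoord (H := H) e₀) e :=
  contMDiffAt_extChartAt' (mem_chart_source_totalSpace.2 h)

/-- A bilinear form on the tangent space at `e` with given matrix in the chart at `e₀`. -/
def pullForm (e₀ e : TotalSpace F E) (B : (H × F) →L[ℝ] (H × F) →L[ℝ] ℝ) :
    TangentSpace (𝓘(ℝ, H).prod 𝓘(ℝ, F)) e →L[ℝ]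
      TangentSpace (𝓘(ℝ, H).prod 𝓘(ℝ, F)) e →L[ℝ] ℝ :=
  -- The tangent space is `H × F` by definition; the ascription makes the composition one between
  -- normed spaces.
  letI L : H × F →L[ℝ] H × F := tanCoord e₀ e
  B.bilinearComp L L

theorem pullForm_apply (e₀ e : TotalSpace F E) (B : (H × F) →L[ℝ] (H × F) →L[ℝ] ℝ)
    (v w : TangentSpace (𝓘(ℝ, H).prod 𝓘(ℝ, F)) e) :
    pullForm e₀ e B v w = B (tanCoord e₀ e v) (tanCoord e₀ e w) := rfl

/-- The trivialization at `e₀` of the bundle of bilinear forms on the tangent spaces of `E`. -/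
abbrev formTriv (e₀ : TotalSpace F E) := trivializationAt ((H × F) →L[ℝ] (H × F) →L[ℝ] ℝ)
  (fun e : TotalSpace F E => TangentSpace (𝓘(ℝ, H).prod 𝓘(ℝ, F)) e →L[ℝ]
    TangentSpace (𝓘(ℝ, H).prod 𝓘(ℝ, F)) e →L[ℝ] ℝ) e₀

theorem mem_formTriv_baseSet {e₀ e : TotalSpace F E} (h : e.proj ∈ coordNhd H F E e₀.proj) :
    e ∈ (formTriv (H := H) e₀).baseSet := by
  refine ⟨mem_tanTriv_baseSet h, mem_tanTriv_baseSet h, ?_⟩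
  exact Set.mem_univ _

theorem formTriv_apply {e₀ e : TotalSpace F E} (h : e.proj ∈ coordNhd H F E e₀.proj)
    (B : TangentSpace (𝓘(ℝ, H).prod 𝓘(ℝ, F)) e →L[ℝ]
      TangentSpace (𝓘(ℝ, H).prod 𝓘(ℝ, F)) e →L[ℝ] ℝ) (u w : H × F) :
    (formTriv (H := H) e₀ ⟨e, B⟩).2 u w = B (tanSymm e₀ e u) (tanSymm e₀ e w) := by
  rw [formTriv, hom_trivializationAt_apply]
  simp only
  rw [inCoordinates_apply_eq₂ (mem_tanTriv_baseSet h) (mem_tanTriv_baseSet h) (Set.mem_univ _),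
    tanSymm, (tanTriv (H := H) e₀).symmL_apply (R := ℝ) (mem_tanTriv_baseSet h),
    (tanTriv (H := H) e₀).symmL_apply (R := ℝ) (mem_tanTriv_baseSet h)]
  simp only [Trivial.fiberBundle_trivializationAt', Trivial.linearMapAt_trivialization,
    LinearMap.id_coe, id_eq]

theorem formTriv_pullForm {e₀ e : TotalSpace F E} (h : e.proj ∈ coordNhd H F E e₀.proj)
    (B : (H × F) →L[ℝ] (H × F) →L[ℝ] ℝ) : (formTriv e₀ ⟨e, pullForm e₀ e B⟩).2 = B := by
  refine ContinuousLinearMap.ext fun u => ContinuousLinearMap.ext fun w => ?_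
  rw [formTriv_apply h, pullForm_apply, tanCoord_tanSymm h, tanCoord_tanSymm h]

instance tangentSpaceDual_continuousAdd (e : TotalSpace F E) :
    ContinuousAdd (TangentSpace (𝓘(ℝ, H).prod 𝓘(ℝ, F)) e →L[ℝ] ℝ) :=
  inferInstanceAs (ContinuousAdd ((H × F) →L[ℝ] ℝ))

/-- Smoothness at `e` of a field of bilinear forms on the tangent spaces of `E`. -/
abbrev FormSmoothAt (h : ∀ e : TotalSpace F E, TangentSpace (𝓘(ℝ, H).prod 𝓘(ℝ, F)) e →L[ℝ]
    TangentSpace (𝓘(ℝ, H).prod 𝓘(ℝ, F)) e →L[ℝ] ℝ) (e : TotalSpace F E) : Prop :=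
  ContMDiffAt (𝓘(ℝ, H).prod 𝓘(ℝ, F))
    ((𝓘(ℝ, H).prod 𝓘(ℝ, F)).prod 𝓘(ℝ, (H × F) →L[ℝ] (H × F) →L[ℝ] ℝ)) ∞
    (fun e => TotalSpace.mk' ((H × F) →L[ℝ] (H × F) →L[ℝ] ℝ)
      (E := fun e : TotalSpace F E => TangentSpace (𝓘(ℝ, H).prod 𝓘(ℝ, F)) e →L[ℝ]
        TangentSpace (𝓘(ℝ, H).prod 𝓘(ℝ, F)) e →L[ℝ] ℝ) e (h e)) e

theorem formSmoothAt_pullForm {e₀ e : TotalSpace F E} (h : e.proj ∈ coordNhd H F E e₀.proj)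
    {B : H × F → (H × F) →L[ℝ] (H × F) →L[ℝ] ℝ} (hB : ContDiffAt ℝ ∞ B (totCoord e₀ e)) :
    FormSmoothAt (fun e => pullForm e₀ e (B (totCoord e₀ e))) e := by
  refine ((formTriv (H := H) e₀).contMDiffAt_section_iff (mem_formTriv_baseSet h)).2 ?_
  refine (hB.contMDiffAt.comp e (contMDiffAt_totCoord h)).congr_of_eventuallyEq ?_
  filter_upwards [eventually_mem_coordNhd h] with z hz
  exact formTriv_pullForm hz _

/-- Two smooth fields of bilinear forms which agree on a set `A` agree at all points of its
closure. -/
theorem form_eq_of_mem_closure {h₁ h₂ : ∀ e : TotalSpace F E,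
    TangentSpace (𝓘(ℝ, H).prod 𝓘(ℝ, F)) e →L[ℝ] TangentSpace (𝓘(ℝ, H).prod 𝓘(ℝ, F)) e →L[ℝ] ℝ}
    {e : TotalSpace F E} (hs₁ : FormSmoothAt h₁ e) (hs₂ : FormSmoothAt h₂ e)
    {A : Set (TotalSpace F E)} (hA : e ∈ closure A) (heq : ∀ z ∈ A, h₁ z = h₂ z) :
    h₁ e = h₂ e := by
  have he := mem_formTriv_baseSet (H := H) (mem_coordNhd (H := H) (F := F) (E := E) e.proj)
  have c₁ := (((formTriv (H := H) e).contMDiffAt_section_iff he).1 hs₁).continuousAt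
  have c₂ := (((formTriv (H := H) e).contMDiffAt_section_iff he).1 hs₂).continuousAt
  have : (nhdsWithin e A).NeBot := mem_closure_iff_nhdsWithin_neBot.1 hA
  have hlim := tendsto_nhds_unique_of_eventuallyEq (c₁.tendsto.mono_left nhdsWithin_le_nhds)
    (c₂.tendsto.mono_left (nhdsWithin_le_nhds (s := A)))
    (Filter.eventually_of_mem self_mem_nhdsWithin fun z hz => by simp only [heq z hz])
  refine ContinuousLinearMap.ext fun v => ContinuousLinearMap.ext fun w => ?_
  have hc := mem_coordNhd (H := H) (F := F) (E := E) e.proj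
  have h3 := DFunLike.congr_fun (DFunLike.congr_fun hlim (tanCoord e e v)) (tanCoord e e w)
  rwa [formTriv_apply hc, formTriv_apply hc, tanSymm_tanCoord hc, tanSymm_tanCoord hc] at h3

end TotalSpaceCoordinates

/-! ### The vector fields `Ψ(X)` in coordinates. -/

section AffineFields

variable {M : Type*} [TopologicalSpace M]
  {H : Type*} [NormedAddCommGroup H] [NormedSpace ℝ H] [FiniteDimensional ℝ H]
  [ChartedSpace H M] [IsManifold 𝓘(ℝ, H) ∞ M]
  {F : Type*} [NormedAddCommGroup F] [NormedSpace ℝ F] [FiniteDimensional ℝ F]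
  {E : M → Type*} [∀ x, AddCommGroup (E x)] [∀ x, Module ℝ (E x)] [∀ x, TopologicalSpace (E x)]
  [TopologicalSpace (TotalSpace F E)] [FiberBundle F E] [VectorBundle ℝ F E]
  [ContMDiffVectorBundle ∞ F E 𝓘(ℝ, H)]

/-- The derivative is the sum of the two partial ones; in the fibre variable the function is affine,
with linear part `ιInv`. -/
theorem fderiv_affineEval {S : H → ExteriorAlgebra ℝ (Module.Dual ℝ F)} {q : H × F}
    (hS : WSmoothAt S q.1) (w : H × F) :
    fderiv ℝ (fun r : H × F => affineEval r.2 (S r.1)) q w =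
      affineEval q.2 (wderiv w.1 S q.1) + ExteriorAlgebra.ιInv (S q.1) w.2 := by
  have := extAlg_finite (F := F)
  have hd : HasFDerivAt (fun r : H × F => affineEval r.2 (S r.1))
      (fderiv ℝ (fun r : H × F => affineEval r.2 (S r.1)) q) q :=
    ((contDiffAt_affineEval hS).differentiableAt (by simp)).hasFDerivAt
  have h1 : HasFDerivAt (fun z : H => affineEval q.2 (S z)) _ q.1 :=
    HasFDerivAt.comp (f := fun z : H => (z, q.2)) q.1 hd (hasFDerivAt_prodMk_left q.1 q.2)
  have h2 : HasFDerivAt (fun f : F => affineEval f (S q.1)) _ q.2 :=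
    HasFDerivAt.comp (f := fun f : F => (q.1, f)) q.2 hd (hasFDerivAt_prodMk_right q.1 q.2)
  have h3 : HasFDerivAt (fun f : F => affineEval f (S q.1))
      (LinearMap.toContinuousLinearMap (ExteriorAlgebra.ιInv (S q.1))) q.2 :=
    (LinearMap.toContinuousLinearMap (ExteriorAlgebra.ιInv (S q.1))).hasFDerivAt.const_add _
  have h4 := DFunLike.congr_fun (h2.unique h3) w.2
  have h5 := DFunLike.congr_fun h1.fderiv w.1
  rw [← hS.apply_wderiv] at h5
  have h6 : w = (w.1, 0) + (0, w.2) := by simp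
  conv_lhs => rw [h6, map_add]
  exact (congrArg₂ (· + ·) h5 h4.symm).symm

theorem mfderiv_affineFun {e₀ e : TotalSpace F E} {V : Opens M}
    (hV : V ≤ coordNhd H F E e₀.proj) (s : SuperFun H F E V) (he : e.proj ∈ V)
    (v : TangentSpace (𝓘(ℝ, H).prod 𝓘(ℝ, F)) e) :
    mfderiv (𝓘(ℝ, H).prod 𝓘(ℝ, F)) 𝓘(ℝ, ℝ) (affineFun s) e v =
      affineEval (trivializationAt F E e₀.proj e).2
        (wderiv (tanCoord e₀ e v).1 (rep e₀.proj s) (chartAt H e₀.proj e.proj)) +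
      ExteriorAlgebra.ιInv (rep e₀.proj s (chartAt H e₀.proj e.proj)) (tanCoord e₀ e v).2 := by
  have hS := wsmoothAt_rep hV s (chart_mem_coordDom hV he)
  have hq := totCoord_eq (H := H) (hV he)
  have h1 : affineFun s =ᶠ[nhds e]
      fun z => (fun r : H × F => affineEval r.2 (rep e₀.proj s r.1)) (totCoord e₀ z) := by
    filter_upwards [eventually_mem_coordNhd he] with z hz
    rw [affineFun_eq hV s hz, totCoord_eq (hV hz)]
  rw [mfderiv_eq_fderiv_coord (hV he) h1
    (by rw [hq]; exact (contDiffAt_affineEval hS).differentiableAt (by simp)), hq]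
  exact fderiv_affineEval hS _

theorem wderiv_rep_evenCoord {x₀ : M} {V : Opens M} (hV : V ≤ coordNhd H F E x₀)
    (l : Module.Dual ℝ H) {y : H} (hy : y ∈ coordDom H x₀ V) (v : H) :
    wderiv v (rep x₀ (evenCoord hV l)) y = algebraMap ℝ _ (l v) := by
  rw [← rep_evenCoordFam v ⟨V, hV⟩ _ hy, evenCoordFam_evenCoord ⟨V, hV⟩, rep_algebraMap _ hy]

theorem wderiv_rep_oddCoord {x₀ : M} {V : Opens M} (hV : V ≤ coordNhd H F E x₀)
    (θ : Module.Dual ℝ F) {y : H} (hy : y ∈ coordDom H x₀ V) (v : H) :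
    wderiv v (rep x₀ (oddCoord hV θ)) y = 0 := by
  rw [← rep_evenCoordFam v ⟨V, hV⟩ _ hy, evenCoordFam_oddCoord ⟨V, hV⟩, rep_zero]

theorem IsPsi.affineEval_rep {e₀ e : TotalSpace F E} {W : Opens M}
    (hW : W ≤ coordNhd H F E e₀.proj) {X : tangentSheaf H F E W}
    {X' : ∀ e : TotalSpace F E, TangentSpace (𝓘(ℝ, H).prod 𝓘(ℝ, F)) e}
    (hX' : IsPsi X X') (he : e.proj ∈ W) {s : SuperFun H F E W} (hs : IsAffine s) :
    affineEval (trivializationAt F E e₀.proj e).2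
        (wderiv (tanCoord e₀ e (X' e)).1 (rep e₀.proj s) (chartAt H e₀.proj e.proj)) +
      ExteriorAlgebra.ιInv (rep e₀.proj s (chartAt H e₀.proj e.proj)) (tanCoord e₀ e (X' e)).2 =
    affineEval (trivializationAt F E e₀.proj e).2
      (rep e₀.proj (X.1 (iicTop W) s) (chartAt H e₀.proj e.proj)) :=
  (mfderiv_affineFun hW s he (X' e)).symm.trans
    ((hX' (iicTop W) s hs e he).trans (affineFun_eq hW _ he))

/-- An even and affine value is a scalar, and testing `Ψ(X)` on this coordinate identifies the
scalar. -/
theorem IsPsi.rep_evenCoord {e₀ e : TotalSpace F E} {W : Opens M}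
    (hW : W ≤ coordNhd H F E e₀.proj) {X : tangentSheaf H F E W}
    {X' : ∀ e : TotalSpace F E, TangentSpace (𝓘(ℝ, H).prod 𝓘(ℝ, F)) e}
    (hX : IsAffineEven X) (hX' : IsPsi X X') (he : e.proj ∈ W) (l : Module.Dual ℝ H) :
    rep e₀.proj (X.1 (iicTop W) (evenCoord hW l)) (chartAt H e₀.proj e.proj) =
      algebraMap ℝ _ (l (tanCoord e₀ e (X' e)).1) := by
  have hy := chart_mem_coordDom hW he
  have h := hX'.affineEval_rep hW he (evenCoord_isAffine hW l)
  rw [wderiv_rep_evenCoord hW l hy,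
    SuperGeom.rep_evenCoord hW l hy, affineEval_algebraMap, ιInv_algebraMap, LinearMap.zero_apply,
    add_zero] at h
  obtain ⟨c, θ, hc⟩ := (isAffine_iff hW).1 (hX.2 (iicTop W) _ (evenCoord_isAffine hW l)) _ hy
  have hp := (mem_superFunParity_iff hW).1
    (hX.1.2.1 (iicTop W) 0 _ (evenCoord_mem hW l)) _ hy
  have hθ := ιInv_of_even hp
  rw [hc, map_add, ιInv_algebraMap, ιInv_ι, zero_add] at hθ
  rw [hθ, map_zero, add_zero] at hc
  rw [hc, affineEval_algebraMap] at h
  rw [hc, h]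

/-- An odd and affine value is a covector `η`. The tangent vector at `e` fixes only the value of `η`
at the fibre coordinate, which is all that `coordBilin_eq` asks for. -/
theorem IsPsi.rep_oddCoord {e₀ e : TotalSpace F E} {W : Opens M}
    (hW : W ≤ coordNhd H F E e₀.proj) {X : tangentSheaf H F E W}
    {X' : ∀ e : TotalSpace F E, TangentSpace (𝓘(ℝ, H).prod 𝓘(ℝ, F)) e}
    (hX : IsAffineEven X) (hX' : IsPsi X X') (he : e.proj ∈ W) (θ : Module.Dual ℝ F) :
    ∃ η : Module.Dual ℝ F,
      rep e₀.proj (X.1 (iicTop W) (oddCoord hW θ)) (chartAt H e₀.proj e.proj) =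
        ExteriorAlgebra.ι ℝ η ∧
      η (trivializationAt F E e₀.proj e).2 = θ (tanCoord e₀ e (X' e)).2 := by
  have hy := chart_mem_coordDom hW he
  have h := hX'.affineEval_rep hW he (oddCoord_isAffine hW θ)
  rw [wderiv_rep_oddCoord hW θ hy,
    SuperGeom.rep_oddCoord hW θ hy, map_zero, ιInv_ι, zero_add] at h
  obtain ⟨c, η, hc⟩ := (isAffine_iff hW).1 (hX.2 (iicTop W) _ (oddCoord_isAffine hW θ)) _ hy
  have hp := (mem_superFunParity_iff hW).1
    (hX.1.2.1 (iicTop W) 1 _ (oddCoord_mem hW θ)) _ hy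
  have h0 := body_of_odd hp
  rw [hc, body, map_add] at h0
  have h0' : c = 0 := by
    have h1 := body_algebraMap (V := Module.Dual ℝ F) c
    have h2 := body_ι η
    rw [body] at h1 h2
    rwa [h1, h2, add_zero] at h0
  rw [h0', map_zero, zero_add] at hc
  refine ⟨η, hc, ?_⟩
  rw [hc, affineEval_ι] at h
  exact h.symm

/-- The linear projection of `Λ F^*` onto the components of degree `0` and `1`. -/
def affinePart (F : Type*) [NormedAddCommGroup F] [NormedSpace ℝ F] :
    ExteriorAlgebra ℝ (Module.Dual ℝ F) →ₗ[ℝ] ExteriorAlgebra ℝ (Module.Dual ℝ F) :=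
  Algebra.linearMap ℝ _ ∘ₗ ExteriorAlgebra.algebraMapInv.toLinearMap +
    ExteriorAlgebra.ι ℝ ∘ₗ ExteriorAlgebra.ιInv

theorem affinePart_apply (a : ExteriorAlgebra ℝ (Module.Dual ℝ F)) :
    affinePart F a = algebraMap ℝ _ (body a) + ExteriorAlgebra.ι ℝ (ExteriorAlgebra.ιInv a) := rfl

theorem affinePart_affine (c : ℝ) (θ : Module.Dual ℝ F) :
    affinePart F (algebraMap ℝ _ c + ExteriorAlgebra.ι ℝ θ) =
      algebraMap ℝ _ c + ExteriorAlgebra.ι ℝ θ := by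
  rw [map_add, affinePart_apply, affinePart_apply, body_algebraMap, body_ι, ιInv_algebraMap, ιInv_ι]
  simp

variable {x₀ : M} {W : Opens M}

/-- The even superderivation `∂_v + θ ∂_a` in local coordinates. -/
def affineDer (hW : W ≤ coordNhd H F E x₀) (v : H) (θ : Module.Dual ℝ F) (a : F) :
    tangentSheaf H F E W :=
  resT hW (evenCoordDer x₀ v) + smulT (oddCoord hW θ) (resT hW (oddCoordDer x₀ a))

theorem rep_affineDer (hW : W ≤ coordNhd H F E x₀) (v : H) (θ : Module.Dual ℝ F) (a : F)
    (V : Set.Iic W) (s : SuperFun H F E V.1) {y : H} (hy : y ∈ coordDom H x₀ V.1) :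
    rep x₀ ((affineDer hW v θ a).1 V s) y = wderiv v (rep x₀ s) y +
      ExteriorAlgebra.ι ℝ θ * contract (Module.Dual.eval ℝ F a) (rep x₀ s y) := by
  have hV := (iic_le V).trans hW
  change rep x₀ (evenCoordFam x₀ v ⟨V.1, hV⟩ s +
    res (iic_le V) (oddCoord hW θ) * oddCoordFam x₀ a ⟨V.1, hV⟩ s) y = _
  rw [rep_add, rep_evenCoordFam v ⟨V.1, hV⟩ s hy, rep_mul _ _ hy, rep_res _ _ hy,
    rep_oddCoord hW θ (coordDom_mono x₀ (iic_le V) hy), rep_oddCoordFam a ⟨V.1, hV⟩ s hy]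

/-- Differentiation commutes with the projection `affinePart`, hence keeps affine sections affine;
`θ ∂_a` sends a covector `η` to `η a • θ`. -/
theorem affineDer_isAffineEven (hW : W ≤ coordNhd H F E x₀) (v : H) (θ : Module.Dual ℝ F) (a : F) :
    IsAffineEven (affineDer hW v θ a) := by
  have := extAlg_finite (F := F)
  have hodd := smulFam_mem (oddCoord_mem hW θ) (oddCoordDer_parity (E := E) hW a)
  rw [show (1 : ZMod 2) + 1 = 0 by decide] at hodd
  refine ⟨Submodule.add_mem _ (evenCoordDer_parity (E := E) hW v) hodd, fun V s hs => ?_⟩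
  have hV := (iic_le V).trans hW
  rw [isAffine_iff hV] at hs ⊢
  intro y hy
  have hev : (fun z => affinePart F (rep x₀ s z)) =ᶠ[nhds y] rep x₀ s := by
    filter_upwards [(isOpen_coordDom (H := H) x₀ V.1).mem_nhds hy] with z hz
    obtain ⟨c, η, hc⟩ := hs z hz
    rw [hc, affinePart_affine]
  have h1 := wderiv_map (wsmoothAt_rep hV s hy) (affinePart F) v
  rw [wderiv_congr hev, affinePart_apply] at h1
  obtain ⟨c, η, hc⟩ := hs y hy
  refine ⟨body (wderiv v (rep x₀ s) y), ExteriorAlgebra.ιInv (wderiv v (rep x₀ s) y) + η a • θ, ?_⟩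
  rw [rep_affineDer hW v θ a V s hy, hc, map_add (contract _), contract_algebraMap, contract_ι,
    zero_add, ← Algebra.commutes, ← Algebra.smul_def, map_add, map_smul, ← add_assoc, ← h1]
  rfl

/-- Under `ψ` the operator `θ ∂_a` becomes the vertical field `f ↦ θ(f) a`, which is linear on
fibres and vanishes on the zero section. -/
theorem affineDer_isPsi {e₀ : TotalSpace F E} (hW : W ≤ coordNhd H F E e₀.proj) (v : H)
    (θ : Module.Dual ℝ F) (a : F) :
    IsPsi (affineDer hW v θ a)
      fun e => tanSymm e₀ e (v, θ (trivializationAt F E e₀.proj e).2 • a) := by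
  intro V s _ e he
  have hV := (iic_le V).trans hW
  have hy := chart_mem_coordDom hV he
  refine (mfderiv_affineFun hV s he _).trans (Eq.trans ?_ (affineFun_eq hV _ he).symm)
  rw [tanCoord_tanSymm (hV he), rep_affineDer hW v θ a V s hy, map_add, affineEval_ι_mul,
    body_contract, map_smul, smul_eq_mul]
  rfl

end AffineFields

/-! ### Existence, uniqueness and (non-)degeneracy of the induced form. -/

section InducedForm

variable {M : Type*} [TopologicalSpace M]
  {H : Type*} [NormedAddCommGroup H] [NormedSpace ℝ H] [FiniteDimensional ℝ H]
  [ChartedSpace H M] [IsManifold 𝓘(ℝ, H) ∞ M]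
  {F : Type*} [NormedAddCommGroup F] [NormedSpace ℝ F] [FiniteDimensional ℝ F]
  {E : M → Type*} [∀ x, AddCommGroup (E x)] [∀ x, Module ℝ (E x)] [∀ x, TopologicalSpace (E x)]
  [TopologicalSpace (TotalSpace F E)] [FiberBundle F E] [VectorBundle ℝ F E]
  [ContMDiffVectorBundle ∞ F E 𝓘(ℝ, H)] {p : ZMod 2}

/-- The bilinear forms `h` on the tangent spaces of `E` are induced by `g` over the open set `W`. -/
def InducedOn (g : SuperMetric H F E p) (W : Opens M)
    (h : ∀ e : TotalSpace F E, TangentSpace (𝓘(ℝ, H).prod 𝓘(ℝ, F)) e →L[ℝ]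
      TangentSpace (𝓘(ℝ, H).prod 𝓘(ℝ, F)) e →L[ℝ] ℝ) : Prop :=
  ∀ (X Y : tangentSheaf H F E W)
    (X' Y' : ∀ e : TotalSpace F E, TangentSpace (𝓘(ℝ, H).prod 𝓘(ℝ, F)) e),
    IsAffineEven X → IsAffineEven Y → IsPsi X X' → IsPsi Y Y' →
    ∀ e : TotalSpace F E, e.proj ∈ W → h e (X' e) (Y' e) = affineFun (g.toFun W X Y) e

theorem IsAffineEven.resT {U W : Opens M} (h : W ≤ U) {X : tangentSheaf H F E U}
    (hX : IsAffineEven X) : IsAffineEven (resT h X) :=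
  ⟨resFam_mem h hX.1, fun V s hs => hX.2 ⟨V.1, (iic_le V).trans h⟩ s hs⟩

theorem IsPsi.resT {U W : Opens M} (h : W ≤ U) {X : tangentSheaf H F E U}
    {X' : ∀ e : TotalSpace F E, TangentSpace (𝓘(ℝ, H).prod 𝓘(ℝ, F)) e}
    (hX : IsPsi X X') : IsPsi (resT h X) X' :=
  fun V s hs e he => hX ⟨V.1, (iic_le V).trans h⟩ s hs e he

/-- The form induced by `g`, in the coordinates at `e₀`. -/
def SuperMetric.localForm (g : SuperMetric H F E p) (e₀ e : TotalSpace F E) :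
    TangentSpace (𝓘(ℝ, H).prod 𝓘(ℝ, F)) e →L[ℝ]
      TangentSpace (𝓘(ℝ, H).prod 𝓘(ℝ, F)) e →L[ℝ] ℝ :=
  pullForm e₀ e (g.coordForm e₀.proj (totCoord e₀ e))

theorem SuperMetric.localForm_apply (g : SuperMetric H F E p) {e₀ e : TotalSpace F E}
    (h : e.proj ∈ coordNhd H F E e₀.proj) (v w : TangentSpace (𝓘(ℝ, H).prod 𝓘(ℝ, F)) e) :
    g.localForm e₀ e v w = g.coordBilin e₀.proj (chartAt H e₀.proj e.proj)
      (trivializationAt F E e₀.proj e).2 (tanCoord e₀ e v) (tanCoord e₀ e w) := by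
  rw [SuperMetric.localForm, pullForm_apply, g.coordForm_apply, totCoord_eq h]

theorem SuperMetric.formSmoothAt_localForm (g : SuperMetric H F E p) {e₀ e : TotalSpace F E}
    (h : e.proj ∈ coordNhd H F E e₀.proj) : FormSmoothAt (g.localForm e₀) e := by
  refine formSmoothAt_pullForm h ((g.contDiffOn_coordForm e₀.proj).contDiffAt ?_)
  refine ((isOpen_coordDom _ _).prod isOpen_univ).mem_nhds ?_
  rw [totCoord_eq h]
  exact ⟨chart_mem_coordDom le_rfl h, Set.mem_univ _⟩

theorem SuperMetric.inducedOn_localForm (g : SuperMetric H F E p) {e₀ : TotalSpace F E}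
    {W : Opens M} (hW : W ≤ coordNhd H F E e₀.proj) : InducedOn g W (g.localForm e₀) := by
  intro X Y X' Y' hX hY hX' hY' e he
  choose η hη hηf using fun θ => hX'.rep_oddCoord hW hX he θ
  choose ζ hζ hζf using fun θ => hY'.rep_oddCoord hW hY he θ
  rw [g.localForm_apply (hW he), affineFun_eq hW _ he]
  exact (g.coordBilin_eq hW hX.1 hY.1 (chart_mem_coordDom hW he) _
    (fun j => η ((Module.finBasis ℝ F).coord j)) (fun j => ζ ((Module.finBasis ℝ F).coord j))
    (fun j => hX'.rep_evenCoord hW hX he _) (fun j => hη _) (fun j => hηf _)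
    (fun j => hY'.rep_evenCoord hW hY he _) (fun j => hζ _) (fun j => hζf _)).symm

/-- Away from the zero section the values of the vector fields `Ψ(X)` span the tangent space. -/
theorem exists_isPsi_eq {e₀ e : TotalSpace F E} {W : Opens M}
    (hW : W ≤ coordNhd H F E e₀.proj) (he : e.proj ∈ W)
    (hf : (trivializationAt F E e₀.proj e).2 ≠ 0 ∨ Subsingleton F)
    (v : TangentSpace (𝓘(ℝ, H).prod 𝓘(ℝ, F)) e) :
    ∃ (X : tangentSheaf H F E W)
      (X' : ∀ e : TotalSpace F E, TangentSpace (𝓘(ℝ, H).prod 𝓘(ℝ, F)) e),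
      IsAffineEven X ∧ IsPsi X X' ∧ X' e = v := by
  -- The field `∂_v + θ ∂_a` has vertical part `θ(f) a`, so `θ(f) = 1` is wanted; this is possible
  -- for `f ≠ 0`, and there is nothing to do if `F` is trivial.
  obtain ⟨θ, hθ⟩ : ∃ θ : Module.Dual ℝ F,
      θ (trivializationAt F E e₀.proj e).2 • (tanCoord e₀ e v).2 = (tanCoord e₀ e v).2 := by
    rcases hf with hf | hf
    · obtain ⟨θ, hθ⟩ := SeparatingDual.exists_eq_one (R := ℝ) hf
      exact ⟨θ.toLinearMap, by rw [ContinuousLinearMap.coe_coe, hθ, one_smul]⟩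
    · exact ⟨0, Subsingleton.elim _ _⟩
  refine ⟨_, _, affineDer_isAffineEven hW (tanCoord e₀ e v).1 θ (tanCoord e₀ e v).2,
    affineDer_isPsi hW _ _ _, ?_⟩
  rw [hθ]
  exact tanSymm_tanCoord (hW he) v

/-- It suffices to approach `e` within its own fibre, where the non-zero vectors are dense unless
`F` is trivial. -/
theorem mem_closure_nonzero {e₀ e : TotalSpace F E} {W : Opens M}
    (hW : W ≤ coordNhd H F E e₀.proj) (he : e.proj ∈ W) :
    e ∈ closure {z : TotalSpace F E | z.proj ∈ W ∧
      ((trivializationAt F E e₀.proj z).2 ≠ 0 ∨ Subsingleton F)} := by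
  rcases subsingleton_or_nontrivial F with hF | hF
  · exact subset_closure ⟨he, Or.inr hF⟩
  set t := trivializationAt F E e₀.proj
  have hb : e.proj ∈ t.baseSet := (hW he).2
  have ht : ∀ f : F, (e.proj, f) ∈ t.target := fun f => t.mem_target.2 hb
  have hc : Continuous fun f : F => t.toOpenPartialHomeomorph.symm (e.proj, f) :=
    t.toOpenPartialHomeomorph.symm.continuousOn.comp_continuous (by fun_prop) ht
  have h0 : (t e).2 ∈ closure ({0}ᶜ : Set F) := (dense_compl_singleton (0 : F)) _
  have h1 := image_closure_subset_closure_image hc (Set.mem_image_of_mem _ h0)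
  have h2 : t.toOpenPartialHomeomorph.symm (e.proj, (t e).2) = e := by
    rw [← t.coe_fst' hb]
    exact t.toOpenPartialHomeomorph.left_inv (t.mem_source.2 hb)
  simp only [h2] at h1
  refine closure_mono ?_ h1
  rintro _ ⟨f, hf, rfl⟩
  refine ⟨?_, Or.inl ?_⟩
  · rw [t.proj_symm_apply (ht f)]
    exact he
  · rw [t.apply_symm_apply (ht f)]
    exact hf

/-- Where the fields `Ψ(X)` exhaust the tangent space, being induced prescribes the form; continuity
extends the equality to the zero section, where they need not do so. -/
theorem InducedOn.eq {g : SuperMetric H F E p} {e₀ e : TotalSpace F E} {W : Opens M}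
    (hW : W ≤ coordNhd H F E e₀.proj) (he : e.proj ∈ W)
    {h₁ h₂ : ∀ e : TotalSpace F E, TangentSpace (𝓘(ℝ, H).prod 𝓘(ℝ, F)) e →L[ℝ]
      TangentSpace (𝓘(ℝ, H).prod 𝓘(ℝ, F)) e →L[ℝ] ℝ}
    (hi₁ : InducedOn g W h₁) (hi₂ : InducedOn g W h₂)
    (hs₁ : FormSmoothAt h₁ e) (hs₂ : FormSmoothAt h₂ e) : h₁ e = h₂ e := by
  refine form_eq_of_mem_closure hs₁ hs₂ (mem_closure_nonzero hW he) fun z hz => ?_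
  refine ContinuousLinearMap.ext fun v => ContinuousLinearMap.ext fun w => ?_
  obtain ⟨X, X', hX, hX', hv⟩ := exists_isPsi_eq hW hz.1 hz.2 v
  obtain ⟨Y, Y', hY, hY', hw⟩ := exists_isPsi_eq hW hz.1 hz.2 w
  rw [← hv, ← hw, hi₁ X Y X' Y' hX hY hX' hY' z hz.1, hi₂ X Y X' Y' hX hY hX' hY' z hz.1]

/-- Both local forms are induced by `g` over the overlap of the two coordinate domains, so
uniqueness replaces a change-of-coordinates computation. -/
theorem SuperMetric.localForm_eq (g : SuperMetric H F E p) {e₀ e : TotalSpace F E}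
    (h : e.proj ∈ coordNhd H F E e₀.proj) : g.localForm e e = g.localForm e₀ e :=
  have he := mem_coordNhd (H := H) (F := F) (E := E) e.proj
  InducedOn.eq (W := coordNhd H F E e.proj ⊓ coordNhd H F E e₀.proj) inf_le_left ⟨he, h⟩
    (g.inducedOn_localForm inf_le_left) (g.inducedOn_localForm inf_le_right)
    (g.formSmoothAt_localForm he) (g.formSmoothAt_localForm h)

/-- The symmetric bilinear form `g^{TE}` on the manifold `E` induced by `g`. -/
def SuperMetric.totalForm (g : SuperMetric H F E p) : SymmetricForm H F E where
  toFun e := g.localForm e e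
  symm e v w := by
    have he := mem_coordNhd (H := H) (F := F) (E := E) e.proj
    rw [g.localForm_apply he, g.localForm_apply he, g.coordBilin_symm]
  contMDiff e₀ := by
    have h₀ := mem_coordNhd (H := H) (F := F) (E := E) e₀.proj
    -- The form is defined at each point in that point's own coordinates; near `e₀` it agrees with
    -- the form in the fixed coordinates at `e₀`.
    refine (g.formSmoothAt_localForm h₀).congr_of_eventuallyEq ?_
    filter_upwards [eventually_mem_coordNhd h₀] with e he
    rw [g.localForm_eq he]

theorem SuperMetric.isInducedBy_totalForm (g : SuperMetric H F E p) :
    IsInducedBy g g.totalForm := by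
  intro U X Y X' Y' hX hY hX' hY' e he
  -- `U` need not be a coordinate domain, but all the data restrict to a neighbourhood of the base
  -- point that lies in one.
  have heW : e.proj ∈ U ⊓ coordNhd H F E e.proj := ⟨he, mem_coordNhd e.proj⟩
  have h := g.inducedOn_localForm (e₀ := e) (W := U ⊓ coordNhd H F E e.proj) inf_le_right
    (SuperGeom.resT inf_le_left X) (SuperGeom.resT inf_le_left Y) X' Y' (hX.resT _) (hY.resT _)
    (hX'.resT _) (hY'.resT _) e heW
  rw [← g.map_res, affineFun_res _ _ heW] at h
  exact h

theorem IsInducedBy.eq {g : SuperMetric H F E p} {h₁ h₂ : SymmetricForm H F E}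
    (hi₁ : IsInducedBy g h₁) (hi₂ : IsInducedBy g h₂) : h₁ = h₂ := by
  have key : h₁.toFun = h₂.toFun := funext fun e =>
    InducedOn.eq le_rfl (mem_coordNhd e.proj) (hi₁ _) (hi₂ _) (h₁.contMDiff e) (h₂.contMDiff e)
  cases h₁; cases h₂; cases key; rfl

theorem SuperMetric.isInducedBy_iff (g : SuperMetric H F E p) (h : SymmetricForm H F E) :
    IsInducedBy g h ↔ h = g.totalForm :=
  ⟨fun hi => hi.eq g.isInducedBy_totalForm, fun hi => hi ▸ g.isInducedBy_totalForm⟩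

theorem SuperMetric.isPseudoRiemannian_totalForm (g : SuperMetric H F E 1) :
    g.totalForm.IsPseudoRiemannian := by
  rintro e ⟨v, hv, h⟩
  have he := mem_coordNhd (H := H) (F := F) (E := E) e.proj
  refine hv ?_
  have h0 : tanCoord e e v = 0 := by
    refine g.coordBilin_nondegenerate (chart_mem_coordDom le_rfl he)
      (trivializationAt F E e.proj e).2 fun w => ?_
    rw [← h (tanSymm e e w), SuperMetric.totalForm, g.localForm_apply he, tanCoord_tanSymm he]
  rw [← tanSymm_tanCoord he v, h0, map_zero]

theorem SuperMetric.isDegenerateAt_totalForm (g : SuperMetric H F E 0)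
    (hF : 0 < Module.finrank ℝ F) (e : TotalSpace F E) : g.totalForm.IsDegenerateAt e := by
  have he := mem_coordNhd (H := H) (F := F) (E := E) e.proj
  have : Nontrivial F := Module.finrank_pos_iff.1 hF
  obtain ⟨a, ha⟩ := exists_ne (0 : F)
  -- A non-zero vertical vector, which exists because the rank is positive.
  refine ⟨tanSymm e e (0, a), fun h0 => ha ?_, fun w => ?_⟩
  · have h := tanCoord_tanSymm he ((0, a) : H × F)
    rw [h0, map_zero] at h
    exact (congrArg Prod.snd h).symm
  · rw [SuperMetric.totalForm, g.localForm_apply he, tanCoord_tanSymm he]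
    exact g.coordBilin_vertical (chart_mem_coordDom le_rfl he) _ _ _

end InducedForm

end SuperGeom

end

theorem corollary3p7 {M : Type*} [TopologicalSpace M] [T2Space M] [SecondCountableTopology M]
    {H : Type*} [NormedAddCommGroup H] [NormedSpace ℝ H] [FiniteDimensional ℝ H]
    [ChartedSpace H M] [IsManifold 𝓘(ℝ, H) ∞ M]
    {F : Type*} [NormedAddCommGroup F] [NormedSpace ℝ F] [FiniteDimensional ℝ F]
    {E : M → Type*} [∀ x, AddCommGroup (E x)] [∀ x, Module ℝ (E x)]
    [∀ x, TopologicalSpace (E x)] [TopologicalSpace (TotalSpace F E)]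
    [FiberBundle F E] [VectorBundle ℝ F E] [ContMDiffVectorBundle ∞ F E 𝓘(ℝ, H)] :
    (∀ g : SuperGeom.SuperMetric H F E 1, ∃ gTE : SuperGeom.SymmetricForm H F E,
      (∀ h : SuperGeom.SymmetricForm H F E, SuperGeom.IsInducedBy g h ↔ h = gTE) ∧
      gTE.IsPseudoRiemannian) ∧
    (∀ g : SuperGeom.SuperMetric H F E 0, ∃ gTE : SuperGeom.SymmetricForm H F E,
      (∀ h : SuperGeom.SymmetricForm H F E, SuperGeom.IsInducedBy g h ↔ h = gTE) ∧
      (0 < Module.finrank ℝ F → ∀ e : TotalSpace F E, gTE.IsDegenerateAt e)) :=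
  ⟨fun g => ⟨g.totalForm, g.isInducedBy_iff, g.isPseudoRiemannian_totalForm⟩,
    fun g => ⟨g.totalForm, g.isInducedBy_iff, g.isDegenerateAt_totalForm⟩⟩
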